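/- Let $\mathcal K$ be an oriented virtual knot, i.e. a class of oriented Gauss diagrams modulo isomorphisms and Reidemeister moves, and let $A$ be an abelian group. For a diagram $D$ of $\mathcal K$ let $\mathcal V(D)$ be the set of its classical crossings and $\mathcal A(D)$ the set of its arcs between consecutive classical crossings (the diagram without crossings has one closed arc). Let $\tilde D$ be the four-valent graph with vertices $\mathcal V(D)$ and edges $\mathcal A(D)$ (a circle with one closed edge if $D$ has no crossings), embedded in the closed oriented surface $AD(D)$ of the abstract knot diagram, let $C_1(D,A)=A^{\mathcal A(D)}$ and $H_1(D,A)=\ker(\partial\colon C_1(\tilde D,A)\to C_0(\tilde D,A))$, and let $x\cdot y\in A$ be the intersection number on $AD(D)$ of cycles $x\in H_1(D,\mathbb Z)$, $y\in H_1(D,A)$. For $v\in\mathcal V(D)$ let $D^l_v$ be the left half of $D$ at $v$, i.e. the part of $D$ that, when both strands at $v$ are drawn upwards, leaves $v$ to the upper left and runs until it first returns to $v$ from the lower left. A morphism $f\colon D\to D'$ is a composition of isomorphisms and Reidemeister moves; it induces a partial bijection $f_*$ of crossings. Arcs $a\in\mathcal A(D)$, $a'\in\mathcal A(D')$ correspond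 under an isomorphism if it takes one to the other, and under a Reidemeister move if they have a common point outside the area of the move. An *oriented parity* $p$ with coefficients in $A$ on the diagrams of $\mathcal K$ is a family of maps $p_D\colon\mathcal V(D)\to A$ such that * (P0) $p_D(v)=p_{D'}(f_*(v))$ for every morphism $f\colon D\to D'$ and every crossing $v$ for which $f_*(v)$ exists; * (P1) $p_D(v)=0$ if $v$ disappears in a decreasing first Reidemeister move; * (P2) $p_D(v_1)+p_D(v_2)=0$ if $v_1,v_2$ disappear in a decreasing second Reidemeister move; * (P3+) $\sum_{i=1}^3\epsilon_\Delta(v_i)\,p_D(v_i)=0$ for the crossings $v_1,v_2,v_3$ of a third Reidemeister move, where $\Delta$ is the disappearing triangle and $\epsilon_\Delta(v_i)=1$ if exactly one of the two sides of $\Delta$ at $v_i$ is directed away from $v_i$, and $\epsilon_\Delta(v_i)=-1$ otherwise. A *normalized invariant 1-cycle* $\delta$ with coefficients in $A$ is a family of cycles $\delta_D=\sum_{a\in\mathcal A(D)}\delta_D(a)\,a\in H_1(D,A)$ such that $\delta_D(a)=\delta_{D'}(a')$ whenever $a$ and $a'$ correspond under an isomorphism or a Reidemeister move $D\to D'$,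 and $D\cdot\delta_D=0$ for every diagram $D$. The *parity cycle* $\delta^p$ of an oriented parity $p$ is the family of chains whose coefficient at $a\in\mathcal A(D)$ is $p_{D'}(u)$, where $D'$ is obtained from $D$ by a second Reidemeister move between two equally directed pieces of $a$, so that $a$ now passes successively through $u,w,u,w$, where $u,w$ are the new crossings. Then: 1. For every normalized invariant 1-cycle $\delta$ the intersection formula $p^\delta_D(v)=D^l_v\cdot\delta_D$ defines an oriented parity $p^\delta$. 2. For every oriented parity $p$ the parity cycle $\delta^p$ is well defined (it does not depend on the choice of the second Reidemeister moves), it is a normalized invariant 1-cycle, and $p^{\delta^p}=p$. 3. For every normalized invariant 1-cycle $\delta$ one has $\delta^{p^\delta}=\delta$. 4. Consequently $\delta\mapsto p^\delta$ is an isomorphism, with inverse $p\mapsto\delta^p$, from the abelian group of normalized invariant 1-cycles to the abelian group of oriented parities with coefficients in $A$ on the diagrams of $\mathcal K$. -/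

import Mathlib

/-- An (oriented) Gauss diagram. `V` is the set of chords, i.e. of classical crossings. The chord
`v` has the two ends `(v, true)` (the overcrossing) and `(v, false)` (the undercrossing) on the
oriented core circle, and `next` sends an end to the end that follows it on the circle. If `V` is
empty, this is the diagram without crossings. -/
structure GaussDiagram : Type 1 where
  V : Type
  fintypeV : Fintype V
  decEqV : DecidableEq V
  sign : V → ℤˣ
  next : Equiv.Perm (V × Bool)
  cyclic : next.IsCycleOn Set.univ

namespace GaussDiagram

attribute [instance] GaussDiagram.fintypeV GaussDiagram.decEqV

/-- The ends of the chords, i.e. the passages of the knot through its classical crossings. -/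
abbrev Endpoint (D : GaussDiagram) : Type := D.V × Bool

/-- The arcs of a diagram: `edge e` starts at the passage `e` and ends at the passage `D.next e`;
a diagram without classical crossings has exactly one arc, the closed one. -/
inductive Arc (D : GaussDiagram) : Type
  | edge (e : D.Endpoint) : Arc D
  | circle (h : IsEmpty D.V) : Arc D

/-! ### Moves and the correspondences of crossings and arcs -/

/-- An isomorphism of Gauss diagrams (on planar virtual diagrams: isotopies and detour moves). -/
structure Iso (D D' : GaussDiagram) where
  equiv : D.V ≃ D'.V
  sign_eq : ∀ v, D'.sign (equiv v) = D.sign v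
  next_eq : ∀ e : D.Endpoint,
    D'.next (Prod.map equiv id e) = Prod.map equiv id (D.next e)

/-- `D'` is obtained from `D` by deleting the set `S` of chords: the remaining chords keep
their signs, directions, and the cyclic order of their ends. -/
structure Deletion (D D' : GaussDiagram) (S : Set D.V) where
  emb : D'.V ↪ D.V
  range_eq : Set.range emb = Sᶜ
  sign_eq : ∀ v, D.sign (emb v) = D'.sign v
  next_eq : ∀ e : D'.Endpoint, ∃ k : ℕ,
    (D.next ^ (k + 1)) (Prod.map emb id e) = Prod.map emb id (D'.next e) ∧
    ∀ j, 0 < j → j ≤ k → ((D.next ^ j) (Prod.map emb id e)).1 ∈ S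

/-- The arc `edge f` of `D` is a part of the arc `a'` of `D'` into which it is merged by the
deletion. -/
def Deletion.Covers {D D' : GaussDiagram} {S : Set D.V} (d : Deletion D D' S)
    (f : D.Endpoint) : D'.Arc → Prop
  | .edge e => ∃ k : ℕ, (D.next ^ k) (Prod.map d.emb id e) = f ∧
      ∀ j, 0 < j → j ≤ k → ((D.next ^ j) (Prod.map d.emb id e)).1 ∈ S
  | .circle _ => True

/-- A decreasing first Reidemeister move `D → D'`: deletion of a chord with adjacent ends. The
small arc (the loop that disappears) is `edge x`. -/
structure R1 (D D' : GaussDiagram) where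
  x : D.Endpoint
  next_x : (D.next x).1 = x.1 ∧ (D.next x).2 ≠ x.2
  del : Deletion D D' {x.1}

/-- A decreasing second Reidemeister move `D → D'`: deletion of two chords of opposite signs whose
over-ends are adjacent and whose under-ends are adjacent. The small arcs (the two sides of the bigon
that disappears) are `edge x` on the over-strand and `edge y` on the under-strand. -/
structure R2 (D D' : GaussDiagram) where
  x : D.Endpoint
  y : D.Endpoint
  over_x : x.2 = true ∧ (D.next x).2 = true
  under_y : y.2 = false ∧ (D.next y).2 = false
  ne : x.1 ≠ (D.next x).1
  chords : (y.1 = x.1 ∧ (D.next y).1 = (D.next x).1) ∨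
    (y.1 = (D.next x).1 ∧ (D.next y).1 = x.1)
  sign_neg : D.sign (D.next x).1 = - D.sign x.1
  del : Deletion D D' {x.1, (D.next x).1}

/-- `e` and `f` are neighbours on the core circle, in the order `e, f` if `s = 1` and in the
order `f, e` if `s = -1`. -/
def Adjacent (D : GaussDiagram) (s : ℤˣ) (e f : D.Endpoint) : Prop :=
  if s = 1 then D.next e = f else D.next f = e

/-- A third Reidemeister move `D → D'`. The crossing `a` is top strand over middle strand,
`b` is top over bottom, `c` is middle over bottom. The signs `t`, `m`, `l` tell in which order the
top, middle and bottom strands pass their two crossings, and `triangle` says that the signs of the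
crossings are those of three oriented strands in the plane which bound a triangle (each
of the three products is the orientation of the triangle `abc`). The move exchanges the two
ends of each of the three small arcs. -/
structure R3 (D D' : GaussDiagram) where
  a : D.V
  b : D.V
  c : D.V
  ne_ab : a ≠ b
  ne_ac : a ≠ c
  ne_bc : b ≠ c
  t : ℤˣ
  m : ℤˣ
  l : ℤˣ
  top : D.Adjacent t (a, true) (b, true)
  mid : D.Adjacent m (a, false) (c, true)
  bot : D.Adjacent l (b, false) (c, false)
  triangle : t * m * D.sign a = t * l * D.sign b ∧ t * l * D.sign b = m * l * D.sign c
  equiv : D.V ≃ D'.V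
  sign_eq : ∀ v, D'.sign (equiv v) = D.sign v
  next_eq : ∀ e : D.Endpoint,
    let τ : Equiv.Perm D.Endpoint := Equiv.swap (a, true) (b, true) *
      Equiv.swap (a, false) (c, true) * Equiv.swap (b, false) (c, false)
    D'.next (Prod.map equiv id (τ e)) = Prod.map equiv id (τ (D.next e))

/-- The permutation that exchanges the two ends of each of the three small arcs. -/
def R3.flip {D D' : GaussDiagram} (r : R3 D D') : Equiv.Perm D.Endpoint :=
  Equiv.swap (r.a, true) (r.b, true) * Equiv.swap (r.a, false) (r.c, true) *
    Equiv.swap (r.b, false) (r.c, false)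

/-- The incidence index of the crossing `a` to the triangle `Δ` that disappears: it is `1` if
exactly one of the two sides of `Δ` at the crossing is directed away from it (so `Δ` lies to the
left or to the right of the crossing), and `-1` otherwise. -/
def R3.incA {D D' : GaussDiagram} (r : R3 D D') : ℤˣ := - (r.t * r.m)
/-- The incidence index of the crossing `b`, see `R3.incA`. -/
def R3.incB {D D' : GaussDiagram} (r : R3 D D') : ℤˣ := r.t * r.l
/-- The incidence index of the crossing `c`, see `R3.incA`. -/
def R3.incC {D D' : GaussDiagram} (r : R3 D D') : ℤˣ := - (r.m * r.l)

/-- Correspondence of crossings under a decreasing first or second Reidemeister move. -/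
def Deletion.CrossingCorr {D D' : GaussDiagram} {S : Set D.V} (d : Deletion D D' S)
    (v : D.V) (v' : D'.V) : Prop := d.emb v' = v

/-- Correspondence of arcs under an isomorphism. -/
inductive Iso.ArcCorr {D D' : GaussDiagram} (i : Iso D D') : D.Arc → D'.Arc → Prop
  | edge (e : D.Endpoint) : Iso.ArcCorr i (.edge e) (.edge (Prod.map i.equiv id e))
  | circle (h : IsEmpty D.V) (h' : IsEmpty D'.V) : Iso.ArcCorr i (.circle h) (.circle h')

/-- Correspondence of arcs under a decreasing first Reidemeister move: the arcs have a common
point outside the area of the move. The small arc corresponds to nothing. -/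
inductive R1.ArcCorr {D D' : GaussDiagram} (r : R1 D D') : D.Arc → D'.Arc → Prop
  | edge (f : D.Endpoint) (a' : D'.Arc) (hx : f ≠ r.x) (h : r.del.Covers f a') :
      R1.ArcCorr r (.edge f) a'

/-- Correspondence of arcs under a decreasing second Reidemeister move: the arcs have a common
point outside the area of the move. The two small arcs correspond to nothing. -/
inductive R2.ArcCorr {D D' : GaussDiagram} (r : R2 D D') : D.Arc → D'.Arc → Prop
  | edge (f : D.Endpoint) (a' : D'.Arc) (hx : f ≠ r.x) (hy : f ≠ r.y)
      (h : r.del.Covers f a') : R2.ArcCorr r (.edge f) a'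

/-- Correspondence of arcs under a third Reidemeister move. An arc `edge f` is small precisely when
`f` and `D.next f` are exchanged by the move; small arcs correspond to nothing. -/
inductive R3.ArcCorr {D D' : GaussDiagram} (r : R3 D D') : D.Arc → D'.Arc → Prop
  | edge (f : D.Endpoint) (h : D.next f ≠ r.flip f) :
      R3.ArcCorr r (.edge f) (.edge (Prod.map r.equiv id (r.flip f)))

/-- The elementary morphisms of diagrams: isomorphisms and Reidemeister moves. -/
inductive Move (D D' : GaussDiagram) : Type
  | iso (i : Iso D D')
  | r1 (r : R1 D D')
  | r1Inv (r : R1 D' D)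
  | r2 (r : R2 D D')
  | r2Inv (r : R2 D' D)
  | r3 (r : R3 D D')

/-- The correspondence (a partial bijection) of crossings induced by an elementary morphism. -/
def Move.CrossingCorr {D D' : GaussDiagram} : Move D D' → D.V → D'.V → Prop
  | .iso i, v, v' => i.equiv v = v'
  | .r1 r, v, v' => r.del.CrossingCorr v v'
  | .r1Inv r, v, v' => r.del.CrossingCorr v' v
  | .r2 r, v, v' => r.del.CrossingCorr v v'
  | .r2Inv r, v, v' => r.del.CrossingCorr v' v
  | .r3 r, v, v' => r.equiv v = v'

/-- The correspondence of arcs induced by an elementary morphism. -/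
def Move.ArcCorr {D D' : GaussDiagram} : Move D D' → D.Arc → D'.Arc → Prop
  | .iso i, a, a' => i.ArcCorr a a'
  | .r1 r, a, a' => r.ArcCorr a a'
  | .r1Inv r, a, a' => r.ArcCorr a' a
  | .r2 r, a, a' => r.ArcCorr a a'
  | .r2Inv r, a, a' => r.ArcCorr a' a
  | .r3 r, a, a' => r.ArcCorr a a'

/-- The morphisms of the diagram category: finite compositions of elementary morphisms. -/
inductive Morphism : GaussDiagram → GaussDiagram → Type 1
  | refl (D : GaussDiagram) : Morphism D D
  | comp {D D' D'' : GaussDiagram} (f : Morphism D D') (m : Move D' D'') : Morphism D D''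

/-- The partial bijection `f_*` of crossings induced by a morphism. -/
def Morphism.CrossingCorr : {D D' : GaussDiagram} → Morphism D D' → D.V → D'.V → Prop
  | _, _, .refl _, v, v' => v = v'
  | _, _, .comp f m, v, v' => ∃ w, Morphism.CrossingCorr f v w ∧ m.CrossingCorr w v'

/-! ### Chains, cycles and intersection numbers

At a crossing `v` draw both strands upwards: one goes from the lower left to the upper right, and
the other one from the lower right to the upper left. The first one is the overcrossing if `v` is
positive, and the undercrossing if `v` is negative. -/

/-- The passage through `v` from the lower left to the upper right. -/
def ltr (D : GaussDiagram) (v : D.V) : D.Endpoint := (v, decide (D.sign v = 1))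

/-- The passage through `v` from the lower right to the upper left. -/
def rtl (D : GaussDiagram) (v : D.V) : D.Endpoint := (v, !decide (D.sign v = 1))

/-- The incoming arc at a passage. -/
def incoming (D : GaussDiagram) (e : D.Endpoint) : D.Arc := .edge (D.next.symm e)

/-- The outgoing arc at a passage. -/
def outgoing (D : GaussDiagram) (e : D.Endpoint) : D.Arc := .edge e

/-- The group `C₁(D, A)` of 1-chains on the arcs of `D`. -/
abbrev Chain (D : GaussDiagram) (A : Type*) := D.Arc → A

/-- The boundary map `C₁(D, A) → C₀(D, A)` of the covering graph: an arc goes to its end minus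
its start. -/
def boundary (D : GaussDiagram) (A : Type*) [AddCommGroup A] : D.Chain A →+ (D.V → A) where
  toFun c v := c (D.incoming (D.ltr v)) + c (D.incoming (D.rtl v))
    - c (D.outgoing (D.ltr v)) - c (D.outgoing (D.rtl v))
  map_zero' := by ext v; simp
  map_add' c d := by ext v; simp only [Pi.add_apply]; abel

/-- The group `H₁(D, A)` of 1-cycles. -/
def H1 (D : GaussDiagram) (A : Type*) [AddCommGroup A] : AddSubgroup (D.Chain A) :=
  (D.boundary A).ker

/-- The intersection number `x · y` of two cycles on the oriented surface `AD(D)`. The cycle `x` is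
pushed off slightly to the left of the (oriented) arcs of `D`, and near each crossing it is led
through the quadrant on the left. Then at `v` it meets only the upper left arc (outgoing,
from left to right) and the lower left arc (incoming, from right to left). An intersection point
is counted with `+1` if the pair (direction of `x`, direction of `y`) is positively oriented. -/
def inter (D : GaussDiagram) {A : Type*} [AddCommGroup A] (x : D.Chain ℤ) (y : D.Chain A) : A :=
  ∑ v : D.V, (x (D.outgoing (D.ltr v)) • y (D.outgoing (D.rtl v))
    - x (D.incoming (D.rtl v)) • y (D.incoming (D.ltr v)))

/-- The diagram `D` itself as an integral 1-cycle. -/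
def fundamental (D : GaussDiagram) : D.Chain ℤ := fun _ => 1

open Classical in
/-- The left half `D^l_v`: the part of the diagram that leaves `v` along the upper left arc and
runs until it arrives at `v` along the lower left arc for the first time. -/
noncomputable def leftHalf (D : GaussDiagram) (v : D.V) : D.Chain ℤ
  | .edge e => if ∃ k : ℕ, (D.next ^ k) (D.rtl v) = e ∧
      ∀ j ≤ k, (D.next ^ j) (D.rtl v) ≠ D.ltr v then 1 else 0
  | .circle _ => 0

/-- The equivalence of Gauss diagrams generated by isomorphisms and Reidemeister moves. -/
def knotSetoid : Setoid GaussDiagram :=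
  Relation.EqvGen.setoid fun D D' => Nonempty (Move D D')

end GaussDiagram

/-- An oriented virtual knot: an equivalence class of Gauss diagrams. -/
def VirtualKnot : Type 1 := Quotient GaussDiagram.knotSetoid

namespace VirtualKnot

open GaussDiagram

/-- The diagrams of the virtual knot `K`. -/
def Diagram (K : VirtualKnot) : Type 1 := {D : GaussDiagram // Quotient.mk knotSetoid D = K}

/-- Families of maps `p_D : V(D) → A`, one for each diagram `D` of the knot. -/
abbrev CrossingFamily (K : VirtualKnot) (A : Type*) := ∀ D : K.Diagram, D.1.V → A

/-- Families of 1-chains, one for each diagram `D` of the knot. -/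
abbrev ChainFamily (K : VirtualKnot) (A : Type*) := ∀ D : K.Diagram, D.1.Chain A

variable {K : VirtualKnot} {A : Type*} [AddCommGroup A]

/-- Oriented parities with coefficients in `A` on the diagrams of `K`. -/
structure IsOrientedParity (p : K.CrossingFamily A) : Prop where
  P0 : ∀ (D D' : K.Diagram) (f : Morphism D.1 D'.1) (v : D.1.V) (v' : D'.1.V),
    f.CrossingCorr v v' → p D v = p D' v'
  P1 : ∀ (D D' : K.Diagram) (r : R1 D.1 D'.1), p D r.x.1 = 0
  P2 : ∀ (D D' : K.Diagram) (r : R2 D.1 D'.1), p D r.x.1 + p D (D.1.next r.x).1 = 0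
  P3 : ∀ (D D' : K.Diagram) (r : R3 D.1 D'.1),
    r.incA • p D r.a + r.incB • p D r.b + r.incC • p D r.c = 0

/-- Normalized invariant 1-cycles with coefficients in `A` on the diagrams of `K`. -/
structure IsNormalizedInvariantCycle (δ : K.ChainFamily A) : Prop where
  cycle : ∀ D : K.Diagram, δ D ∈ D.1.H1 A
  invariant : ∀ (D D' : K.Diagram) (m : Move D.1 D'.1) (a : D.1.Arc) (a' : D'.1.Arc),
    m.ArcCorr a a' → δ D a = δ D' a'
  normalized : ∀ D : K.Diagram, D.1.inter D.1.fundamental (δ D) = 0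

variable (K A) in
/-- The group `𝒫(K, A)` of oriented parities. -/
def orientedParities : AddSubgroup (K.CrossingFamily A) where
  carrier := {p | IsOrientedParity p}
  zero_mem' := ⟨fun _ _ _ _ _ _ => rfl, fun _ _ _ => rfl, fun _ _ _ => by simp,
    fun _ _ _ => by simp⟩
  add_mem' {p q} hp hq := by
    refine ⟨fun D D' f v v' h => ?_, fun D D' r => ?_, fun D D' r => ?_, fun D D' r => ?_⟩
    · simp only [Pi.add_apply, hp.P0 D D' f v v' h, hq.P0 D D' f v v' h]
    · simp only [Pi.add_apply, hp.P1 D D' r, hq.P1 D D' r, add_zero]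
    · have h := congrArg₂ (· + ·) (hp.P2 D D' r) (hq.P2 D D' r)
      simp only [add_zero] at h
      simp only [Pi.add_apply]
      rw [← h]; abel
    · have h := congrArg₂ (· + ·) (hp.P3 D D' r) (hq.P3 D D' r)
      simp only [add_zero] at h
      simp only [Pi.add_apply, smul_add]
      rw [← h]; abel
  neg_mem' {p} hp := by
    refine ⟨fun D D' f v v' h => ?_, fun D D' r => ?_, fun D D' r => ?_, fun D D' r => ?_⟩
    · simp only [Pi.neg_apply, hp.P0 D D' f v v' h]
    · simp only [Pi.neg_apply, hp.P1 D D' r, neg_zero]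
    · simp only [Pi.neg_apply]
      rw [← neg_add, hp.P2 D D' r, neg_zero]
    · simp only [Pi.neg_apply, smul_neg]
      rw [← neg_add, ← neg_add, hp.P3 D D' r, neg_zero]

variable (K A) in
/-- The group `𝒩ℐ𝒞(K, A)` of normalized invariant cycles. -/
def normalizedInvariantCycles : AddSubgroup (K.ChainFamily A) where
  carrier := {δ | IsNormalizedInvariantCycle δ}
  zero_mem' := ⟨fun D => (D.1.H1 A).zero_mem, fun _ _ _ _ _ _ => rfl, fun D => by simp [inter]⟩
  add_mem' {δ η} hδ hη := by
    refine ⟨fun D => (D.1.H1 A).add_mem (hδ.cycle D) (hη.cycle D), fun D D' m a a' h => ?_,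
      fun D => ?_⟩
    · simp only [Pi.add_apply, hδ.invariant D D' m a a' h, hη.invariant D D' m a a' h]
    · have h := congrArg₂ (· + ·) (hδ.normalized D) (hη.normalized D)
      simp only [add_zero] at h
      rw [← h]
      simp only [inter, Pi.add_apply, smul_add, ← Finset.sum_add_distrib]
      exact Finset.sum_congr rfl fun v _ => by abel
  neg_mem' {δ} hδ := by
    refine ⟨fun D => (D.1.H1 A).neg_mem (hδ.cycle D), fun D D' m a a' h => ?_, fun D => ?_⟩
    · simp only [Pi.neg_apply, hδ.invariant D D' m a a' h]
    · have h := congrArg (- ·) (hδ.normalized D)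
      simp only [neg_zero] at h
      rw [← h]
      simp only [inter, Pi.neg_apply, smul_neg, ← Finset.sum_neg_distrib]
      exact Finset.sum_congr rfl fun v _ => by abel

/-- The intersection formula `p^δ_D(v) = D^l_v · δ_D`. -/
noncomputable def intersectionParity (δ : K.ChainFamily A) : K.CrossingFamily A :=
  fun D v => D.1.inter (D.1.leftHalf v) (δ D)

/-- `r : D' → D` is the inverse of an increasing second Reidemeister move which is applied to two
parallel (equally directed) pieces of one and the same arc `a` of `D`: in `D'` the arc `a` passes
successively through `u, w, u, w`, where `u, w` are the new crossings, and `u` is `r.x.1`. -/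
def IsSelfMove {D D' : GaussDiagram} (r : R2 D' D) (a : D.Arc) : Prop :=
  r.y.1 = r.x.1 ∧
    ((D'.next (D'.next r.x) = r.y ∧ r.ArcCorr (.edge (D'.next r.x)) a) ∨
      (D'.next (D'.next r.y) = r.x ∧ r.ArcCorr (.edge (D'.next r.y)) a))

/-- `δ` is the parity cycle of `p`: the coefficient `δ_a` is the parity of the first of the two
crossings that are produced by a second Reidemeister move between two parallel pieces of `a`.
Such moves exist, and all of them give the same value. -/
def IsParityCycle (p : K.CrossingFamily A) (δ : K.ChainFamily A) : Prop :=
  ∀ (D : K.Diagram) (a : D.1.Arc),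
    (∃ (D' : K.Diagram) (r : R2 D'.1 D.1), IsSelfMove r a) ∧
    ∀ (D' : K.Diagram) (r : R2 D'.1 D.1), IsSelfMove r a → δ D a = p D' r.x.1

end VirtualKnot

/-!
The two directions of the correspondence rest on one notion, that of a potential.

Push the diagram `D` off to its left. Walking along the pushed copy, one meets a 1-chain `y` near
each passage through a crossing, and a potential of `y` (`IsPotential`) is a function on the arcs
that changes by this local intersection number at each passage. Since the diagram is a single
closed curve, potentials exist if and only if `D · y = 0` (`exists_isPotential`,
`IsPotential.inter_fundamental_eq_zero`). Summation by parts turns the intersection number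
`D^l_v · y` into the difference `jump` of a potential at the two ends of the left half
(`IsPotential.inter_leftHalf`).

*From cycles to parities.* By the last formula the axioms of a parity are local statements. With a
potential, the relations for vanishing crossings are linear algebra at the crossings of the move
(`R1.jump_eq_zero`, `R2.jump_add_jump`, `R3.jump_relation`). For the invariance, a potential is
carried through each move: a decreasing first or second move only merges arcs on which the potential
agrees (`Deletion.SmallArcs.isPotential`), and a third move changes it only on the sides of the
triangle (`R3.isPotential`, `R3.jump_map`).

*From parities to cycles.* Diagrams are cut open at an arc, the closing arc, and written as linear
Gauss codes (`Word`, `Spelling`), on which the moves are operations on lists. Cutting a word into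
`X ++ Y` chooses a second arc, and a second Reidemeister move between the closing arc and that arc
creates a `bigon`. The value of the parity at its first crossing, `bigonValue p X Y`, does not
depend on the labels and the signs of the new crossings (`wordValue_bigon`). Pushing a strand from the
closing arc to both sides of a quadrant at a crossing `v`, the relation of a triangle shows that the
value of `v` is the difference of two values of bigons, for the left and for the right quadrant
(`wordValue_eq_sub`, `wordValue_eq_sub'`). Applied to the crossings of auxiliary bigons, the same
relations give identities between the values of the bigons that connect three arcs
(`bigonValue_add_sub`, `bigonValue_add_sub'`, `bigonValue_nil_right`). The coefficient of the parity
cycle at an arc is the value of the bigon of the closing arc with itself, when the diagram is cut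
open at this arc (`parityCycle`), and the identities say that minus the values of the bigons of a
fixed closing arc with the other arcs are a potential of the parity cycle (`bigonValue_crossing`,
`isPotential_bigonPotential`) whose `jump` at `v` is `p v`. So the parity cycle is a normalized
cycle and gives back `p`. It is invariant because a move can be performed in the presence of a bigon on an
arc that survives the move (`bigonValue_nil_eq_of_move`).

*The two constructions are inverse to each other.* The moves in the definition of the parity cycle
exist and have the value of `parityCycle` (`exists_selfMove`, `eq_parityCycle_of_selfMove`), and
for a normalized invariant cycle `δ` the intersection formula takes the value `δ D a` at the first
crossing of such a move on the arc `a` (`intersectionParity_selfMove`).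
-/

/-! ### Potentials and intersection numbers -/

namespace GaussDiagram

variable {A : Type*} [AddCommGroup A]

/-- A potential of a 1-chain `y`: a function on the arcs (`φ e` belongs to the arc that starts at
the passage `e`) which changes at each passage by the intersection number of `y` with the piece of
the diagram around this passage, pushed off to the left. At a crossing drawn upwards, the piece from
the lower left to the upper right then meets only the upper left arc, and the other one meets only
the lower left arc. -/
structure IsPotential (D : GaussDiagram) (y : D.Chain A) (φ : D.Endpoint → A) : Prop where
  ltr : ∀ v, φ (D.ltr v) = φ (D.next.symm (D.ltr v)) + y (.edge (D.rtl v))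
  rtl : ∀ v, φ (D.rtl v) = φ (D.next.symm (D.rtl v)) - y (.edge (D.next.symm (D.ltr v)))

theorem eq_ltr_or_eq_rtl (D : GaussDiagram) (e : D.Endpoint) :
    e = D.ltr e.1 ∨ e = D.rtl e.1 := by
  obtain ⟨v, b⟩ := e
  cases b <;> by_cases h : D.sign v = 1 <;> simp [ltr, rtl, h]

theorem ltr_ne_rtl (D : GaussDiagram) (v w : D.V) : D.ltr v ≠ D.rtl w := by
  intro h
  obtain ⟨h1, h2⟩ := Prod.ext_iff.1 h
  simp only [ltr, rtl] at h1 h2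
  subst h1
  simp at h2

theorem rtl_inj (D : GaussDiagram) {v w : D.V} : D.rtl v = D.rtl w ↔ v = w :=
  ⟨fun h => congrArg Prod.fst h, fun h => h ▸ rfl⟩

theorem sum_endpoint (D : GaussDiagram) (f : D.Endpoint → A) :
    ∑ e, f e = ∑ v, (f (D.ltr v) + f (D.rtl v)) := by
  rw [Fintype.sum_prod_type]
  refine Finset.sum_congr rfl fun v _ => ?_
  rw [Fintype.sum_bool]
  by_cases h : D.sign v = 1
  · simp [ltr, rtl, h]
  · simp [ltr, rtl, h, add_comm]

/-- The contribution of a passage to the intersection number of the diagram with `y`: the prescribed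
change of a potential at this passage. -/
def increment (D : GaussDiagram) (y : D.Chain A) (e : D.Endpoint) : A :=
  if e = D.ltr e.1 then y (.edge (D.rtl e.1)) else - y (.edge (D.next.symm (D.ltr e.1)))

theorem increment_ltr (D : GaussDiagram) (y : D.Chain A) (v : D.V) :
    D.increment y (D.ltr v) = y (.edge (D.rtl v)) := by
  exact if_pos rfl

theorem increment_rtl (D : GaussDiagram) (y : D.Chain A) (v : D.V) :
    D.increment y (D.rtl v) = - y (.edge (D.next.symm (D.ltr v))) := by
  exact if_neg (D.ltr_ne_rtl _ _).symm

theorem isPotential_iff (D : GaussDiagram) (y : D.Chain A) (φ : D.Endpoint → A) :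
    D.IsPotential y φ ↔ ∀ e, φ (D.next e) = φ e + D.increment y (D.next e) := by
  constructor
  · intro h e
    rcases D.eq_ltr_or_eq_rtl (D.next e) with h1 | h1
    · have := h.ltr (D.next e).1
      rw [← h1, Equiv.symm_apply_apply] at this
      rw [this, h1, increment_ltr]; rfl
    · have := h.rtl (D.next e).1
      rw [← h1, Equiv.symm_apply_apply] at this
      rw [this, h1, increment_rtl, sub_eq_add_neg]; rfl
  · refine fun h => ⟨fun v => ?_, fun v => ?_⟩
    · have := h (D.next.symm (D.ltr v))
      rwa [Equiv.apply_symm_apply, increment_ltr] at this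
    · have := h (D.next.symm (D.rtl v))
      rwa [Equiv.apply_symm_apply, increment_rtl, ← sub_eq_add_neg] at this

theorem inter_fundamental (D : GaussDiagram) (y : D.Chain A) :
    D.inter D.fundamental y = ∑ e, D.increment y e := by
  rw [sum_endpoint]
  simp only [inter, fundamental, one_smul, increment_ltr, increment_rtl, outgoing, incoming,
    sub_eq_add_neg]

theorem IsPotential.inter_fundamental_eq_zero {D : GaussDiagram} {y : D.Chain A}
    {φ : D.Endpoint → A} (h : D.IsPotential y φ) : D.inter D.fundamental y = 0 := by
  rw [inter_fundamental, ← Equiv.sum_comp D.next]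
  have : ∀ e, D.increment y (D.next e) = φ (D.next e) - φ e := fun e => by
    rw [(isPotential_iff D y φ).1 h e, add_sub_cancel_left]
  rw [Finset.sum_congr rfl fun e _ => this e, Finset.sum_sub_distrib, Equiv.sum_comp D.next φ,
    sub_self]

theorem exists_pow_next (D : GaussDiagram) (e f : D.Endpoint) :
    ∃ n < Fintype.card D.Endpoint, (D.next ^ n) e = f := by
  have h : D.next.IsCycleOn ((Finset.univ : Finset D.Endpoint) : Set D.Endpoint) := by
    simpa using D.cyclic
  exact h.exists_pow_eq (Finset.mem_univ e) (Finset.mem_univ f)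

theorem pow_next_inj (D : GaussDiagram) (e : D.Endpoint) {m n : ℕ}
    (hm : m < Fintype.card D.Endpoint) (hn : n < Fintype.card D.Endpoint)
    (h : (D.next ^ m) e = (D.next ^ n) e) : m = n := by
  have hc : D.next.IsCycleOn ((Finset.univ : Finset D.Endpoint) : Set D.Endpoint) := by
    simpa using D.cyclic
  have := (hc.pow_apply_eq_pow_apply (Finset.mem_univ e)).1 h
  exact Nat.ModEq.eq_of_lt_of_lt this (by simpa using hm) (by simpa using hn)

theorem pow_next_card (D : GaussDiagram) (e : D.Endpoint) :
    (D.next ^ Fintype.card D.Endpoint) e = e := by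
  have hc : D.next.IsCycleOn ((Finset.univ : Finset D.Endpoint) : Set D.Endpoint) := by
    simpa using D.cyclic
  simpa using hc.pow_card_apply (Finset.mem_univ e)

/-- A chain which has intersection number zero with the diagram has a potential: the increments are
summed up along the core circle, and their total is the intersection number. -/
theorem exists_isPotential (D : GaussDiagram) (y : D.Chain A)
    (h : D.inter D.fundamental y = 0) : ∃ φ, D.IsPotential y φ := by
  rcases isEmpty_or_nonempty D.V with hV | ⟨⟨v⟩⟩
  · exact ⟨fun _ => 0, fun v => hV.elim v, fun v => hV.elim v⟩
  set N := Fintype.card D.Endpoint with hN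
  set e₀ : D.Endpoint := (v, true)
  choose k hk using D.exists_pow_next e₀
  refine ⟨fun e => ∑ j ∈ Finset.range (k e), D.increment y ((D.next ^ (j + 1)) e₀),
    (isPotential_iff D y _).2 fun e => ?_⟩
  have hsucc : (D.next ^ (k e + 1)) e₀ = D.next e := by
    rw [pow_succ', Equiv.Perm.mul_apply, (hk e).2]
  have hadd : (∑ j ∈ Finset.range (k e), D.increment y ((D.next ^ (j + 1)) e₀))
      + D.increment y (D.next e)
      = ∑ j ∈ Finset.range (k e + 1), D.increment y ((D.next ^ (j + 1)) e₀) := by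
    rw [Finset.sum_range_succ, hsucc]
  rw [hadd]
  rcases Nat.lt_or_ge (k e + 1) N with hlt | hge
  · rw [D.pow_next_inj e₀ (hk (D.next e)).1 hlt ((hk (D.next e)).2.trans hsucc.symm)]
  · have heq : k e + 1 = N := le_antisymm (hk e).1 hge
    have h0 : k (D.next e) = 0 := by
      refine D.pow_next_inj e₀ (hk (D.next e)).1 (lt_of_le_of_lt (Nat.zero_le _) (hk e).1) ?_
      rw [(hk (D.next e)).2, ← hsucc, heq, hN, D.pow_next_card, pow_zero, Equiv.Perm.one_apply]
    rw [h0, heq, Finset.sum_range_zero, ← h, inter_fundamental]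
    symm
    refine Finset.sum_bij (fun j _ => (D.next ^ (j + 1)) e₀) (fun _ _ => Finset.mem_univ _)
      (fun i hi j hj hij => ?_) (fun f _ => ?_) fun _ _ => rfl
    · rw [Finset.mem_range] at hi hj
      simp only [pow_succ', Equiv.Perm.mul_apply] at hij
      exact D.pow_next_inj e₀ hi hj (D.next.injective hij)
    · refine ⟨k (D.next.symm f), Finset.mem_range.2 (hk _).1, ?_⟩
      rw [pow_succ', Equiv.Perm.mul_apply, (hk _).2, Equiv.apply_symm_apply]

section leftHalf

variable (D : GaussDiagram) (v : D.V)

theorem leftHalf_edge_eq_one {e : D.Endpoint} (k : ℕ) (hk : (D.next ^ k) (D.rtl v) = e)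
    (h : ∀ j ≤ k, (D.next ^ j) (D.rtl v) ≠ D.ltr v) : D.leftHalf v (.edge e) = 1 :=
  if_pos ⟨k, hk, h⟩

theorem leftHalf_rtl : D.leftHalf v (.edge (D.rtl v)) = 1 :=
  D.leftHalf_edge_eq_one v 0 rfl fun j hj => by
    rw [Nat.le_zero.1 hj]; exact (D.ltr_ne_rtl v v).symm

theorem leftHalf_ltr : D.leftHalf v (.edge (D.ltr v)) = 0 :=
  if_neg fun ⟨k, hk, h⟩ => h k le_rfl hk

theorem leftHalf_next {e : D.Endpoint} (hl : D.next e ≠ D.ltr v) (hr : D.next e ≠ D.rtl v) :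
    D.leftHalf v (.edge (D.next e)) = D.leftHalf v (.edge e) := by
  have hiff : (∃ k : ℕ, (D.next ^ k) (D.rtl v) = D.next e ∧
      ∀ j ≤ k, (D.next ^ j) (D.rtl v) ≠ D.ltr v) ↔
      ∃ k : ℕ, (D.next ^ k) (D.rtl v) = e ∧
      ∀ j ≤ k, (D.next ^ j) (D.rtl v) ≠ D.ltr v := by
    constructor
    · rintro ⟨k, hk, h⟩
      obtain _ | k := k
      · exact absurd hk.symm hr
      · rw [pow_succ', Equiv.Perm.mul_apply] at hk
        exact ⟨k, D.next.injective hk, fun j hj => h j (hj.trans k.le_succ)⟩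
    · rintro ⟨k, hk, h⟩
      have hs : (D.next ^ (k + 1)) (D.rtl v) = D.next e := by
        rw [pow_succ', Equiv.Perm.mul_apply, hk]
      refine ⟨k + 1, hs, fun j hj => ?_⟩
      rcases Nat.lt_or_ge k j with hkj | hkj
      · rw [le_antisymm hj hkj, hs]; exact hl
      · exact h j hkj
  by_cases h : ∃ k : ℕ, (D.next ^ k) (D.rtl v) = e ∧ ∀ j ≤ k, (D.next ^ j) (D.rtl v) ≠ D.ltr v
  · exact (if_pos (hiff.2 h)).trans (if_pos h).symm
  · exact (if_neg fun h' => h (hiff.1 h')).trans (if_neg h).symm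

theorem leftHalf_before_ltr : D.leftHalf v (.edge (D.next.symm (D.ltr v))) = 1 := by
  classical
  have hex : ∃ n, (D.next ^ n) (D.rtl v) = D.ltr v :=
    (D.exists_pow_next (D.rtl v) (D.ltr v)).imp fun _ h => h.2
  have hmin : ∀ j < Nat.find hex, (D.next ^ j) (D.rtl v) ≠ D.ltr v := fun j hj =>
    Nat.find_min hex hj
  have hsp := Nat.find_spec hex
  rcases h0 : Nat.find hex with _ | k
  · rw [h0] at hsp
    exact absurd hsp.symm (D.ltr_ne_rtl v v)
  · rw [h0] at hsp hmin
    refine D.leftHalf_edge_eq_one v k ?_ fun j hj => hmin j (Nat.lt_succ_of_le hj)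
    rw [pow_succ', Equiv.Perm.mul_apply] at hsp
    rw [← hsp, Equiv.symm_apply_apply]

theorem leftHalf_before_rtl : D.leftHalf v (.edge (D.next.symm (D.rtl v))) = 0 := by
  refine if_neg fun ⟨k, hk, h⟩ => ?_
  have hper : (D.next ^ (k + 1)) (D.rtl v) = D.rtl v := by
    rw [pow_succ', Equiv.Perm.mul_apply, hk, Equiv.apply_symm_apply]
  obtain ⟨n, -, hn⟩ := D.exists_pow_next (D.rtl v) (D.ltr v)
  refine h (n % (k + 1)) (Nat.lt_succ_iff.1 (Nat.mod_lt _ k.succ_pos)) ?_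
  rw [← hn]
  conv_rhs => rw [← Nat.mod_add_div n (k + 1), pow_add, Equiv.Perm.mul_apply, pow_mul]
  congr 1
  generalize n / (k + 1) = m
  induction m with
  | zero => rfl
  | succ m ih => rw [pow_succ, Equiv.Perm.mul_apply, hper]; exact ih

end leftHalf

/-- Summation by parts: the indicator function of the left half jumps only at the crossing, so only
the values of the potential on the two arcs at its ends remain. -/
theorem IsPotential.inter_leftHalf {D : GaussDiagram} {y : D.Chain A} {φ : D.Endpoint → A}
    (h : D.IsPotential y φ) (v : D.V) :
    D.inter (D.leftHalf v) y = φ (D.next.symm (D.ltr v)) - φ (D.rtl v) := by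
  classical
  set x : D.Endpoint → ℤ := fun e => D.leftHalf v (.edge e) with hx
  -- the last summand accounts for the jump of the indicator function before `D.rtl v`
  have hterm : ∀ w, D.leftHalf v (D.outgoing (D.ltr w)) • y (D.outgoing (D.rtl w))
      - D.leftHalf v (D.incoming (D.rtl w)) • y (D.incoming (D.ltr w))
      = (x (D.ltr w) • (φ (D.ltr w) - φ (D.next.symm (D.ltr w)))
        + x (D.rtl w) • (φ (D.rtl w) - φ (D.next.symm (D.rtl w))))
        - if w = v then φ (D.rtl w) - φ (D.next.symm (D.rtl w)) else 0 := by
    intro w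
    have h1 : x (D.next.symm (D.rtl w)) • y (.edge (D.next.symm (D.ltr w)))
        = - (x (D.rtl w) • (φ (D.rtl w) - φ (D.next.symm (D.rtl w))))
          + if w = v then φ (D.rtl w) - φ (D.next.symm (D.rtl w)) else 0 := by
      split_ifs with hw
      · subst hw
        have e1 : x (D.next.symm (D.rtl w)) = 0 := D.leftHalf_before_rtl w
        have e2 : x (D.rtl w) = 1 := D.leftHalf_rtl w
        rw [e1, e2]; simp
      · have e1 : x (D.rtl w) = x (D.next.symm (D.rtl w)) := by
          have := D.leftHalf_next v (e := D.next.symm (D.rtl w))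
            (by rw [Equiv.apply_symm_apply]; exact (D.ltr_ne_rtl v w).symm)
            (by rw [Equiv.apply_symm_apply, Ne, rtl_inj]; exact hw)
          rwa [Equiv.apply_symm_apply] at this
        rw [e1, h.rtl w]; simp
    have h2 : y (.edge (D.rtl w)) = φ (D.ltr w) - φ (D.next.symm (D.ltr w)) := by
      rw [h.ltr w]; simp
    change x (D.ltr w) • y (.edge (D.rtl w))
      - x (D.next.symm (D.rtl w)) • y (.edge (D.next.symm (D.ltr w))) = _
    rw [h1, h2]; abel
  rw [inter, Finset.sum_congr rfl fun w _ => hterm w, Finset.sum_sub_distrib,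
    ← sum_endpoint D fun e => x e • (φ e - φ (D.next.symm e)), Finset.sum_ite_eq' Finset.univ v]
  simp only [Finset.mem_univ, if_true, smul_sub, Finset.sum_sub_distrib]
  have hshift : ∑ e, x e • φ (D.next.symm e) = ∑ e, x (D.next e) • φ e := by
    rw [← Equiv.sum_comp D.next]; simp
  rw [hshift, ← Finset.sum_sub_distrib]
  have hne : D.next.symm (D.ltr v) ≠ D.next.symm (D.rtl v) := fun h' =>
    D.ltr_ne_rtl v v (D.next.symm.injective h')
  rw [← Finset.sum_subset (Finset.subset_univ
      {D.next.symm (D.ltr v), D.next.symm (D.rtl v)}), Finset.sum_pair hne]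
  · have e1 : x (D.next.symm (D.rtl v)) = 0 := D.leftHalf_before_rtl v
    have e2 : x (D.rtl v) = 1 := D.leftHalf_rtl v
    have e3 : x (D.next.symm (D.ltr v)) = 1 := D.leftHalf_before_ltr v
    have e4 : x (D.ltr v) = 0 := D.leftHalf_ltr v
    simp only [Equiv.apply_symm_apply, e1, e2, e3, e4]
    simp only [one_smul, zero_smul, sub_zero, zero_sub]
    abel
  · intro e _ he
    simp only [Finset.mem_insert, Finset.mem_singleton, not_or] at he
    have : x (D.next e) = x e := D.leftHalf_next v
      (fun h' => he.1 (by rw [← h', Equiv.symm_apply_apply]))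
      (fun h' => he.2 (by rw [← h', Equiv.symm_apply_apply]))
    rw [this, sub_self]

theorem mem_H1_iff (D : GaussDiagram) (y : D.Chain A) : y ∈ D.H1 A ↔
    ∀ v, y (.edge (D.next.symm (D.ltr v))) + y (.edge (D.next.symm (D.rtl v)))
      = y (.edge (D.ltr v)) + y (.edge (D.rtl v)) := by
  rw [H1, AddMonoidHom.mem_ker, funext_iff]
  refine forall_congr' fun v => ?_
  change y (.edge (D.next.symm (D.ltr v))) + y (.edge (D.next.symm (D.rtl v)))
    - y (.edge (D.ltr v)) - y (.edge (D.rtl v)) = 0 ↔ _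
  rw [sub_sub, sub_eq_zero]

end GaussDiagram

/-! ### The relations at the crossings of a move -/

namespace GaussDiagram

variable {A : Type*} [AddCommGroup A]

section moves

variable {D D' : GaussDiagram}

/-- The value of the intersection formula at `v`, in terms of a potential: the difference between
the lower left and the upper left arc. -/
def jump (D : GaussDiagram) (φ : D.Endpoint → A) (v : D.V) : A :=
  φ (D.next.symm (D.ltr v)) - φ (D.rtl v)

theorem R1.jump_eq_zero (r : R1 D D') {y : D.Chain A} {φ : D.Endpoint → A}
    (hy : y ∈ D.H1 A) (h : D.IsPotential y φ) : D.jump φ r.x.1 = 0 := by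
  have hc := (D.mem_H1_iff y).1 hy r.x.1
  have h1 := h.ltr r.x.1
  have h2 := h.rtl r.x.1
  have hn := D.eq_ltr_or_eq_rtl (D.next r.x)
  rw [r.next_x.1] at hn
  have hne : D.next r.x ≠ r.x := fun h' => r.next_x.2 (congrArg Prod.snd h')
  have h3 := Equiv.symm_apply_apply D.next r.x
  rw [jump]
  rcases D.eq_ltr_or_eq_rtl r.x with h0 | h0 <;> rcases hn with hn | hn
  · exact absurd (hn.trans h0.symm) hne
  · rw [hn] at h3
    generalize r.x.1 = v at *
    grind
  · rw [hn] at h3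
    generalize r.x.1 = v at *
    grind
  · exact absurd (hn.trans h0.symm) hne

theorem sides_of_sign (D : GaussDiagram) (v : D.V) :
    (D.sign v = 1 ∧ D.ltr v = (v, true) ∧ D.rtl v = (v, false)) ∨
      (D.sign v = -1 ∧ D.ltr v = (v, false) ∧ D.rtl v = (v, true)) := by
  rcases Int.units_eq_one_or (D.sign v) with h | h <;> simp [ltr, rtl, h]

theorem R2.jump_add_jump (r : R2 D D') {y : D.Chain A} {φ : D.Endpoint → A}
    (hy : y ∈ D.H1 A) (h : D.IsPotential y φ) :
    D.jump φ r.x.1 + D.jump φ (D.next r.x).1 = 0 := by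
  obtain ⟨u, bu, hu⟩ : ∃ u b, r.x = (u, b) := ⟨_, _, rfl⟩
  obtain ⟨w, bw, hw⟩ : ∃ w b, D.next r.x = (w, b) := ⟨_, _, rfl⟩
  have ho := r.over_x
  have hun := r.under_y
  have hch := r.chords
  have hs := r.sign_neg
  rw [hw, hu] at ho hch hs
  rw [hw, hu]
  simp only at ho hch hs
  obtain ⟨rfl, rfl⟩ := ho
  have hx : D.next.symm (w, true) = (u, true) := by rw [← hw, Equiv.symm_apply_apply, hu]
  have hcu := (D.mem_H1_iff y).1 hy u
  have hcw := (D.mem_H1_iff y).1 hy w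
  have h1 := h.ltr u
  have h2 := h.rtl u
  have h3 := h.ltr w
  have h4 := h.rtl w
  have hyy : (r.y = (u, false) ∧ D.next.symm (w, false) = (u, false)) ∨
      (r.y = (w, false) ∧ D.next.symm (u, false) = (w, false)) := by
    refine hch.imp (fun hh => ?_) fun hh => ?_
    · have e1 : r.y = (u, false) := Prod.ext hh.1 hun.1
      have e2 : D.next r.y = (w, false) := Prod.ext hh.2 hun.2
      exact ⟨e1, by rw [← e2, Equiv.symm_apply_apply, e1]⟩
    · have e1 : r.y = (w, false) := Prod.ext hh.1 hun.1
      have e2 : D.next r.y = (u, false) := Prod.ext hh.2 hun.2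
      exact ⟨e1, by rw [← e2, Equiv.symm_apply_apply, e1]⟩
  simp only [jump]
  clear hy h hch hun hu hw
  rcases D.sides_of_sign u with ⟨hu0, hu1, hu2⟩ | ⟨hu0, hu1, hu2⟩ <;>
  rcases D.sides_of_sign w with ⟨hw0, hw1, hw2⟩ | ⟨hw0, hw1, hw2⟩ <;>
  rw [hu0, hw0] at hs <;>
  first
  | exact absurd hs (by decide)
  | rcases hyy with ⟨-, hy2⟩ | ⟨-, hy2⟩ <;> grind

theorem Adjacent.next_eq_or {s : ℤˣ} {e f : D.Endpoint} (h : D.Adjacent s e f) :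
    (s = 1 ∧ D.next e = f) ∨ (s = -1 ∧ D.next f = e) := by
  rcases Int.units_eq_one_or s with rfl | rfl
  · rw [Adjacent, if_pos rfl] at h
    exact .inl ⟨rfl, h⟩
  · rw [Adjacent, if_neg (by decide)] at h
    exact .inr ⟨rfl, h⟩

theorem Adjacent.next_symm_eq_or {s : ℤˣ} {e f : D.Endpoint} (h : D.Adjacent s e f) :
    (s = 1 ∧ D.next.symm f = e) ∨ (s = -1 ∧ D.next.symm e = f) :=
  h.next_eq_or.imp (And.imp_right fun h => (Equiv.symm_apply_eq _).2 h.symm)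
    (And.imp_right fun h => (Equiv.symm_apply_eq _).2 h.symm)

theorem R3.jump_relation (r : R3 D D') {y : D.Chain A} {φ : D.Endpoint → A}
    (hy : y ∈ D.H1 A) (h : D.IsPotential y φ) :
    r.incA • D.jump φ r.a + r.incB • D.jump φ r.b + r.incC • D.jump φ r.c = 0 := by
  obtain ⟨a, b, c, -, -, -, t, m, l, ht, hm, hl, htr, -, -, -⟩ := r
  simp only [incA, incB, incC, jump]
  have hca := (D.mem_H1_iff y).1 hy a
  have hcb := (D.mem_H1_iff y).1 hy b
  have hcc := (D.mem_H1_iff y).1 hy c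
  have h1 := h.ltr a
  have h2 := h.rtl a
  have h3 := h.ltr b
  have h4 := h.rtl b
  have h5 := h.ltr c
  have h6 := h.rtl c
  clear h hy
  -- all signs and directions; those which do not fit a planar triangle contradict `triangle`
  obtain ⟨htr1, htr2⟩ := htr
  rcases D.sides_of_sign a with ⟨ha0, ha1, ha2⟩ | ⟨ha0, ha1, ha2⟩ <;>
  rcases D.sides_of_sign b with ⟨hb0, hb1, hb2⟩ | ⟨hb0, hb1, hb2⟩ <;>
  rcases D.sides_of_sign c with ⟨hc0, hc1, hc2⟩ | ⟨hc0, hc1, hc2⟩ <;>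
  rcases ht.next_symm_eq_or with ⟨rfl, ht1⟩ | ⟨rfl, ht1⟩ <;>
  rcases hm.next_symm_eq_or with ⟨rfl, hm1⟩ | ⟨rfl, hm1⟩ <;>
  rcases hl.next_symm_eq_or with ⟨rfl, hl1⟩ | ⟨rfl, hl1⟩ <;>
  rw [ha0, hb0] at htr1 <;> rw [hb0, hc0] at htr2 <;>
  first
  | exact absurd htr1 (by decide)
  | exact absurd htr2 (by decide)
  | (clear ht hm hl htr1 htr2
     simp only [mul_neg, neg_neg, mul_one, Units.neg_smul, one_smul]
     grind)

end moves

end GaussDiagram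

/-! ### Potentials under isomorphisms and decreasing moves -/

namespace GaussDiagram

variable {A : Type*} [AddCommGroup A] {D D' : GaussDiagram}

theorem Iso.map_ltr (i : Iso D D') (v : D.V) :
    D'.ltr (i.equiv v) = Prod.map i.equiv id (D.ltr v) := by
  simp [ltr, i.sign_eq]

theorem Iso.map_rtl (i : Iso D D') (v : D.V) :
    D'.rtl (i.equiv v) = Prod.map i.equiv id (D.rtl v) := by
  simp [rtl, i.sign_eq]

theorem Iso.next_symm (i : Iso D D') (e : D.Endpoint) :
    D'.next.symm (Prod.map i.equiv id e) = Prod.map i.equiv id (D.next.symm e) := by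
  rw [Equiv.symm_apply_eq, i.next_eq, Equiv.apply_symm_apply]

/-- Potentials are transported by isomorphisms. -/
theorem Iso.exists_isPotential (i : Iso D D') {y : D.Chain A} {y' : D'.Chain A}
    (hy : ∀ e, y (.edge e) = y' (.edge (Prod.map i.equiv id e))) {φ : D.Endpoint → A}
    (h : D.IsPotential y φ) :
    ∃ φ', D'.IsPotential y' φ' ∧ ∀ v, D'.jump φ' (i.equiv v) = D.jump φ v := by
  have hinv : ∀ e : D.Endpoint, Prod.map i.equiv.symm id (Prod.map i.equiv id e) = e := fun e => by
    simp [Prod.map]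
  refine ⟨fun e => φ (Prod.map i.equiv.symm id e), ⟨fun v' => ?_, fun v' => ?_⟩, fun v => ?_⟩
  · obtain ⟨v, rfl⟩ := i.equiv.surjective v'
    simp only [i.map_ltr, i.map_rtl, i.next_symm, hinv, ← hy]
    exact h.ltr v
  · obtain ⟨v, rfl⟩ := i.equiv.surjective v'
    simp only [i.map_ltr, i.map_rtl, i.next_symm, hinv, ← hy]
    exact h.rtl v
  · simp only [jump, i.map_ltr, i.map_rtl, i.next_symm, hinv]

variable {S : Set D.V}

theorem Deletion.emb_notMem (d : Deletion D D' S) (v : D'.V) : d.emb v ∉ S := by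
  have : d.emb v ∈ Set.range d.emb := ⟨v, rfl⟩
  rwa [d.range_eq] at this

theorem Deletion.map_ltr (d : Deletion D D' S) (v : D'.V) :
    Prod.map d.emb id (D'.ltr v) = D.ltr (d.emb v) := by
  simp [ltr, d.sign_eq]

theorem Deletion.map_rtl (d : Deletion D D' S) (v : D'.V) :
    Prod.map d.emb id (D'.rtl v) = D.rtl (d.emb v) := by
  simp [rtl, d.sign_eq]

theorem Deletion.covers_self (d : Deletion D D' S) (e : D'.Endpoint) :
    d.Covers (Prod.map d.emb id e) (.edge e) :=
  ⟨0, rfl, fun _ h0 h1 => absurd (h0.trans_le h1) (lt_irrefl 0)⟩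

/-- The last one of the arcs that are merged into the arc before the passage `e`. -/
theorem Deletion.covers_before (d : Deletion D D' S) (e : D'.Endpoint) :
    d.Covers (D.next.symm (Prod.map d.emb id e)) (.edge (D'.next.symm e)) := by
  obtain ⟨k, hk, hj⟩ := d.next_eq (D'.next.symm e)
  refine ⟨k, ?_, hj⟩
  rw [Equiv.apply_symm_apply] at hk
  rw [← hk, pow_succ', Equiv.Perm.mul_apply, Equiv.symm_apply_apply]

theorem Deletion.covers_next (d : Deletion D D' S) {f : D.Endpoint} {a : D'.Arc}
    (h : d.Covers f a) (hf : (D.next f).1 ∈ S) : d.Covers (D.next f) a := by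
  cases a with
  | circle => trivial
  | edge e =>
    obtain ⟨k, hk, hS⟩ := h
    have hk' : (D.next ^ (k + 1)) (Prod.map d.emb id e) = D.next f := by
      rw [pow_succ', Equiv.Perm.mul_apply, hk]
    refine ⟨k + 1, hk', fun j h0 h1 => ?_⟩
    rcases Nat.lt_or_ge k j with hkj | hkj
    · rwa [le_antisymm h1 hkj, hk']
    · exact hS j h0 hkj

theorem Deletion.covers_prev (d : Deletion D D' S) {f : D.Endpoint} {a : D'.Arc}
    (h : d.Covers f a) (hf : f.1 ∈ S) : d.Covers (D.next.symm f) a := by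
  cases a with
  | circle => trivial
  | edge e =>
    obtain ⟨k, hk, hS⟩ := h
    obtain _ | k := k
    · subst hk
      exact absurd hf (d.emb_notMem e.1)
    · refine ⟨k, ?_, fun j h0 h1 => hS j h0 (h1.trans k.le_succ)⟩
      rw [← hk, pow_succ', Equiv.Perm.mul_apply, Equiv.symm_apply_apply]

theorem Deletion.exists_emb_eq (d : Deletion D D' S) {f : D.Endpoint} (hf : f.1 ∉ S) :
    ∃ e : D'.Endpoint, Prod.map d.emb id e = f := by
  have : f.1 ∈ Set.range d.emb := by rwa [d.range_eq]
  obtain ⟨v, hv⟩ := this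
  exact ⟨(v, f.2), Prod.ext hv rfl⟩

theorem Deletion.exists_covers (d : Deletion D D' S) (f : D.Endpoint) :
    ∃ a, d.Covers f a := by
  rcases isEmpty_or_nonempty D'.V with hV | ⟨⟨v⟩⟩
  · exact ⟨.circle hV, trivial⟩
  obtain ⟨n, -, rfl⟩ := D.exists_pow_next (Prod.map d.emb id (v, true)) f
  induction n with
  | zero => exact ⟨_, d.covers_self (v, true)⟩
  | succ n ih =>
    rw [pow_succ', Equiv.Perm.mul_apply]
    by_cases hS : (D.next ((D.next ^ n) (Prod.map d.emb id (v, true)))).1 ∈ S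
    · exact ih.imp fun a ha => d.covers_next ha hS
    · obtain ⟨e, he⟩ := d.exists_emb_eq hS
      exact ⟨_, he ▸ d.covers_self e⟩

/-- A set `M` of arcs all of which disappear in a deletion, such that, up to these arcs, a function
`ψ` takes the same values on the arcs that are merged into one arc: an arc that does not belong to
`M` and starts at a deleted passage follows an arc of `M`, and has the same value as the arc before
that one. -/
structure Deletion.SmallArcs (_d : Deletion D D' S) (M : Set D.Endpoint) {B : Type*}
    (ψ : D.Endpoint → B) : Prop where
  start_mem : ∀ f ∈ M, f.1 ∈ S
  next_mem : ∀ f ∈ M, (D.next f).1 ∈ S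
  step : ∀ f : D.Endpoint, f.1 ∈ S → f ∉ M →
    ∃ s ∈ M, D.next s = f ∧ D.next.symm s ∉ M ∧ ψ f = ψ (D.next.symm s)

theorem Deletion.SmallArcs.eq_of_covers {d : Deletion D D' S} {M : Set D.Endpoint} {B : Type*}
    {ψ : D.Endpoint → B} (hM : d.SmallArcs M ψ) {f : D.Endpoint} {e : D'.Endpoint}
    (hf : f ∉ M) (h : d.Covers f (.edge e)) : ψ f = ψ (Prod.map d.emb id e) := by
  obtain ⟨k, hk, hS⟩ := h
  induction k using Nat.strong_induction_on generalizing f with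
  | _ k ih =>
    obtain _ | k := k
    · rw [← hk]; rfl
    obtain ⟨s, hsM, hs, hsM', hψ⟩ := hM.step f (hk ▸ hS (k + 1) k.succ_pos le_rfl) hf
    rw [pow_succ', Equiv.Perm.mul_apply, ← hs] at hk
    have hk' := D.next.injective hk
    obtain _ | m := k
    · subst hk'
      exact absurd (hM.start_mem _ hsM) (d.emb_notMem e.1)
    rw [hψ]
    refine ih m (by lia) hsM' ?_ fun j h0 h1 => hS j h0 (by lia)
    rw [← hk', pow_succ', Equiv.Perm.mul_apply, Equiv.symm_apply_apply]

/-- Potentials are inherited by the result of a deletion. -/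
theorem Deletion.SmallArcs.isPotential {d : Deletion D D' S} {M : Set D.Endpoint}
    {φ : D.Endpoint → A} (hM : d.SmallArcs M φ) {y : D.Chain A} {y' : D'.Chain A}
    (hy : ∀ f e, f ∉ M → d.Covers f (.edge e) → y (.edge f) = y' (.edge e))
    (h : D.IsPotential y φ) :
    D'.IsPotential y' (fun e => φ (Prod.map d.emb id e)) ∧
      ∀ v, D'.jump (fun e => φ (Prod.map d.emb id e)) v = D.jump φ (d.emb v) := by
  have hself : ∀ e : D'.Endpoint, Prod.map d.emb id e ∉ M := fun e he =>
    d.emb_notMem e.1 (hM.start_mem _ he)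
  have hbefore : ∀ e : D'.Endpoint, D.next.symm (Prod.map d.emb id e) ∉ M := fun e he => by
    have := hM.next_mem _ he
    rw [Equiv.apply_symm_apply] at this
    exact d.emb_notMem e.1 this
  have hφ : ∀ e : D'.Endpoint, φ (Prod.map d.emb id (D'.next.symm e))
      = φ (D.next.symm (Prod.map d.emb id e)) := fun e =>
    (hM.eq_of_covers (hbefore e) (d.covers_before e)).symm
  have hy1 : ∀ e : D'.Endpoint, y' (.edge e) = y (.edge (Prod.map d.emb id e)) := fun e =>
    (hy _ _ (hself e) (d.covers_self e)).symm
  have hy2 : ∀ e : D'.Endpoint, y' (.edge (D'.next.symm e))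
      = y (.edge (D.next.symm (Prod.map d.emb id e))) := fun e =>
    (hy _ _ (hbefore e) (d.covers_before e)).symm
  refine ⟨⟨fun v => ?_, fun v => ?_⟩, fun v => ?_⟩
  · simp only [hφ, hy1, d.map_ltr, d.map_rtl]
    exact h.ltr _
  · simp only [hφ, hy2, d.map_ltr, d.map_rtl]
    exact h.rtl _
  · simp only [jump, hφ, d.map_ltr, d.map_rtl]

theorem next_ne_self (D : GaussDiagram) (e : D.Endpoint) : D.next e ≠ e := by
  refine D.cyclic.apply_ne ⟨(e.1, true), trivial, (e.1, false), trivial, ?_⟩ trivial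
  simp

theorem R1.smallArcs (r : R1 D D') {y : D.Chain A} {φ : D.Endpoint → A}
    (hy : y ∈ D.H1 A) (h : D.IsPotential y φ) : r.del.SmallArcs {r.x} φ where
  start_mem := by rintro f rfl; rfl
  next_mem := by rintro f rfl; exact r.next_x.1
  step := by
    intro f hf hfx
    have hfn : D.next r.x = f := by
      have hf' : f.1 = r.x.1 := hf
      refine Prod.ext (r.next_x.1.trans hf'.symm) ?_
      have h2 : f.2 ≠ r.x.2 := fun h' => hfx (Prod.ext hf h')
      have h1 := r.next_x.2
      revert h1 h2
      generalize (D.next r.x).2 = p, f.2 = q, r.x.2 = s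
      decide +revert
    refine ⟨r.x, rfl, hfn, fun h' => ?_, ?_⟩
    · have h' : D.next.symm r.x = r.x := h'
      rw [Equiv.symm_apply_eq] at h'
      exact D.next_ne_self _ h'.symm
    · have hc := (D.mem_H1_iff y).1 hy r.x.1
      have h1 := h.ltr r.x.1
      have h2 := h.rtl r.x.1
      have hn := D.eq_ltr_or_eq_rtl (D.next r.x)
      rw [r.next_x.1] at hn
      have hne : D.next r.x ≠ r.x := D.next_ne_self _
      have h3 := Equiv.symm_apply_apply D.next r.x
      rw [← hfn]
      rcases D.eq_ltr_or_eq_rtl r.x with h0 | h0 <;> rcases hn with hn | hn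
      · exact absurd (hn.trans h0.symm) hne
      · rw [hn] at h3
        generalize r.x.1 = v at *
        grind
      · rw [hn] at h3
        generalize r.x.1 = v at *
        grind
      · exact absurd (hn.trans h0.symm) hne

theorem R2.next_x_ne (r : R2 D D') : D.next r.x ≠ r.y := fun h' => by
  have h1 := r.over_x.2; rw [h', r.under_y.1] at h1; cases h1

theorem R2.next_y_ne (r : R2 D D') : D.next r.y ≠ r.x := fun h' => by
  have h1 := r.under_y.2; rw [h', r.over_x.1] at h1; cases h1

theorem R2.next_x_mem (r : R2 D D') : (D.next r.x).1 ∈ ({r.x.1, (D.next r.x).1} : Set D.V) :=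
  Or.inr rfl

theorem R2.y_mem (r : R2 D D') : r.y.1 ∈ ({r.x.1, (D.next r.x).1} : Set D.V) :=
  r.chords.elim (fun h => Or.inl h.1) fun h => Or.inr h.1

theorem R2.next_y_mem (r : R2 D D') : (D.next r.y).1 ∈ ({r.x.1, (D.next r.x).1} : Set D.V) :=
  r.chords.elim (fun h => Or.inr h.2) fun h => Or.inl h.2

/-- The two outer pieces of each strand of a bigon belong to the same arc after the move. -/
theorem R2.exists_arcCorr (r : R2 D D') {s : D.Endpoint} (hs : s = r.x ∨ s = r.y) :
    ∃ a, r.ArcCorr (.edge (D.next.symm s)) a ∧ r.ArcCorr (.edge (D.next s)) a := by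
  have hmem : s.1 ∈ ({r.x.1, (D.next r.x).1} : Set D.V) ∧
      (D.next s).1 ∈ ({r.x.1, (D.next r.x).1} : Set D.V) := by
    rcases hs with rfl | rfl
    exacts [⟨Or.inl rfl, r.next_x_mem⟩, ⟨r.y_mem, r.next_y_mem⟩]
  have hne : D.next s ≠ r.x ∧ D.next s ≠ r.y := by
    rcases hs with rfl | rfl
    exacts [⟨D.next_ne_self _, r.next_x_ne⟩, ⟨r.next_y_ne, D.next_ne_self _⟩]
  have hne' : D.next.symm s ≠ r.x ∧ D.next.symm s ≠ r.y := by
    rw [Ne, Ne, Equiv.symm_apply_eq, Equiv.symm_apply_eq]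
    rcases hs with rfl | rfl
    exacts [⟨(D.next_ne_self _).symm, r.next_y_ne.symm⟩,
      ⟨r.next_x_ne.symm, (D.next_ne_self _).symm⟩]
  obtain ⟨a, ha⟩ := r.del.exists_covers s
  exact ⟨a, .edge _ _ hne'.1 hne'.2 (r.del.covers_prev ha hmem.1),
    .edge _ _ hne.1 hne.2 (r.del.covers_next ha hmem.2)⟩

theorem R2.smallArcs (r : R2 D D') {y : D.Chain A} {φ : D.Endpoint → A}
    (hy : y ∈ D.H1 A) (h : D.IsPotential y φ) {y' : D'.Chain A}
    (hyy : ∀ a a', r.ArcCorr a a' → y a = y' a') : r.del.SmallArcs {r.x, r.y} φ := by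
  have hsx : D.next.symm r.x ∉ ({r.x, r.y} : Set D.Endpoint) := by
    rw [Set.mem_insert_iff, Set.mem_singleton_iff, Equiv.symm_apply_eq, Equiv.symm_apply_eq]
    rintro (h' | h')
    · exact D.next_ne_self _ h'.symm
    · exact r.next_y_ne h'.symm
  have hsy : D.next.symm r.y ∉ ({r.x, r.y} : Set D.Endpoint) := by
    rw [Set.mem_insert_iff, Set.mem_singleton_iff, Equiv.symm_apply_eq, Equiv.symm_apply_eq]
    rintro (h' | h')
    · exact r.next_x_ne h'.symm
    · exact D.next_ne_self _ h'.symm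
  have hox : y (.edge (D.next.symm r.x)) = y (.edge (D.next r.x)) := by
    obtain ⟨a, h1, h2⟩ := r.exists_arcCorr (.inl rfl)
    rw [hyy _ _ h1, hyy _ _ h2]
  have hoy : y (.edge (D.next.symm r.y)) = y (.edge (D.next r.y)) := by
    obtain ⟨a, h1, h2⟩ := r.exists_arcCorr (.inr rfl)
    rw [hyy _ _ h1, hyy _ _ h2]
  have hφ : φ (D.next r.x) = φ (D.next.symm r.x) ∧ φ (D.next r.y) = φ (D.next.symm r.y) := by
    obtain ⟨u, bu, hu⟩ : ∃ u b, r.x = (u, b) := ⟨_, _, rfl⟩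
    obtain ⟨w, bw, hw⟩ : ∃ w b, D.next r.x = (w, b) := ⟨_, _, rfl⟩
    obtain ⟨u', bu', hu'⟩ : ∃ u b, r.y = (u, b) := ⟨_, _, rfl⟩
    obtain ⟨w', bw', hw'⟩ : ∃ w b, D.next r.y = (w, b) := ⟨_, _, rfl⟩
    have ho := r.over_x
    have hun := r.under_y
    have hch := r.chords
    have hs := r.sign_neg
    have h5 := Equiv.symm_apply_apply D.next r.x
    have h6 := Equiv.symm_apply_apply D.next r.y
    rw [hw, hu] at ho hs
    rw [hw', hu'] at hun
    rw [hw, hu, hw', hu'] at hch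
    rw [hw, hu] at h5
    rw [hw', hu'] at h6
    rw [hw, hu] at hox
    rw [hw', hu'] at hoy
    rw [hw, hu, hw', hu']
    simp only at ho hun hch hs
    obtain ⟨rfl, rfl⟩ := ho
    obtain ⟨rfl, rfl⟩ := hun
    have hcu := (D.mem_H1_iff y).1 hy u
    have hcw := (D.mem_H1_iff y).1 hy w
    have h1 := h.ltr u
    have h2 := h.rtl u
    have h3 := h.ltr w
    have h4 := h.rtl w
    clear hy h hyy hsx hsy hu hw hu' hw'
    rcases D.sides_of_sign u with ⟨hu0, hu1, hu2⟩ | ⟨hu0, hu1, hu2⟩ <;>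
    rcases D.sides_of_sign w with ⟨hw0, hw1, hw2⟩ | ⟨hw0, hw1, hw2⟩ <;>
    rw [hu0, hw0] at hs <;>
    first
    | exact absurd hs (by decide)
    | rcases hch with ⟨rfl, rfl⟩ | ⟨rfl, rfl⟩ <;> grind
  refine ⟨?_, ?_, ?_⟩
  · rintro f (rfl | rfl)
    exacts [Or.inl rfl, r.y_mem]
  · rintro f (rfl | rfl)
    exacts [r.next_x_mem, r.next_y_mem]
  · intro f hf hfM
    have hf1 : f.1 = r.x.1 ∨ f.1 = (D.next r.x).1 := hf
    have hfM1 : f ≠ r.x := fun h => hfM (Or.inl h)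
    have hfM2 : f ≠ r.y := fun h => hfM (Or.inr h)
    have : f = D.next r.x ∨ f = D.next r.y := by
      have ho := r.over_x
      have hun := r.under_y
      have hch := r.chords
      rw [Ne, Prod.ext_iff] at hfM1 hfM2
      simp only [Prod.ext_iff]
      rcases hb : f.2 <;> grind
    rcases this with rfl | rfl
    · exact ⟨r.x, Or.inl rfl, rfl, hsx, hφ.1⟩
    · exact ⟨r.y, Or.inr rfl, rfl, hsy, hφ.2⟩

end GaussDiagram

/-! ### Potentials under a third Reidemeister move -/

namespace GaussDiagram

variable {A : Type*} [AddCommGroup A] {D D' : GaussDiagram}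

theorem next_next_ne (D : GaussDiagram) {e f : D.Endpoint} (h1 : f ≠ e) (h2 : f ≠ D.next e) :
    D.next (D.next e) ≠ e := by
  intro h
  obtain ⟨n, -, hn⟩ := D.exists_pow_next e f
  have : ∀ n : ℕ, (D.next ^ n) e = e ∨ (D.next ^ n) e = D.next e := by
    intro n
    induction n with
    | zero => exact .inl rfl
    | succ n ih =>
      rw [pow_succ', Equiv.Perm.mul_apply]
      rcases ih with ih | ih
      · exact .inr (by rw [ih])
      · exact .inl (by rw [ih, h])
  rcases this n with h' | h' <;> rw [hn] at h'
  exacts [h1 h', h2 h']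

namespace R3

theorem flip_aT (r : R3 D D') : r.flip (r.a, true) = (r.b, true) := by
  have := r.ne_ab; have := r.ne_ac; have := r.ne_bc
  simp [flip, Equiv.swap_apply_def, *]

theorem flip_bT (r : R3 D D') : r.flip (r.b, true) = (r.a, true) := by
  have := r.ne_ab; have := r.ne_ac; have := r.ne_bc
  simp [flip, Equiv.swap_apply_def, *]

theorem flip_aF (r : R3 D D') : r.flip (r.a, false) = (r.c, true) := by
  have := r.ne_ab; have := r.ne_ac; have := r.ne_bc.symm; have := r.ne_ac.symm
  simp [flip, Equiv.swap_apply_def, *]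

theorem flip_cT (r : R3 D D') : r.flip (r.c, true) = (r.a, false) := by
  have := r.ne_ab; have := r.ne_ac; have := r.ne_bc
  simp [flip, Equiv.swap_apply_def, *]

theorem flip_bF (r : R3 D D') : r.flip (r.b, false) = (r.c, false) := by
  have := r.ne_ab; have := r.ne_ac.symm; have := r.ne_bc
  simp [flip, Equiv.swap_apply_def, *]

theorem flip_cF (r : R3 D D') : r.flip (r.c, false) = (r.b, false) := by
  have := r.ne_ab.symm; have := r.ne_ac; have := r.ne_bc
  simp [flip, Equiv.swap_apply_def, *]

theorem flip_of_ne (r : R3 D D') {e : D.Endpoint} (ha : e.1 ≠ r.a) (hb : e.1 ≠ r.b)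
    (hc : e.1 ≠ r.c) : r.flip e = e := by
  obtain ⟨v, s⟩ := e
  simp only at ha hb hc
  simp [flip, Equiv.swap_apply_def, *]

theorem flip_flip (r : R3 D D') (e : D.Endpoint) : r.flip (r.flip e) = e := by
  by_cases ha : e.1 = r.a
  · obtain ⟨v, s⟩ := e; subst ha; cases s
    exacts [by rw [flip_aF, flip_cT], by rw [flip_aT, flip_bT]]
  by_cases hb : e.1 = r.b
  · obtain ⟨v, s⟩ := e; subst hb; cases s
    exacts [by rw [flip_bF, flip_cF], by rw [flip_bT, flip_aT]]
  by_cases hc : e.1 = r.c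
  · obtain ⟨v, s⟩ := e; subst hc; cases s
    exacts [by rw [flip_cF, flip_bF], by rw [flip_cT, flip_aF]]
  rw [r.flip_of_ne ha hb hc, r.flip_of_ne ha hb hc]

/-- The identification of the ends of the chords before and after the move. -/
def map (r : R3 D D') (e : D.Endpoint) : D'.Endpoint := Prod.map r.equiv id e

theorem next_map (r : R3 D D') (e : D.Endpoint) :
    D'.next (r.map e) = r.map (r.flip (D.next (r.flip e))) := by
  have := r.next_eq (r.flip e)
  change D'.next (r.map (r.flip (r.flip e))) = r.map (r.flip (D.next (r.flip e))) at this
  rwa [r.flip_flip] at this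

theorem symm_map (r : R3 D D') (e : D.Endpoint) :
    D'.next.symm (r.map e) = r.map (r.flip (D.next.symm (r.flip e))) := by
  rw [Equiv.symm_apply_eq, r.next_map, r.flip_flip, Equiv.apply_symm_apply, r.flip_flip]

theorem ltr_map (r : R3 D D') (v : D.V) : D'.ltr (r.equiv v) = r.map (D.ltr v) := by
  simp [ltr, r.sign_eq, map]

theorem rtl_map (r : R3 D D') (v : D.V) : D'.rtl (r.equiv v) = r.map (D.rtl v) := by
  simp [rtl, r.sign_eq, map]

theorem next_second_ne (r : R3 D D') {e f : D.Endpoint} (hn : D.next e = f) :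
    D.next f ≠ e := by
  rw [← hn]
  obtain ⟨g, hg⟩ : ∃ g : D.V, g ≠ e.1 ∧ g ≠ f.1 := by
    have h1 := r.ne_ab; have h2 := r.ne_ac; have h3 := r.ne_bc
    by_contra! hcon
    have hp : ∀ g, g = e.1 ∨ g = f.1 := fun g => or_iff_not_imp_left.2 (hcon g)
    rcases hp r.a with ha | ha <;> rcases hp r.b with hb | hb <;> rcases hp r.c with hc | hc <;>
    first
    | exact h1 (ha.trans hb.symm)
    | exact h2 (ha.trans hc.symm)
    | exact h3 (hb.trans hc.symm)
  refine D.next_next_ne (f := (g, true)) ?_ ?_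
  · exact fun h => hg.1 (congrArg Prod.fst h)
  · rw [hn]
    exact fun h => hg.2 (congrArg Prod.fst h)

/-- The relations between the arcs of a strand of the triangle before and after the move: the
strand first passes `e` and then `f`; after the move it first passes `f`. -/
theorem strand (r : R3 D D') {B : Type*} {y : D.Arc → B} {y' : D'.Arc → B}
    (hy : ∀ f, D.next f ≠ r.flip f → y (.edge f) = y' (.edge (r.map (r.flip f))))
    {e f : D.Endpoint} (hn : D.next e = f) (hf : r.flip e = f) :
    D.next.symm f = e ∧ D'.next.symm (r.map f) = r.map (r.flip (D.next.symm e)) ∧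
      D'.next.symm (r.map e) = r.map f ∧ y (.edge f) = y' (.edge (r.map e)) ∧
      y (.edge (D.next.symm e)) = y' (.edge (r.map (r.flip (D.next.symm e)))) := by
  have hf' : r.flip f = e := by rw [← hf, r.flip_flip]
  have hfe := r.next_second_ne hn
  refine ⟨by rw [← hn, Equiv.symm_apply_apply], by rw [r.symm_map, hf'], ?_, ?_, ?_⟩
  · rw [r.symm_map, hf, ← hn, Equiv.symm_apply_apply, hn, hf]
  · rw [hy f (by rwa [hf']), hf']
  · refine hy _ fun h => hfe ?_
    rw [Equiv.apply_symm_apply, ← hf'] at h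
    have := r.flip.injective h
    rw [this, Equiv.apply_symm_apply, hf']

/-- A potential after a third Reidemeister move: it has the old values on all arcs except the small
ones, which start at `r.map e` with `D.next (r.flip e) = e`. There the value is determined by the
value on the arc before. -/
noncomputable def potential (r : R3 D D') (y' : D'.Chain A) (φ : D.Endpoint → A) :
    D'.Endpoint → A := fun e' =>
  let e : D.Endpoint := Prod.map r.equiv.symm id e'
  if D.next (r.flip e) = e then φ (D.next.symm (r.flip e)) + D'.increment y' e'
    else φ (r.flip e)

theorem potential_map (r : R3 D D') (y' : D'.Chain A) (φ : D.Endpoint → A) (e : D.Endpoint) :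
    r.potential y' φ (r.map e) =
      if D.next (r.flip e) = e then φ (D.next.symm (r.flip e)) + D'.increment y' (r.map e)
      else φ (r.flip e) := by
  have : Prod.map r.equiv.symm id (r.map e) = e := by simp [map, Prod.map]
  simp only [potential, this]

/-- The total change of a potential along the two crossings of a side of the triangle is preserved
by the move. -/
theorem increments (r : R3 D D') {y : D.Chain A} {y' : D'.Chain A}
    (hc : y ∈ D.H1 A) (hc' : y' ∈ D'.H1 A)
    (hy : ∀ f, D.next f ≠ r.flip f → y (.edge f) = y' (.edge (r.map (r.flip f)))) :
    (D.increment y (r.a, true) + D.increment y (r.b, true)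
      = D'.increment y' (r.map (r.a, true)) + D'.increment y' (r.map (r.b, true))) ∧
    (D.increment y (r.a, false) + D.increment y (r.c, true)
      = D'.increment y' (r.map (r.a, false)) + D'.increment y' (r.map (r.c, true))) ∧
    (D.increment y (r.b, false) + D.increment y (r.c, false)
      = D'.increment y' (r.map (r.b, false)) + D'.increment y' (r.map (r.c, false))) := by
  have hca := (D.mem_H1_iff y).1 hc r.a
  have hcb := (D.mem_H1_iff y).1 hc r.b
  have hcc := (D.mem_H1_iff y).1 hc r.c
  have hca' := (D'.mem_H1_iff y').1 hc' (r.equiv r.a)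
  have hcb' := (D'.mem_H1_iff y').1 hc' (r.equiv r.b)
  have hcc' := (D'.mem_H1_iff y').1 hc' (r.equiv r.c)
  have h1 := D.increment_ltr y r.a
  have h2 := D.increment_rtl y r.a
  have h3 := D.increment_ltr y r.b
  have h4 := D.increment_rtl y r.b
  have h5 := D.increment_ltr y r.c
  have h6 := D.increment_rtl y r.c
  have h1' := D'.increment_ltr y' (r.equiv r.a)
  have h2' := D'.increment_rtl y' (r.equiv r.a)
  have h3' := D'.increment_ltr y' (r.equiv r.b)
  have h4' := D'.increment_rtl y' (r.equiv r.b)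
  have h5' := D'.increment_ltr y' (r.equiv r.c)
  have h6' := D'.increment_rtl y' (r.equiv r.c)
  rw [ltr_map, rtl_map] at hca' hcb' hcc'
  rw [ltr_map] at h1' h3' h5' h2' h4' h6'
  rw [rtl_map] at h1' h3' h5' h2' h4' h6'
  have htop : (r.t = 1 ∧ D.next (r.a, true) = (r.b, true)) ∨
    (r.t = -1 ∧ D.next (r.b, true) = (r.a, true)) := r.top.next_eq_or
  have hmid : (r.m = 1 ∧ D.next (r.a, false) = (r.c, true)) ∨
    (r.m = -1 ∧ D.next (r.c, true) = (r.a, false)) := r.mid.next_eq_or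
  have hbot : (r.l = 1 ∧ D.next (r.b, false) = (r.c, false)) ∨
    (r.l = -1 ∧ D.next (r.c, false) = (r.b, false)) := r.bot.next_eq_or
  obtain ⟨htr1, htr2⟩ := r.triangle
  rcases D.sides_of_sign r.a with ⟨ha0, ha1, ha2⟩ | ⟨ha0, ha1, ha2⟩ <;>
  rcases D.sides_of_sign r.b with ⟨hb0, hb1, hb2⟩ | ⟨hb0, hb1, hb2⟩ <;>
  rcases D.sides_of_sign r.c with ⟨hc0, hc1, hc2⟩ | ⟨hc0, hc1, hc2⟩ <;>
  rcases htop with ⟨ht, ht1⟩ | ⟨ht, ht1⟩ <;>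
  rcases hmid with ⟨hm, hm1⟩ | ⟨hm, hm1⟩ <;>
  rcases hbot with ⟨hl, hl1⟩ | ⟨hl, hl1⟩ <;>
  rw [ha0, hb0, ht, hm, hl] at htr1 <;> rw [hb0, hc0, ht, hm, hl] at htr2 <;>
  first
  | exact absurd htr1 (by decide)
  | exact absurd htr2 (by decide)
  | (have hT := r.strand hy ht1 (by first | exact r.flip_aT | exact r.flip_bT)
     have hM := r.strand hy hm1 (by first | exact r.flip_aF | exact r.flip_cT)
     have hB := r.strand hy hl1 (by first | exact r.flip_bF | exact r.flip_cF)
     rw [ha1, ha2] at h1 h2 h1' h2' hca hca'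
     rw [hb1, hb2] at h3 h4 h3' h4' hcb hcb'
     rw [hc1, hc2] at h5 h6 h5' h6' hcc hcc'
     clear hc hc' ha0 hb0 hc0 ha1 ha2 hb1 hb2 hc1 hc2 htr1 htr2 ht hm hl ht1 hm1 hl1 hy
     grind)

theorem increment_map_of_ne (r : R3 D D') {y : D.Chain A} {y' : D'.Chain A}
    (hy : ∀ f, D.next f ≠ r.flip f → y (.edge f) = y' (.edge (r.map (r.flip f))))
    {v : D.V} (ha : v ≠ r.a) (hb : v ≠ r.b) (hc : v ≠ r.c) (e : D.Endpoint) (he : e.1 = v) :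
    D'.increment y' (r.map e) = D.increment y e := by
  subst he
  have hl : r.flip (D.ltr e.1) = D.ltr e.1 := r.flip_of_ne ha hb hc
  have hr : r.flip (D.rtl e.1) = D.rtl e.1 := r.flip_of_ne ha hb hc
  rcases D.eq_ltr_or_eq_rtl e with h | h <;> rw [h]
  · rw [← ltr_map, increment_ltr, increment_ltr, rtl_map, hy, hr]
    rw [hr]
    exact D.next_ne_self _
  · rw [← rtl_map, increment_rtl, increment_rtl, ltr_map, symm_map, hl, ← hy]
    rw [Equiv.apply_symm_apply]
    intro h'
    have := congrArg r.flip h'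
    rw [flip_flip, hl] at this
    refine D.next_ne_self (D.ltr e.1) ?_
    conv_lhs => rw [this, Equiv.apply_symm_apply]

theorem potential_of_ne (r : R3 D D') (y' : D'.Chain A) (φ : D.Endpoint → A) {e : D.Endpoint}
    (h : D.next e ≠ r.flip e) : r.potential y' φ (r.map (r.flip e)) = φ e := by
  rw [potential_map, flip_flip, if_neg h]

theorem potential_of_eq (r : R3 D D') (y' : D'.Chain A) (φ : D.Endpoint → A) {e f : D.Endpoint}
    (hn : D.next e = f) (hf : r.flip e = f) : r.potential y' φ (r.map f)
      = φ (D.next.symm e) + D'.increment y' (r.map f) := by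
  rw [potential_map, ← hf, flip_flip, if_pos (hn.trans hf.symm)]

/-- Each passage at the triangle lies on a strand, which first passes `e` and then `f`; the total
change of a potential along it is preserved. -/
theorem exists_strand (r : R3 D D') {y : D.Chain A} {y' : D'.Chain A}
    (hc : y ∈ D.H1 A) (hc' : y' ∈ D'.H1 A)
    (hy : ∀ f, D.next f ≠ r.flip f → y (.edge f) = y' (.edge (r.map (r.flip f))))
    (h : D.Endpoint) (hh : h.1 = r.a ∨ h.1 = r.b ∨ h.1 = r.c) :
    ∃ e f, D.next e = f ∧ r.flip e = f ∧ (h = e ∨ h = f) ∧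
      D.increment y e + D.increment y f
        = D'.increment y' (r.map e) + D'.increment y' (r.map f) := by
  obtain ⟨hT, hM, hB⟩ := r.increments hc hc' hy
  have key : ∀ s : ℤˣ, ∀ g k : D.Endpoint, D.Adjacent s g k → r.flip g = k →
      D.increment y g + D.increment y k
        = D'.increment y' (r.map g) + D'.increment y' (r.map k) →
      ∃ e f, D.next e = f ∧ r.flip e = f ∧ ((h = g ∨ h = k) → (h = e ∨ h = f)) ∧
      D.increment y e + D.increment y f
        = D'.increment y' (r.map e) + D'.increment y' (r.map f) := by
    intro s g k hadj hflip hinc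
    rcases hadj.next_eq_or with ⟨-, h1⟩ | ⟨-, h1⟩
    · exact ⟨g, k, h1, hflip, id, hinc⟩
    · exact ⟨k, g, h1, by rw [← hflip, r.flip_flip], Or.symm,
        by rw [add_comm, hinc, add_comm]⟩
  have : (h = (r.a, true) ∨ h = (r.b, true)) ∨ (h = (r.a, false) ∨ h = (r.c, true)) ∨
      (h = (r.b, false) ∨ h = (r.c, false)) := by
    obtain ⟨v, s⟩ := h
    simp only at hh
    rcases hh with rfl | rfl | rfl <;> cases s <;> simp
  rcases this with hs | hs | hs
  · obtain ⟨e, f, h1, h2, h3, h4⟩ := key _ _ _ r.top r.flip_aT hT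
    exact ⟨e, f, h1, h2, h3 hs, h4⟩
  · obtain ⟨e, f, h1, h2, h3, h4⟩ := key _ _ _ r.mid r.flip_aF hM
    exact ⟨e, f, h1, h2, h3 hs, h4⟩
  · obtain ⟨e, f, h1, h2, h3, h4⟩ := key _ _ _ r.bot r.flip_bF hB
    exact ⟨e, f, h1, h2, h3 hs, h4⟩

/-- Between the crossings of a strand `R3.potential` is a potential by definition, and after the
strand because the total change is preserved. -/
theorem isPotential (r : R3 D D') {y : D.Chain A} {y' : D'.Chain A}
    (hc : y ∈ D.H1 A) (hc' : y' ∈ D'.H1 A)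
    (hy : ∀ f, D.next f ≠ r.flip f → y (.edge f) = y' (.edge (r.map (r.flip f))))
    {φ : D.Endpoint → A} (hφ : D.IsPotential y φ) : D'.IsPotential y' (r.potential y' φ) := by
  rw [isPotential_iff] at hφ ⊢
  intro e'
  obtain ⟨g, rfl⟩ : ∃ g, r.map (r.flip g) = e' := by
    refine ⟨r.flip (Prod.map r.equiv.symm id e'), ?_⟩
    rw [flip_flip]; simp [map, Prod.map]
  rw [next_map, flip_flip]
  have hg := hφ g
  obtain ⟨h, hh⟩ : ∃ h, D.next g = h := ⟨_, rfl⟩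
  rw [hh] at hg ⊢
  by_cases hcase : h.1 = r.a ∨ h.1 = r.b ∨ h.1 = r.c
  · obtain ⟨e, f, hn, hf, hef, hinc⟩ := r.exists_strand hc hc' hy h hcase
    have hf' : r.flip f = e := by rw [← hf, r.flip_flip]
    have hne := r.next_second_ne hn
    rcases hef with rfl | rfl
    · -- `h` is the first passage of a side of the triangle
      have hs : D.next.symm h = g := by rw [← hh, Equiv.symm_apply_apply]
      rw [hf, r.potential_of_eq y' φ hn hf, hs, r.potential_of_ne]
      intro h'
      rw [hh] at h'
      exact hne (by rw [← hf, h', r.flip_flip, hh, h'])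
    · -- `h` is the second passage of a side of the triangle
      have hge : g = e := D.next.injective (hh.trans hn.symm)
      subst hge
      have h1 := r.potential_of_eq y' φ hn hf
      have h2 := r.potential_of_ne y' φ (e := h) (by rwa [hf'])
      have h3 := hφ (D.next.symm g)
      rw [Equiv.apply_symm_apply] at h3
      rw [hf'] at h2
      rw [hf, hf', h1, h2, hg, h3, add_assoc, hinc, add_assoc, add_comm (D'.increment _ _)]
  · push Not at hcase
    have hτ := r.flip_of_ne hcase.1 hcase.2.1 hcase.2.2
    have h1 := r.potential_of_ne y' φ (e := h) (by rw [hτ]; exact D.next_ne_self _)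
    rw [h1, r.potential_of_ne, hτ, hg,
      r.increment_map_of_ne hy hcase.1 hcase.2.1 hcase.2.2 h rfl]
    intro h'
    have h2 := congrArg r.flip h'
    rw [hh, flip_flip, hτ] at h2
    exact D.next_ne_self g (by rw [hh, h2])

theorem strand_potential (r : R3 D D') (y' : D'.Chain A) (φ : D.Endpoint → A)
    {e f : D.Endpoint} (hn : D.next e = f) (hf : r.flip e = f) :
    r.potential y' φ (r.map e) = φ f ∧
      r.potential y' φ (r.map (r.flip (D.next.symm e))) = φ (D.next.symm e) := by
  have hf' : r.flip f = e := by rw [← hf, r.flip_flip]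
  have hfe := r.next_second_ne hn
  constructor
  · have := r.potential_of_ne y' φ (e := f) (by rwa [hf'])
    rwa [hf'] at this
  · refine r.potential_of_ne y' φ fun h => hfe ?_
    rw [Equiv.apply_symm_apply, ← hf'] at h
    have := r.flip.injective h
    rw [this, Equiv.apply_symm_apply, hf']

/-- The values of the three crossings of the triangle are not changed by the move. -/
theorem jump_triangle (r : R3 D D') {y : D.Chain A} {y' : D'.Chain A}
    (hc : y ∈ D.H1 A) (hc' : y' ∈ D'.H1 A)
    (hy : ∀ f, D.next f ≠ r.flip f → y (.edge f) = y' (.edge (r.map (r.flip f))))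
    {φ : D.Endpoint → A} (hφ : D.IsPotential y φ) :
    D'.jump (r.potential y' φ) (r.equiv r.a) = D.jump φ r.a ∧
    D'.jump (r.potential y' φ) (r.equiv r.b) = D.jump φ r.b ∧
    D'.jump (r.potential y' φ) (r.equiv r.c) = D.jump φ r.c := by
  have hφ' := r.isPotential hc hc' hy hφ
  have k1 := hφ.ltr r.a
  have k2 := hφ.rtl r.a
  have k3 := hφ.ltr r.b
  have k4 := hφ.rtl r.b
  have k5 := hφ.ltr r.c
  have k6 := hφ.rtl r.c
  have k1' := hφ'.ltr (r.equiv r.a)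
  have k2' := hφ'.rtl (r.equiv r.a)
  have k3' := hφ'.ltr (r.equiv r.b)
  have k4' := hφ'.rtl (r.equiv r.b)
  have k5' := hφ'.ltr (r.equiv r.c)
  have k6' := hφ'.rtl (r.equiv r.c)
  simp only [jump]
  have hca := (D.mem_H1_iff y).1 hc r.a
  have hcb := (D.mem_H1_iff y).1 hc r.b
  have hcc := (D.mem_H1_iff y).1 hc r.c
  have hca' := (D'.mem_H1_iff y').1 hc' (r.equiv r.a)
  have hcb' := (D'.mem_H1_iff y').1 hc' (r.equiv r.b)
  have hcc' := (D'.mem_H1_iff y').1 hc' (r.equiv r.c)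
  rw [ltr_map, rtl_map] at hca' hcb' hcc'
  rw [ltr_map, rtl_map] at k1' k2' k3' k4' k5' k6'
  rw [ltr_map, rtl_map, ltr_map, rtl_map, ltr_map, rtl_map]
  have htop : (r.t = 1 ∧ D.next (r.a, true) = (r.b, true)) ∨
    (r.t = -1 ∧ D.next (r.b, true) = (r.a, true)) := r.top.next_eq_or
  have hmid : (r.m = 1 ∧ D.next (r.a, false) = (r.c, true)) ∨
    (r.m = -1 ∧ D.next (r.c, true) = (r.a, false)) := r.mid.next_eq_or
  have hbot : (r.l = 1 ∧ D.next (r.b, false) = (r.c, false)) ∨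
    (r.l = -1 ∧ D.next (r.c, false) = (r.b, false)) := r.bot.next_eq_or
  obtain ⟨htr1, htr2⟩ := r.triangle
  rcases D.sides_of_sign r.a with ⟨ha0, ha1, ha2⟩ | ⟨ha0, ha1, ha2⟩ <;>
  rcases D.sides_of_sign r.b with ⟨hb0, hb1, hb2⟩ | ⟨hb0, hb1, hb2⟩ <;>
  rcases D.sides_of_sign r.c with ⟨hc0, hc1, hc2⟩ | ⟨hc0, hc1, hc2⟩ <;>
  rcases htop with ⟨ht, ht1⟩ | ⟨ht, ht1⟩ <;>
  rcases hmid with ⟨hm, hm1⟩ | ⟨hm, hm1⟩ <;>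
  rcases hbot with ⟨hl, hl1⟩ | ⟨hl, hl1⟩ <;>
  rw [ha0, hb0, ht, hm, hl] at htr1 <;> rw [hb0, hc0, ht, hm, hl] at htr2 <;>
  first
  | exact absurd htr1 (by decide)
  | exact absurd htr2 (by decide)
  | (have hT := r.strand hy ht1 (by first | exact r.flip_aT | exact r.flip_bT)
     have hM := r.strand hy hm1 (by first | exact r.flip_aF | exact r.flip_cT)
     have hB := r.strand hy hl1 (by first | exact r.flip_bF | exact r.flip_cF)
     have hTφ := r.strand_potential y' φ ht1 (by first | exact r.flip_aT | exact r.flip_bT)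
     have hMφ := r.strand_potential y' φ hm1 (by first | exact r.flip_aF | exact r.flip_cT)
     have hBφ := r.strand_potential y' φ hl1 (by first | exact r.flip_bF | exact r.flip_cF)
     rw [ha1, ha2] at k1 k2 k1' k2' hca hca'
     rw [hb1, hb2] at k3 k4 k3' k4' hcb hcb'
     rw [hc1, hc2] at k5 k6 k5' k6' hcc hcc'
     rw [ha1, ha2, hb1, hb2, hc1, hc2]
     clear hφ hφ' hc hc' ha0 hb0 hc0 ha1 ha2 hb1 hb2 hc1 hc2 htr1 htr2 ht hm hl ht1 hm1 hl1 hy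
     grind)

theorem jump_map (r : R3 D D') {y : D.Chain A} {y' : D'.Chain A}
    (hc : y ∈ D.H1 A) (hc' : y' ∈ D'.H1 A)
    (hy : ∀ f, D.next f ≠ r.flip f → y (.edge f) = y' (.edge (r.map (r.flip f))))
    {φ : D.Endpoint → A} (hφ : D.IsPotential y φ) (v : D.V) :
    D'.jump (r.potential y' φ) (r.equiv v) = D.jump φ v := by
  obtain ⟨ha, hb, hc⟩ := r.jump_triangle hc hc' hy hφ
  by_cases h1 : v = r.a
  · rw [h1, ha]
  by_cases h2 : v = r.b
  · rw [h2, hb]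
  by_cases h3 : v = r.c
  · rw [h3, hc]
  have hl : r.flip (D.ltr v) = D.ltr v := r.flip_of_ne h1 h2 h3
  have hr : r.flip (D.rtl v) = D.rtl v := r.flip_of_ne h1 h2 h3
  have e1 := r.potential_of_ne y' φ (e := D.rtl v) (by rw [hr]; exact D.next_ne_self _)
  rw [hr] at e1
  rw [jump, jump, ltr_map, rtl_map, symm_map, hl, e1, r.potential_of_ne]
  rw [Equiv.apply_symm_apply]
  intro h'
  have := congrArg r.flip h'
  rw [flip_flip, hl] at this
  refine D.next_ne_self (D.ltr v) ?_
  conv_lhs => rw [this, Equiv.apply_symm_apply]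

end R3
end GaussDiagram

/-! ### The parity of a normalized invariant cycle -/

namespace VirtualKnot

open GaussDiagram

variable {K : VirtualKnot} {A : Type*} [AddCommGroup A]

theorem intersectionParity_eq_jump {δ : K.ChainFamily A} {D : K.Diagram} {φ : D.1.Endpoint → A}
    (h : D.1.IsPotential (δ D) φ) (v : D.1.V) : intersectionParity δ D v = D.1.jump φ v :=
  h.inter_leftHalf v

namespace IsNormalizedInvariantCycle

variable {δ : K.ChainFamily A}

theorem exists_potential (hδ : IsNormalizedInvariantCycle δ) (D : K.Diagram) :
    ∃ φ, D.1.IsPotential (δ D) φ :=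
  D.1.exists_isPotential _ (hδ.normalized D)

theorem intersectionParity_r1 (hδ : IsNormalizedInvariantCycle δ)
    {D D' : K.Diagram} (r : R1 D.1 D'.1) (v : D'.1.V) :
    intersectionParity δ D' v = intersectionParity δ D (r.del.emb v) := by
  obtain ⟨φ, hφ⟩ := hδ.exists_potential D
  have hM := r.smallArcs (hδ.cycle D) hφ
  obtain ⟨h1, h2⟩ := hM.isPotential (y' := δ D') (fun f e hf hc =>
    hδ.invariant D D' (.r1 r) _ _ (.edge f _ hf hc)) hφ
  rw [intersectionParity_eq_jump h1, h2, intersectionParity_eq_jump hφ]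

theorem intersectionParity_r2 (hδ : IsNormalizedInvariantCycle δ)
    {D D' : K.Diagram} (r : R2 D.1 D'.1) (v : D'.1.V) :
    intersectionParity δ D' v = intersectionParity δ D (r.del.emb v) := by
  obtain ⟨φ, hφ⟩ := hδ.exists_potential D
  have hM := r.smallArcs (hδ.cycle D) hφ (hδ.invariant D D' (.r2 r))
  obtain ⟨h1, h2⟩ := hM.isPotential (y' := δ D') (fun f e hf hc =>
    hδ.invariant D D' (.r2 r) _ _
      (.edge f _ (fun h => hf (Or.inl h)) (fun h => hf (Or.inr h)) hc)) hφ
  rw [intersectionParity_eq_jump h1, h2, intersectionParity_eq_jump hφ]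

theorem intersectionParity_move (hδ : IsNormalizedInvariantCycle δ)
    {D D' : K.Diagram} (m : Move D.1 D'.1) (v : D.1.V) (v' : D'.1.V)
    (h : m.CrossingCorr v v') : intersectionParity δ D v = intersectionParity δ D' v' := by
  cases m with
  | iso i =>
    obtain rfl : i.equiv v = v' := h
    obtain ⟨φ, hφ⟩ := hδ.exists_potential D
    obtain ⟨φ', h1, h2⟩ := i.exists_isPotential (y' := δ D') (fun e =>
      hδ.invariant D D' (.iso i) _ _ (.edge e)) hφ
    rw [intersectionParity_eq_jump h1, h2, intersectionParity_eq_jump hφ]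
  | r1 r =>
    obtain rfl : r.del.emb v' = v := h
    exact (hδ.intersectionParity_r1 r v').symm
  | r1Inv r =>
    obtain rfl : r.del.emb v = v' := h
    exact hδ.intersectionParity_r1 r v
  | r2 r =>
    obtain rfl : r.del.emb v' = v := h
    exact (hδ.intersectionParity_r2 r v').symm
  | r2Inv r =>
    obtain rfl : r.del.emb v = v' := h
    exact hδ.intersectionParity_r2 r v
  | r3 r =>
    obtain rfl : r.equiv v = v' := h
    obtain ⟨φ, hφ⟩ := hδ.exists_potential D
    have hy : ∀ f, D.1.next f ≠ r.flip f → δ D (.edge f) = δ D' (.edge (r.map (r.flip f))) :=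
      fun f hf => hδ.invariant D D' (.r3 r) _ _ (.edge f hf)
    rw [intersectionParity_eq_jump (r.isPotential (hδ.cycle D) (hδ.cycle D') hy hφ),
      r.jump_map (hδ.cycle D) (hδ.cycle D') hy hφ, intersectionParity_eq_jump hφ]

end IsNormalizedInvariantCycle

theorem mk_eq_of_move {D D' : GaussDiagram} (m : Move D D') :
    (Quotient.mk knotSetoid D : VirtualKnot) = Quotient.mk knotSetoid D' :=
  Quotient.sound (Relation.EqvGen.rel _ _ ⟨m⟩)

theorem IsNormalizedInvariantCycle.isOrientedParity {δ : K.ChainFamily A}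
    (hδ : IsNormalizedInvariantCycle δ) : IsOrientedParity (intersectionParity δ) where
  P0 := by
    suffices h : ∀ (D D' : GaussDiagram) (f : Morphism D D')
        (hD : Quotient.mk knotSetoid D = K) (hD' : Quotient.mk knotSetoid D' = K)
        (v : D.V) (v' : D'.V), f.CrossingCorr v v' →
        intersectionParity δ ⟨D, hD⟩ v = intersectionParity δ ⟨D', hD'⟩ v' from
      fun D D' f v v' hv => h D.1 D'.1 f D.2 D'.2 v v' hv
    -- the intermediate diagrams of a morphism are diagrams of `K`, too
    intro D D' f
    induction f with
    | refl =>
      intro hD hD' v v' h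
      rw [Morphism.CrossingCorr] at h
      rw [h]
    | comp f m ih =>
      intro hD hD' v v' h
      rw [Morphism.CrossingCorr] at h
      obtain ⟨w, h1, h2⟩ := h
      have hw := (mk_eq_of_move m).trans hD'
      exact (ih hD hw v w h1).trans
        (hδ.intersectionParity_move (D := ⟨_, hw⟩) (D' := ⟨_, hD'⟩) m w v' h2)
  P1 := fun D D' r => by
    obtain ⟨φ, hφ⟩ := hδ.exists_potential D
    rw [intersectionParity_eq_jump hφ, r.jump_eq_zero (hδ.cycle D) hφ]
  P2 := fun D D' r => by
    obtain ⟨φ, hφ⟩ := hδ.exists_potential D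
    rw [intersectionParity_eq_jump hφ, intersectionParity_eq_jump hφ,
      r.jump_add_jump (hδ.cycle D) hφ]
  P3 := fun D D' r => by
    obtain ⟨φ, hφ⟩ := hδ.exists_potential D
    rw [intersectionParity_eq_jump hφ, intersectionParity_eq_jump hφ,
      intersectionParity_eq_jump hφ, r.jump_relation (hδ.cycle D) hφ]

/-- The intersection formula takes the value `δ D a` at the first crossing of a self-move: one half
at this crossing consists of pieces of the arc `a` only. -/
theorem IsNormalizedInvariantCycle.intersectionParity_selfMove {δ : K.ChainFamily A}
    (hδ : IsNormalizedInvariantCycle δ) {D D' : K.Diagram} (r : R2 D'.1 D.1) {a : D.1.Arc}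
    (h : IsSelfMove r a) : δ D a = intersectionParity δ D' r.x.1 := by
  obtain ⟨φ, hφ⟩ := hδ.exists_potential D'
  rw [intersectionParity_eq_jump hφ]
  -- the strand `e` of the self-move comes first, the strand `f` second
  obtain ⟨e, f, hef, hn, ha⟩ : ∃ e f, ((e = r.x ∧ f = r.y) ∨ (e = r.y ∧ f = r.x)) ∧
      D'.1.next (D'.1.next e) = f ∧ r.ArcCorr (.edge (D'.1.next e)) a := by
    rcases h.2 with ⟨h1, h2⟩ | ⟨h1, h2⟩
    exacts [⟨_, _, .inl ⟨rfl, rfl⟩, h1, h2⟩, ⟨_, _, .inr ⟨rfl, rfl⟩, h1, h2⟩]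
  have hinv : ∀ g b, r.ArcCorr (.edge g) b → δ D' (.edge g) = δ D b := fun g b =>
    hδ.invariant D' D (.r2 r) _ _
  have hcov : r.del.Covers (D'.1.next e) a := by cases ha with | edge _ _ _ _ h => exact h
  have he : δ D' (.edge (D'.1.next.symm e)) = δ D' (.edge (D'.1.next e)) := by
    obtain ⟨b, h1, h2⟩ := r.exists_arcCorr (s := e) (by tauto)
    rw [hinv _ _ h1, hinv _ _ h2]
  have hf : δ D' (.edge (D'.1.next.symm f)) = δ D' (.edge (D'.1.next f)) := by
    obtain ⟨b, h1, h2⟩ := r.exists_arcCorr (s := f) (by tauto)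
    rw [hinv _ _ h1, hinv _ _ h2]
  have hα := hinv _ _ ha
  obtain ⟨u, bu, hu⟩ : ∃ u b, r.x = (u, b) := ⟨_, _, rfl⟩
  obtain ⟨w, bw, hw⟩ : ∃ w b, D'.1.next r.x = (w, b) := ⟨_, _, rfl⟩
  obtain ⟨u', bu', hu'⟩ : ∃ u b, r.y = (u, b) := ⟨_, _, rfl⟩
  obtain ⟨w', bw', hw'⟩ : ∃ w b, D'.1.next r.y = (w, b) := ⟨_, _, rfl⟩
  have ho := r.over_x
  have hun := r.under_y
  have hch := r.chords
  have hne := r.ne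
  have hs := r.sign_neg
  have h0 := h.1
  have h5 := Equiv.symm_apply_apply D'.1.next r.x
  have h6 := Equiv.symm_apply_apply D'.1.next r.y
  have h7 := Equiv.symm_apply_apply D'.1.next (D'.1.next e)
  rw [hw, hu] at ho hs h5 hne
  rw [hw', hu'] at hun h6
  rw [hw, hu, hw', hu'] at hch
  rw [hu, hu'] at h0
  rw [hu]
  simp only at ho hun hch hs hne h0
  obtain ⟨rfl, rfl⟩ := ho
  obtain ⟨rfl, rfl⟩ := hun
  subst h0
  obtain rfl : w' = w := by
    rcases hch with h | h
    · exact h.2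
    · exact absurd h.1 hne
  have hcu := (D'.1.mem_H1_iff _).1 (hδ.cycle D') u'
  have hcw := (D'.1.mem_H1_iff _).1 (hδ.cycle D') w'
  have h1 := hφ.ltr u'
  have h2 := hφ.rtl u'
  have h3 := hφ.ltr w'
  have h4 := hφ.rtl w'
  rw [jump]
  clear hφ hδ hinv hch hcov ha h hne
  rcases D'.1.sides_of_sign u' with ⟨hu0, hu1, hu2⟩ | ⟨hu0, hu1, hu2⟩ <;>
  rcases D'.1.sides_of_sign w' with ⟨hw0, hw1, hw2⟩ | ⟨hw0, hw1, hw2⟩ <;>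
  rw [hu0, hw0] at hs <;>
  first
  | exact absurd hs (by decide)
  | rcases hef with ⟨rfl, rfl⟩ | ⟨rfl, rfl⟩ <;> grind

end VirtualKnot

/-! ### Cyclic permutations given by lists -/

namespace List

variable {α β : Type*} [DecidableEq α] [DecidableEq β]

theorem formPerm_append_apply {A B : List α} {x y : α} (h : (A ++ x :: y :: B).Nodup) :
    (A ++ x :: y :: B).formPerm x = y := by
  have hr : A ++ x :: y :: B ~r x :: y :: B ++ A := isRotated_append
  rw [formPerm_eq_of_isRotated h hr]
  exact formPerm_apply_head _ _ _ (hr.nodup_iff.1 h)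

theorem formPerm_map_apply {f : α → β} (hf : Function.Injective f) {l : List α} (h : l.Nodup)
    {x : α} (hx : x ∈ l) : (l.map f).formPerm (f x) = f (l.formPerm x) := by
  obtain ⟨i, hi, rfl⟩ := getElem_of_mem hx
  rw [formPerm_apply_getElem l h i hi]
  have := formPerm_apply_getElem (l.map f) (h.map hf) i (by simpa using hi)
  simpa using this

/-- The iterates of the permutation run through the list. -/
theorem formPerm_pow_append {A P B : List α} {x y : α} (h : (A ++ x :: (P ++ y :: B)).Nodup) :
    ((A ++ x :: (P ++ y :: B)).formPerm ^ (P.length + 1)) x = y ∧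
      ∀ j, 0 < j → j ≤ P.length → ((A ++ x :: (P ++ y :: B)).formPerm ^ j) x ∈ P := by
  have hr : A ++ x :: (P ++ y :: B) ~r x :: (P ++ y :: B) ++ A := isRotated_append
  have hn := hr.nodup_iff.1 h
  rw [formPerm_eq_of_isRotated h hr]
  rw [cons_append] at hn ⊢
  refine ⟨?_, fun j h0 h1 => ?_⟩
  · have hlt : P.length + 1 < (x :: (P ++ y :: B ++ A)).length := by simp
    rw [formPerm_pow_apply_head _ _ hn]
    simp only [Nat.mod_eq_of_lt hlt, getElem_cons_succ]
    rw [getElem_append_left (by simp), getElem_append_right le_rfl]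
    simp
  · rw [formPerm_pow_apply_head _ _ hn]
    obtain _ | j := j
    · exact absurd h0 (lt_irrefl 0)
    have hlt : j + 1 < (x :: (P ++ y :: B ++ A)).length := by simp; lia
    simp only [Nat.mod_eq_of_lt hlt, getElem_cons_succ]
    rw [getElem_append_left (by simp; lia), getElem_append_left (by lia)]
    exact getElem_mem _

/-- The iterates return to the head of the list after they have run through the rest of it. -/
theorem formPerm_pow_cons {P : List α} {x : α} (h : (x :: P).Nodup) :
    ((x :: P).formPerm ^ (P.length + 1)) x = x ∧
      ∀ j, 0 < j → j ≤ P.length → ((x :: P).formPerm ^ j) x ∈ P := by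
  refine ⟨?_, fun j h0 h1 => ?_⟩
  · rw [formPerm_pow_apply_head _ _ h]
    simp
  · rw [formPerm_pow_apply_head _ _ h]
    obtain _ | j := j
    · exact absurd h0 (lt_irrefl 0)
    have hlt : j + 1 < (x :: P).length := by simp; lia
    simp only [Nat.mod_eq_of_lt hlt, getElem_cons_succ]
    exact getElem_mem _

/-- The cyclic permutation of a sublist is the first return map of the cyclic permutation of the
list. -/
theorem exists_pow_formPerm_filter {E : β → α} {l : List α}
    {l' : List β} (hl : l.Nodup) {p : α → Bool} (h : l'.map E = l.filter p) {e : β}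
    (he : e ∈ l') :
    ∃ k, (l.formPerm ^ (k + 1)) (E e) = E (l'.formPerm e) ∧
      ∀ j, 0 < j → j ≤ k → p ((l.formPerm ^ j) (E e)) = false := by
  have hl' : l'.Nodup := Nodup.of_map E (h ▸ hl.filter p)
  obtain ⟨A', B', rfl⟩ := append_of_mem he
  rw [map_append, map_cons] at h
  obtain ⟨l₁, l₂, rfl, h₁, h₂⟩ := filter_eq_append_iff.1 h.symm
  obtain ⟨Q, R, rfl, hQ, -, hR⟩ := filter_eq_cons_iff.1 h₂
  have hr : l₁ ++ (Q ++ E e :: R) ~r E e :: (R ++ (l₁ ++ Q)) := by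
    rw [← append_assoc]
    exact isRotated_append
  have hr' : A' ++ e :: B' ~r e :: (B' ++ A') := isRotated_append
  have hf : (R ++ (l₁ ++ Q)).filter p = (B' ++ A').map E := by
    rw [filter_append, filter_append, h₁, hR, filter_eq_nil_iff.2 hQ, append_nil, map_append]
  rw [formPerm_eq_of_isRotated hl hr, formPerm_eq_of_isRotated hl' hr']
  have hn := hr.nodup_iff.1 hl
  have hn' := hr'.nodup_iff.1 hl'
  generalize R ++ (l₁ ++ Q) = C at *
  generalize B' ++ A' = C' at *
  obtain _ | ⟨f, C'⟩ := C'
  · rw [map_nil, filter_eq_nil_iff] at hf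
    obtain ⟨h1, h2⟩ := formPerm_pow_cons hn
    exact ⟨C.length, by simpa using h1, fun j h0 hj => by simpa using hf _ (h2 j h0 hj)⟩
  · rw [map_cons] at hf
    obtain ⟨P, B, rfl, hP, -, -⟩ := filter_eq_cons_iff.1 hf
    obtain ⟨h1, h2⟩ := formPerm_pow_append (A := []) hn
    rw [formPerm_apply_head _ _ _ hn']
    exact ⟨P.length, h1, fun j h0 hj => by simpa using hP _ (h2 j h0 hj)⟩

end List

theorem Equiv.Perm.first_return_unique {α : Type*} {σ : Equiv.Perm α} {S : Set α} {x : α}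
    {k k' : ℕ} (hk : (σ ^ (k + 1)) x ∉ S) (hj : ∀ j, 0 < j → j ≤ k → (σ ^ j) x ∈ S)
    (hk' : (σ ^ (k' + 1)) x ∉ S) (hj' : ∀ j, 0 < j → j ≤ k' → (σ ^ j) x ∈ S) : k = k' := by
  rcases lt_trichotomy k k' with h | h | h
  · exact absurd (hj' (k + 1) k.succ_pos h) hk
  · exact h
  · exact absurd (hj (k' + 1) k'.succ_pos h) hk'

namespace GaussDiagram

/-! ### Gauss codes -/

/-- The labels of the crossings in a word: a number and the sign of the crossing. -/
abbrev Label := ℕ × ℤˣ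

/-- A linear Gauss code: `(c, true)` stands for the passage through the crossing with label `c` from
the lower left to the upper right, `(c, false)` for the one from the lower right to the
upper left. -/
abbrev Word := List (Label × Bool)

/-- The side on which a passage starts below its crossing, see `GaussDiagram.pt`. -/
def side (D : GaussDiagram) (e : D.Endpoint) : Bool := e.2 == decide (D.sign e.1 = 1)

/-- The passage through `v` from the lower left if `s = true`, from the lower right otherwise. -/
def pt (D : GaussDiagram) (v : D.V) (s : Bool) : D.Endpoint :=
  (v, s == decide (D.sign v = 1))

variable {D D' : GaussDiagram}

theorem pt_true (v : D.V) : D.pt v true = D.ltr v := by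
  simp [pt, ltr]

theorem pt_false (v : D.V) : D.pt v false = D.rtl v := by
  simp [pt, rtl]

@[simp] theorem pt_fst (v : D.V) (s : Bool) : (D.pt v s).1 = v := rfl

@[simp] theorem side_pt (v : D.V) (s : Bool) : D.side (D.pt v s) = s := by
  by_cases h : D.sign v = 1 <;> cases s <;> simp [side, pt, h]

@[simp] theorem pt_side (e : D.Endpoint) : D.pt e.1 (D.side e) = e := by
  obtain ⟨v, b⟩ := e
  by_cases h : D.sign v = 1 <;> cases b <;> simp [side, pt, h]

theorem ext_side {e f : D.Endpoint} (h1 : e.1 = f.1) (h2 : D.side e = D.side f) : e = f := by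
  rw [← pt_side e, ← pt_side f, h1, h2]

/-- The letter of a passage, for given labels of the crossings. -/
def letter (D : GaussDiagram) (lab : D.V → Label) (e : D.Endpoint) : Label × Bool :=
  (lab e.1, D.side e)

theorem letter_injective {lab : D.V → Label} (h : Function.Injective lab) :
    Function.Injective (D.letter lab) := fun e f hef => by
  obtain ⟨h1, h2⟩ := Prod.ext_iff.1 hef
  exact ext_side (h h1) h2

/-- The passage at which an arc starts; the closed arc has none. -/
def Arc.start : D.Arc → Option D.Endpoint
  | .edge e => some e
  | .circle _ => none

/-- A diagram `D` is spelled by the word `L`: for some labels of the crossings, `L` lists the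
passages of `D` in their cyclic order. The closing arc of the spelling is the arc from the last to
the first passage; it starts at `list.getLast?`. -/
structure Spelling (D : GaussDiagram) (L : Word) where
  lab : D.V → Label
  lab_inj : Function.Injective lab
  sign_lab : ∀ v, (lab v).2 = D.sign v
  list : List D.Endpoint
  nodup : list.Nodup
  complete : ∀ e, e ∈ list
  next_eq : D.next = list.formPerm
  map_eq : list.map (D.letter lab) = L

/-- A word that is the Gauss code of a diagram (`IsGauss.exists_diagram`): each of its crossings is
passed exactly once on each side. -/
def IsGauss (L : Word) : Prop := L.Nodup ∧ ∀ c s, (c, s) ∈ L → (c, !s) ∈ L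

namespace Spelling

variable {L L' : Word}

theorem isGauss (s : Spelling D L) : IsGauss L := by
  refine ⟨s.map_eq ▸ s.nodup.map (letter_injective s.lab_inj), fun c b h => ?_⟩
  rw [← s.map_eq, List.mem_map] at h ⊢
  obtain ⟨e, -, he⟩ := h
  refine ⟨D.pt e.1 (!D.side e), s.complete _, ?_⟩
  rw [letter, Prod.ext_iff] at he
  obtain ⟨rfl, rfl⟩ := he
  simp [letter]

theorem mem (s : Spelling D L) (e : D.Endpoint) : D.letter s.lab e ∈ L := by
  have := List.mem_map_of_mem (f := D.letter s.lab) (s.complete e)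
  rwa [s.map_eq] at this

theorem exists_of_mem (s : Spelling D L) {x : Label × Bool} (h : x ∈ L) :
    ∃ v, s.lab v = x.1 ∧ D.letter s.lab (D.pt v x.2) = x := by
  rw [← s.map_eq, List.mem_map] at h
  obtain ⟨e, -, rfl⟩ := h
  exact ⟨e.1, rfl, by simp [letter]⟩

theorem exists_lab_eq (s : Spelling D L) {c : Label} {b : Bool} (h : (c, b) ∈ L) :
    ∃ v, s.lab v = c := (s.exists_of_mem h).imp fun _ => And.left

theorem next_of_append (s : Spelling D L) {A B : Word} {v w : D.V} {b b' : Bool}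
    (h : L = A ++ (s.lab v, b) :: (s.lab w, b') :: B) : D.next (D.pt v b) = D.pt w b' := by
  have hm := s.map_eq.trans h
  obtain ⟨A', R, hl, -, hR⟩ := List.map_eq_append_iff.1 hm
  obtain ⟨x, R', rfl, hx, hR'⟩ := List.map_eq_cons_iff.1 hR
  obtain ⟨y, B', rfl, hy, -⟩ := List.map_eq_cons_iff.1 hR'
  have hx' : x = D.pt v b := letter_injective s.lab_inj (hx.trans (by simp [letter]))
  have hy' : y = D.pt w b' := letter_injective s.lab_inj (hy.trans (by simp [letter]))
  have hn := s.nodup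
  rw [hl] at hn
  rw [s.next_eq, hl, ← hx', ← hy']
  exact List.formPerm_append_apply hn

/-- The first passage may be chosen freely. -/
theorem rotate {A B : Word} (s : Spelling D (A ++ B)) :
    ∃ s' : Spelling D (B ++ A), s'.lab = s.lab := by
  obtain ⟨A', B', hl, hA, hB⟩ := List.map_eq_append_iff.1 s.map_eq
  have hr : A' ++ B' ~r B' ++ A' := List.isRotated_append
  have hn := s.nodup
  have hc := s.complete
  rw [hl] at hn hc
  exact ⟨⟨s.lab, s.lab_inj, s.sign_lab, B' ++ A', hr.nodup_iff.1 hn, fun e => hr.mem_iff.1 (hc e),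
    by rw [s.next_eq, hl, List.formPerm_eq_of_isRotated hn hr], by rw [List.map_append, hA, hB]⟩,
    rfl⟩

/-- Two diagrams that are spelled by the same word are isomorphic. -/
theorem exists_iso (s : Spelling D L) (s' : Spelling D' L) :
    ∃ i : Iso D D', ∀ v, s'.lab (i.equiv v) = s.lab v := by
  have h1 : ∀ v, ∃ v', s'.lab v' = s.lab v := fun v => s'.exists_lab_eq (s.mem (v, true))
  have h2 : ∀ v', ∃ v, s.lab v = s'.lab v' := fun v' => s.exists_lab_eq (s'.mem (v', true))
  choose f hf using h1
  choose g hg using h2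
  have hgf : ∀ v, g (f v) = v := fun v => s.lab_inj (by rw [hg, hf])
  have hfg : ∀ v, f (g v) = v := fun v => s'.lab_inj (by rw [hf, hg])
  have hsign : ∀ v, D'.sign (f v) = D.sign v := fun v => by
    rw [← s'.sign_lab, hf, s.sign_lab]
  have hletter : ∀ e, D'.letter s'.lab (Prod.map f id e) = D.letter s.lab e := fun e => by
    simp [letter, side, hf, hsign]
  have hlist : s'.list = s.list.map (Prod.map f id) := by
    refine (List.map_injective_iff.2 (letter_injective s'.lab_inj)) ?_
    rw [s'.map_eq, List.map_map]
    exact s.map_eq.symm.trans (List.map_congr_left fun e _ => (hletter e).symm)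
  have hinj : Function.Injective (Prod.map f (id : Bool → Bool)) :=
    Function.Injective.prodMap (Function.LeftInverse.injective hgf) Function.injective_id
  refine ⟨⟨⟨f, g, hgf, hfg⟩, hsign, fun e => ?_⟩, hf⟩
  rw [s'.next_eq, s.next_eq, hlist]
  exact List.formPerm_map_apply hinj s.nodup (s.complete e)

/-- Deleting letters from a word means deleting chords. -/
theorem exists_deletion (s : Spelling D L) (s' : Spelling D' L') {T : List Label}
    (hL : L' = L.filter fun x => x.1 ∉ T) {S : Set D.V} (hS : ∀ v, v ∈ S ↔ s.lab v ∈ T) :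
    ∃ d : Deletion D D' S, ∀ v, s.lab (d.emb v) = s'.lab v := by
  subst hL
  have h1 : ∀ v', ∃ v, s.lab v = s'.lab v' := fun v' =>
    s.exists_lab_eq (List.mem_of_mem_filter (s'.mem (v', true)))
  choose g hg using h1
  have hgS : ∀ v', g v' ∉ S := fun v' => by
    have := s'.mem (v', true)
    rw [List.mem_filter] at this
    rw [hS, hg]
    exact of_decide_eq_true this.2
  have hginj : Function.Injective g := fun v w h => s'.lab_inj (by rw [← hg, ← hg, h])
  have hsign : ∀ v, D.sign (g v) = D'.sign v := fun v => by
    rw [← s.sign_lab, hg, s'.sign_lab]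
  have hletter : ∀ e, D.letter s.lab (Prod.map g id e) = D'.letter s'.lab e := fun e => by
    simp [letter, side, hg, hsign]
  have hlist : s'.list.map (Prod.map g id) = s.list.filter fun e => s.lab e.1 ∉ T := by
    refine (List.map_injective_iff.2 (letter_injective s.lab_inj)) ?_
    rw [List.map_map, show D.letter s.lab ∘ Prod.map g id = D'.letter s'.lab from funext hletter,
      s'.map_eq]
    refine (congrArg _ s.map_eq.symm).trans ?_
    rw [List.filter_map]
    rfl
  have hinj : Function.Injective (Prod.map g (id : Bool → Bool)) :=
    hginj.prodMap Function.injective_id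
  refine ⟨⟨⟨g, hginj⟩, ?_, hsign, fun e => ?_⟩, hg⟩
  · ext v
    refine ⟨?_, fun hv => ?_⟩
    · rintro ⟨v', rfl⟩
      exact hgS v'
    · have hv' : s.lab v ∉ T := fun h => hv ((hS v).2 h)
      have hm : (s.lab v, D.side (v, true)) ∈ L.filter fun x => x.1 ∉ T := by
        rw [List.mem_filter]
        exact ⟨s.mem (v, true), by simpa using hv'⟩
      obtain ⟨v', hv''⟩ := s'.exists_lab_eq hm
      exact ⟨v', s.lab_inj ((hg v').trans hv'')⟩
  · obtain ⟨k, hk, hj⟩ := List.exists_pow_formPerm_filter s.nodup hlist (s'.complete e)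
    rw [s.next_eq, s'.next_eq]
    refine ⟨k, hk, fun j h0 h1 => ?_⟩
    have := hj j h0 h1
    rw [hS]
    simpa using this

end Spelling

/-- The list of passages that ends with the start of a given arc. -/
theorem exists_list (D : GaussDiagram) (a : D.Arc) : ∃ l : List D.Endpoint,
    l.Nodup ∧ (∀ e, e ∈ l) ∧ D.next = l.formPerm ∧ l.getLast? = a.start := by
  cases a with
  | circle h => exact ⟨[], List.nodup_nil, fun e => h.elim e.1, Equiv.ext fun e => h.elim e.1, rfl⟩
  | edge e =>
    have hsupp : ∀ f, f ∈ D.next.support := fun f => Equiv.Perm.mem_support.2 (D.next_ne_self f)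
    have hsame : ∀ f g, D.next.SameCycle f g := fun f g => D.cyclic.2 trivial trivial
    have hform : D.next = (D.next.toList (D.next e)).formPerm := by
      rw [Equiv.Perm.formPerm_toList]
      ext f : 1
      rw [Equiv.Perm.cycleOf_apply, if_pos (hsame _ _)]
    refine ⟨D.next.toList (D.next e), Equiv.Perm.nodup_toList _ _, fun f =>
      Equiv.Perm.mem_toList_iff.2 ⟨hsame _ _, hsupp _⟩, hform, ?_⟩
    have h0 : (D.next.toList (D.next e)).head? = some (D.next e) := by
      rw [List.head?_eq_getElem?, List.getElem?_eq_getElem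
        (Equiv.Perm.length_toList_pos_of_mem_support _ _ (hsupp _)),
        Equiv.Perm.toList_getElem_zero _ _ (hsupp _)]
    generalize D.next.toList (D.next e) = l at *
    obtain ⟨xs, rfl⟩ : ∃ xs, l = D.next e :: xs := List.head?_eq_some_iff.1 h0
    have h2 := List.formPerm_apply_getLast (D.next e) xs
    rw [← hform] at h2
    rw [List.getLast?_eq_some_getLast (List.cons_ne_nil _ xs), D.next.injective h2, Arc.start]

/-- Every diagram can be spelled, with the last letter at the start of a given arc. -/
theorem exists_spelling (D : GaussDiagram) (a : D.Arc) :
    ∃ (L : Word) (s : Spelling D L), s.list.getLast? = a.start := by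
  obtain ⟨l, h1, h2, h3, h4⟩ := D.exists_list a
  exact ⟨_, ⟨fun v => ((Fintype.equivFin D.V v : ℕ), D.sign v), fun v w h =>
    (Fintype.equivFin D.V).injective (Fin.ext (congrArg Prod.fst h)), fun _ => rfl, l, h1, h2, h3,
    rfl⟩, h4⟩

/-- Every Gauss code spells a diagram. -/
theorem IsGauss.exists_diagram {L : Word} (h : IsGauss L) :
    ∃ D : GaussDiagram, Nonempty (Spelling D L) := by
  classical
  have hfin : Finite {c : Label // (c, true) ∈ L} :=
    Finite.of_injective (β := {x // x ∈ L}) (fun c => ⟨(c.1, true), c.2⟩) fun c d hcd => by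
      simpa [Subtype.ext_iff] using hcd
  let V := {c : Label // (c, true) ∈ L}
  have hV : Fintype V := Fintype.ofFinite V
  let g : V × Bool → Label × Bool := fun e => (e.1.1, e.2 == decide (e.1.1.2 = 1))
  have hg : Function.Injective g := by
    rintro ⟨v, b⟩ ⟨w, c⟩ h
    obtain ⟨h1, h2⟩ := Prod.ext_iff.1 h
    obtain rfl : v = w := Subtype.ext h1
    have hb : ∀ b c p : Bool, (b == p) = (c == p) → b = c := by decide
    rw [hb b c _ h2]
  have hmem : ∀ c b, (c, b) ∈ L → (c, true) ∈ L := fun c b hcb => by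
    cases b
    · exact h.2 c false hcb
    · exact hcb
  obtain ⟨l, hl⟩ : ∃ l : List (V × Bool), l.map g = L := by
    have : L ∈ Set.range (List.map g) := by
      rw [Set.range_list_map]
      rintro ⟨c, b⟩ hcb
      refine ⟨(⟨c, hmem c b hcb⟩, b == decide (c.2 = 1)), ?_⟩
      have hb : ∀ b p : Bool, ((b == p) == p) = b := by decide
      exact Prod.ext rfl (hb b _)
    exact this
  have hn : l.Nodup := List.Nodup.of_map g (hl ▸ h.1)
  have hc : ∀ e, e ∈ l := fun e => by
    have : g e ∈ L := by
      obtain ⟨v, b⟩ := e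
      simp only [g]
      generalize (b == decide (v.1.2 = 1)) = b'
      cases b'
      · exact h.2 _ _ v.2
      · exact v.2
    rw [← hl, List.mem_map_of_injective hg] at this
    exact this
  refine ⟨⟨V, hV, inferInstance, fun c => c.1.2, l.formPerm, ?_⟩,
    ⟨⟨Subtype.val, Subtype.val_injective, fun _ => rfl, l, hn, hc, ?_, hl⟩⟩⟩
  · have := hn.isCycleOn_formPerm
    rwa [Set.eq_univ_of_forall (s := {a | a ∈ l}) hc] at this
  · rfl

end GaussDiagram

/-! ### Reidemeister moves given by successive passages -/

namespace GaussDiagram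

variable {D D' : GaussDiagram} {L L' : Word}

/-- The sign of a crossing whose over-passage starts on the given side. -/
def sideSign (b : Bool) : ℤˣ := if b then 1 else -1

theorem sideSign_not (b : Bool) : sideSign (!b) = - sideSign b := by
  cases b <;> decide

theorem next_next_ne_pt (D : GaussDiagram) {v w : D.V} {b : Bool} (h : v ≠ w) :
    D.next (D.next (D.pt v b)) ≠ D.pt v b := by
  refine D.next_next_ne
    (f := if D.next (D.pt v b) = D.pt w true then D.pt w false else D.pt w true) ?_ ?_
  · split_ifs <;> exact fun h' => h (congrArg Prod.fst h').symm
  · split_ifs with h'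
    · rw [h']
      intro h''
      have := congrArg D.side h''
      simp at this
    · exact fun h'' => h' h''.symm

theorem pt_snd_eq_true {v : D.V} {b : Bool} (h : D.sign v = sideSign b) :
    (D.pt v b).2 = true := by
  cases b <;> simp [pt, sideSign, h] at h ⊢

theorem pt_snd_eq_false {v : D.V} {b : Bool} (h : D.sign v = - sideSign b) :
    (D.pt v b).2 = false := by
  cases b <;> simp [pt, sideSign, h] at h ⊢

theorem sign_eq_or (D : GaussDiagram) (v : D.V) (b : Bool) :
    D.sign v = sideSign b ∨ D.sign v = - sideSign b := by
  rcases Int.units_eq_one_or (D.sign v) with h | h <;> cases b <;> rw [h] <;> decide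

theorem Spelling.exists_r1 (s : Spelling D L) (s' : Spelling D' L') {v : D.V} {b : Bool}
    (h : D.next (D.pt v b) = D.pt v (!b)) (hL : L' = L.filter fun x => x.1 ∉ [s.lab v]) :
    ∃ r : R1 D D', r.x.1 = v ∧ ∀ v', s.lab (r.del.emb v') = s'.lab v' := by
  obtain ⟨d, hd⟩ := s.exists_deletion s' hL (S := {v}) fun w => by
    rw [List.mem_singleton, s.lab_inj.eq_iff]; rfl
  exact ⟨⟨D.pt v b, by rw [h]; exact ⟨rfl, by cases b <;> simp [pt]⟩, d⟩, rfl, hd⟩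

theorem Spelling.exists_r2_of_passages (s : Spelling D L) (s' : Spelling D' L')
    {x y : D.Endpoint} (hx : x.2 = true ∧ (D.next x).2 = true)
    (hy : y.2 = false ∧ (D.next y).2 = false) (hne : x.1 ≠ (D.next x).1)
    (hc : (y.1 = x.1 ∧ (D.next y).1 = (D.next x).1) ∨ (y.1 = (D.next x).1 ∧ (D.next y).1 = x.1))
    (hs : D.sign (D.next x).1 = - D.sign x.1) {T : List Label}
    (hL : L' = L.filter fun x => x.1 ∉ T)
    (hT : ∀ u, s.lab u ∈ T ↔ u = x.1 ∨ u = (D.next x).1) :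
    ∃ r : R2 D D', r.x = x ∧ r.y = y ∧ ∀ v', s.lab (r.del.emb v') = s'.lab v' := by
  obtain ⟨d, hd⟩ := s.exists_deletion s' hL (S := {x.1, (D.next x).1}) fun u => (hT u).symm
  exact ⟨⟨x, y, hx, hy, hne, hc, hs, d⟩, rfl, rfl, hd⟩

/-- A second Reidemeister move is recognized by the sides of the passages: the signs decide which of
the two strands is the upper one. -/
theorem Spelling.exists_r2 (s : Spelling D L) (s' : Spelling D' L') {v w : D.V} {b : Bool}
    (hne : v ≠ w) (hs : D.sign w = - D.sign v) (h1 : D.next (D.pt v b) = D.pt w (!b))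
    (h2 : D.next (D.pt v (!b)) = D.pt w b ∨ D.next (D.pt w b) = D.pt v (!b))
    (hL : L' = L.filter fun x => x.1 ∉ [s.lab v, s.lab w]) :
    ∃ r : R2 D D', (∀ v', s.lab (r.del.emb v') = s'.lab v') ∧
      ((r.x.1 = v ∧ (D.next r.x).1 = w) ∨ (r.x.1 = w ∧ (D.next r.x).1 = v)) ∧
      (D.next (D.pt v (!b)) = D.pt w b → (r.x = D.pt v b ∧ r.y = D.pt v (!b)) ∨
        (r.x = D.pt v (!b) ∧ r.y = D.pt v b)) := by
  have hs' : D.sign v = - D.sign w := by rw [hs, neg_neg]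
  have hT : ∀ u, s.lab u ∈ [s.lab v, s.lab w] ↔ u = v ∨ u = w := fun u => by
    simp [s.lab_inj.eq_iff]
  have hT' : ∀ u, s.lab u ∈ [s.lab v, s.lab w] ↔ u = w ∨ u = v := fun u => by
    rw [hT, or_comm]
  rcases sign_eq_or D v b with hv | hv
  · have e1 : (D.pt v b).2 = true := pt_snd_eq_true hv
    have e2 : (D.pt w (!b)).2 = true := pt_snd_eq_true (by rw [hs, hv, sideSign_not])
    have e3 : (D.pt v (!b)).2 = false := pt_snd_eq_false (by rw [hv, sideSign_not, neg_neg])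
    have e4 : (D.pt w b).2 = false := pt_snd_eq_false (by rw [hs, hv])
    rcases h2 with h2 | h2
    · obtain ⟨r, hx, hy, hr⟩ := s.exists_r2_of_passages s' (x := D.pt v b) (y := D.pt v (!b))
        (by rw [h1]; exact ⟨e1, e2⟩) (by rw [h2]; exact ⟨e3, e4⟩) (by rw [h1]; exact hne)
        (by rw [h1, h2]; exact .inl ⟨rfl, rfl⟩) (by rw [h1]; exact hs) hL (by rw [h1]; exact hT)
      exact ⟨r, hr, .inl (by rw [hx, h1]; exact ⟨rfl, rfl⟩), fun _ => .inl ⟨hx, hy⟩⟩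
    · obtain ⟨r, hx, hy, hr⟩ := s.exists_r2_of_passages s' (x := D.pt v b) (y := D.pt w b)
        (by rw [h1]; exact ⟨e1, e2⟩) (by rw [h2]; exact ⟨e4, e3⟩) (by rw [h1]; exact hne)
        (by rw [h1, h2]; exact .inr ⟨rfl, rfl⟩) (by rw [h1]; exact hs) hL (by rw [h1]; exact hT)
      refine ⟨r, hr, .inl (by rw [hx, h1]; exact ⟨rfl, rfl⟩), fun h3 => ?_⟩
      exact absurd h2 (h3 ▸ D.next_next_ne_pt hne)
  · have e1 : (D.pt v b).2 = false := pt_snd_eq_false hv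
    have e2 : (D.pt w (!b)).2 = false := pt_snd_eq_false (by rw [hs, hv, sideSign_not])
    have e3 : (D.pt v (!b)).2 = true := pt_snd_eq_true (by rw [hv, sideSign_not])
    have e4 : (D.pt w b).2 = true := pt_snd_eq_true (by rw [hs, hv, neg_neg])
    rcases h2 with h2 | h2
    · obtain ⟨r, hx, hy, hr⟩ := s.exists_r2_of_passages s' (x := D.pt v (!b)) (y := D.pt v b)
        (by rw [h2]; exact ⟨e3, e4⟩) (by rw [h1]; exact ⟨e1, e2⟩) (by rw [h2]; exact hne)
        (by rw [h1, h2]; exact .inl ⟨rfl, rfl⟩) (by rw [h2]; exact hs) hL (by rw [h2]; exact hT)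
      exact ⟨r, hr, .inl (by rw [hx, h2]; exact ⟨rfl, rfl⟩), fun _ => .inr ⟨hx, hy⟩⟩
    · obtain ⟨r, hx, hy, hr⟩ := s.exists_r2_of_passages s' (x := D.pt w b) (y := D.pt v b)
        (by rw [h2]; exact ⟨e4, e3⟩) (by rw [h1]; exact ⟨e1, e2⟩) (by rw [h2]; exact hne.symm)
        (by rw [h1, h2]; exact .inr ⟨rfl, rfl⟩) (by rw [h2]; exact hs') hL (by rw [h2]; exact hT')
      refine ⟨r, hr, .inr (by rw [hx, h2]; exact ⟨rfl, rfl⟩), fun h3 => ?_⟩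
      exact absurd h2 (h3 ▸ D.next_next_ne_pt hne)

/-- Every triangle that satisfies the conditions in `R3` can be moved. -/
theorem exists_r3 (D : GaussDiagram) {a b c : D.V} (hab : a ≠ b) (hac : a ≠ c) (hbc : b ≠ c)
    {t m l : ℤˣ} (ht : D.Adjacent t (a, true) (b, true)) (hm : D.Adjacent m (a, false) (c, true))
    (hl : D.Adjacent l (b, false) (c, false))
    (htr : t * m * D.sign a = t * l * D.sign b ∧ t * l * D.sign b = m * l * D.sign c) :
    ∃ (D' : GaussDiagram) (r : R3 D D'), r.a = a ∧ r.b = b ∧ r.c = c ∧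
      r.t = t ∧ r.m = m ∧ r.l = l := by
  let τ : Equiv.Perm D.Endpoint := Equiv.swap (a, true) (b, true) *
    Equiv.swap (a, false) (c, true) * Equiv.swap (b, false) (c, false)
  refine ⟨⟨D.V, D.fintypeV, D.decEqV, D.sign, τ * D.next * τ⁻¹, ?_⟩,
    ⟨a, b, c, hab, hac, hbc, t, m, l, ht, hm, hl, htr, Equiv.refl _, fun _ => rfl, fun e => ?_⟩,
    rfl, rfl, rfl, rfl, rfl, rfl⟩
  · have := D.cyclic.conj (g := τ)
    rwa [Set.image_univ_of_surjective τ.surjective] at this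
  · change (τ * D.next * τ⁻¹) (τ e) = τ (D.next e)
    simp

end GaussDiagram

namespace VirtualKnot

open GaussDiagram

variable {K : VirtualKnot} {A : Type*} [AddCommGroup A] {p : K.CrossingFamily A}

theorem IsOrientedParity.eq_of_move (hp : IsOrientedParity p) {D D' : K.Diagram}
    (m : Move D.1 D'.1) {v : D.1.V} {v' : D'.1.V} (h : m.CrossingCorr v v') : p D v = p D' v' := by
  refine hp.P0 D D' (.comp (.refl _) m) v v' ?_
  rw [Morphism.CrossingCorr]
  refine ⟨v, ?_, h⟩
  rw [Morphism.CrossingCorr]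

theorem mk_eq_of_move' {D : K.Diagram} {D' : GaussDiagram} (m : Move D.1 D') :
    Quotient.mk knotSetoid D' = K := (mk_eq_of_move m).symm.trans D.2

theorem IsOrientedParity.relation (hp : IsOrientedParity p) (D : K.Diagram) {a b c : D.1.V}
    (hab : a ≠ b) (hac : a ≠ c) (hbc : b ≠ c) {t m l : ℤˣ}
    (ht : D.1.Adjacent t (a, true) (b, true)) (hm : D.1.Adjacent m (a, false) (c, true))
    (hl : D.1.Adjacent l (b, false) (c, false))
    (htr : t * m * D.1.sign a = t * l * D.1.sign b ∧
      t * l * D.1.sign b = m * l * D.1.sign c) :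
    (-(t * m)) • p D a + (t * l) • p D b + (-(m * l)) • p D c = 0 := by
  obtain ⟨D', r, rfl, rfl, rfl, rfl, rfl, rfl⟩ := exists_r3 D.1 hab hac hbc ht hm hl htr
  exact hp.P3 D ⟨D', mk_eq_of_move' (.r3 r)⟩ r

/-- The relation of a triangle, for a strand that crosses, for `b = true`, the first of two strands
from the right to the left at `u₁` and then the second one from the left to the right at `u₂`, while
the two strands cross at `v`; for `b = false` left and right are exchanged. The condition `hpat`
excludes the triangle in which each strand lies above the next one in cyclic order. -/
theorem IsOrientedParity.eq_add (hp : IsOrientedParity p) (D : K.Diagram) {u₁ u₂ v : D.1.V}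
    {b : Bool} (hne : u₁ ≠ u₂) (h1 : D.1.next (D.1.pt u₁ (!b)) = D.1.pt u₂ b)
    (h2 : D.1.next (D.1.pt u₁ b) = D.1.pt v b)
    (h3 : D.1.next (D.1.pt v (!b)) = D.1.pt u₂ (!b)) (hu₂ : D.1.sign u₂ = sideSign b)
    (hpat : D.1.sign u₁ = - sideSign b ∨
      (D.1.sign u₁ = sideSign b ∧ D.1.sign v = sideSign b)) :
    p D v = p D u₁ + p D u₂ := by
  have hn1 : u₁ ≠ v := fun h => D.1.next_ne_self (D.1.pt u₁ b) (by rw [h2, h])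
  have hn2 : u₂ ≠ v := fun h => D.1.next_ne_self (D.1.pt v (!b)) (by rw [h3, h])
  have key : ∀ (x : D.1.V) (c : Bool), D.1.sign x = sideSign c → D.1.pt x c = (x, true) :=
    fun x c h => Prod.ext rfl (pt_snd_eq_true h)
  have key' : ∀ (x : D.1.V) (c : Bool), D.1.sign x = - sideSign c → D.1.pt x c = (x, false) :=
    fun x c h => Prod.ext rfl (pt_snd_eq_false h)
  have hb : - sideSign b = sideSign (!b) := (sideSign_not b).symm
  have hb' : sideSign b = - sideSign (!b) := by rw [sideSign_not, neg_neg]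
  rw [key u₂ b hu₂] at h1
  rw [key' u₂ (!b) (hu₂.trans hb')] at h3
  have one : ∀ e f, D.1.next e = f → D.1.Adjacent 1 e f := fun e f h => by
    rw [Adjacent, if_pos rfl]; exact h
  have neg_one : ∀ e f, D.1.next f = e → D.1.Adjacent (-1) e f := fun e f h => by
    rw [Adjacent, if_neg (by decide)]; exact h
  rcases hpat with hu₁ | ⟨hu₁, hv⟩
  · rw [key u₁ (!b) (hu₁.trans hb)] at h1
    rw [key' u₁ b hu₁] at h2
    rcases sign_eq_or D.1 v b with hv | hv
    · rw [key v b hv] at h2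
      rw [key' v (!b) (hv.trans hb')] at h3
      have := hp.relation D hne hn1 hn2 (one _ _ h1) (one _ _ h2) (neg_one _ _ h3)
        (by rw [hu₁, hu₂, hv]; simp)
      simp only [mul_one, one_mul, neg_neg, Units.neg_smul, one_smul] at this
      grind
    · rw [key' v b hv] at h2
      rw [key v (!b) (hv.trans hb)] at h3
      have := hp.relation D hne.symm hn2 hn1 (neg_one _ _ h1) (neg_one _ _ h3) (one _ _ h2)
        (by rw [hu₁, hu₂, hv]; simp)
      simp only [mul_one, neg_mul_neg, neg_neg, Units.neg_smul, one_smul] at this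
      grind
  · rw [key' u₁ (!b) (hu₁.trans hb')] at h1
    rw [key u₁ b hu₁, key v b hv] at h2
    rw [key' v (!b) (hv.trans hb')] at h3
    have := hp.relation D hn1 hne hn2.symm (one _ _ h2) (one _ _ h1) (one _ _ h3)
      (by rw [hu₁, hu₂, hv]; simp)
    simp only [mul_one, Units.neg_smul, one_smul] at this
    grind

end VirtualKnot

/-! ### The values of a parity in terms of Gauss codes -/

namespace GaussDiagram

/-- The label `u` does not occur in the word `L`. -/
def Fresh (u : Label) (L : Word) : Prop := ∀ b, (u, b) ∉ L

@[simp] theorem fresh_nil (u : Label) : Fresh u [] := fun _ => List.not_mem_nil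

@[simp] theorem fresh_cons {u : Label} {x : Label × Bool} {L : Word} :
    Fresh u (x :: L) ↔ u ≠ x.1 ∧ Fresh u L := by
  obtain ⟨c, b⟩ := x
  simp only [Fresh, List.mem_cons, Prod.mk.injEq, not_or, not_and, forall_and]
  refine and_congr_left fun _ => ⟨fun h hu => h b hu rfl, fun h _ hu => absurd hu h⟩

@[simp] theorem fresh_append {u : Label} {L L' : Word} :
    Fresh u (L ++ L') ↔ Fresh u L ∧ Fresh u L' := by
  simp only [Fresh, List.mem_append, not_or, forall_and]

theorem Fresh.fst_ne {u : Label} {L : Word} (h : Fresh u L) {x : Label × Bool} (hx : x ∈ L) :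
    x.1 ≠ u := by
  rintro rfl
  exact h x.2 hx

theorem Fresh.filter_eq {T : List Label} {L : Word} (h : ∀ u ∈ T, Fresh u L) :
    (L.filter fun x => x.1 ∉ T) = L := by
  refine List.filter_eq_self.2 fun x hx => ?_
  simp only [decide_eq_true_eq]
  exact fun hT => (h _ hT).fst_ne hx rfl

theorem IsGauss.perm {L L' : Word} (h : IsGauss L) (hL : L.Perm L') : IsGauss L' :=
  ⟨hL.nodup_iff.1 h.1, fun c b hb => hL.mem_iff.1 (h.2 c b (hL.mem_iff.2 hb))⟩

theorem isGauss_cons_cons {u : Label} {b : Bool} {L : Word} :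
    IsGauss ((u, b) :: (u, !b) :: L) ↔ Fresh u L ∧ IsGauss L := by
  constructor
  · rintro ⟨h1, h2⟩
    rw [List.nodup_cons, List.nodup_cons, List.mem_cons, not_or] at h1
    have hf : Fresh u L := fun b' => by
      rcases Bool.eq_or_eq_not b' b with rfl | rfl
      exacts [h1.1.2, h1.2.1]
    refine ⟨hf, h1.2.2, fun c b' hc => ?_⟩
    have := h2 c b' (List.mem_cons_of_mem _ (List.mem_cons_of_mem _ hc))
    have hcu : c ≠ u := hf.fst_ne hc
    simpa [hcu] using this
  · rintro ⟨hf, h1, h2⟩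
    refine ⟨?_, fun c b' hc => ?_⟩
    · rw [List.nodup_cons, List.nodup_cons, List.mem_cons, not_or]
      exact ⟨⟨by simp, hf b⟩, hf _, h1⟩
    · simp only [List.mem_cons, Prod.mk.injEq] at hc ⊢
      rcases hc with ⟨rfl, rfl⟩ | ⟨rfl, rfl⟩ | hc
      · simp
      · simp
      · exact .inr (.inr (h2 c b' hc))

theorem exists_bound (L : Word) : ∃ N, ∀ n ε, N ≤ n → Fresh (n, ε) L := by
  induction L with
  | nil => exact ⟨0, fun _ _ _ => fresh_nil _⟩
  | cons x L ih =>
    obtain ⟨N, hN⟩ := ih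
    refine ⟨max N (x.1.1 + 1), fun n ε hn => fresh_cons.2 ⟨?_, hN n ε (le_of_max_le_left hn)⟩⟩
    rintro h
    have := le_of_max_le_right hn
    rw [← h] at this
    exact absurd this (by simp)

end GaussDiagram

namespace VirtualKnot

open GaussDiagram

variable {K : VirtualKnot} {A : Type*} [AddCommGroup A] {p : K.CrossingFamily A}

/-- `L` is the Gauss code of a diagram of `K`. -/
def Spells (K : VirtualKnot) (L : Word) : Prop := ∃ D : K.Diagram, Nonempty (Spelling D.1 L)

open Classical in
/-- The value of `p` at the crossing with label `c` of a diagram of `K` with Gauss code `L`, see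
`IsOrientedParity.wordValue_eq`; it is zero if there is no such crossing. The diagram is unique up
to isomorphism, so for a parity the value does not depend on its choice. -/
noncomputable def wordValue (p : K.CrossingFamily A) (L : Word) (c : Label) : A :=
  if h : ∃ (D : K.Diagram) (s : Spelling D.1 L) (v : D.1.V), s.lab v = c then
    p h.choose h.choose_spec.choose_spec.choose else 0

theorem Spells.isGauss {L : Word} (h : K.Spells L) : IsGauss L := by
  obtain ⟨D, ⟨s⟩⟩ := h
  exact s.isGauss

namespace IsOrientedParity

theorem wordValue_eq (hp : IsOrientedParity p) {L : Word} {D : K.Diagram} (s : Spelling D.1 L)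
    (v : D.1.V) : wordValue p L (s.lab v) = p D v := by
  have h : ∃ (D' : K.Diagram) (s' : Spelling D'.1 L) (v' : D'.1.V), s'.lab v' = s.lab v :=
    ⟨D, s, v, rfl⟩
  rw [wordValue, dif_pos h]
  obtain ⟨i, hi⟩ := h.choose_spec.choose.exists_iso s
  refine hp.eq_of_move (.iso i) (?_ : i.equiv _ = v)
  exact s.lab_inj ((hi _).trans h.choose_spec.choose_spec.choose_spec)

/-- If a move preserves the labels of the crossings that survive, it preserves their values. -/
theorem wordValue_eq_of_move (hp : IsOrientedParity p) {L L' : Word} {D D' : K.Diagram}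
    (s : Spelling D.1 L) (s' : Spelling D'.1 L') (m : Move D.1 D'.1) {c : Label} {b : Bool}
    (hc : (c, b) ∈ L') (hm : ∀ v', ∃ v, m.CrossingCorr v v' ∧ s.lab v = s'.lab v') :
    wordValue p L c = wordValue p L' c := by
  obtain ⟨v', rfl⟩ := s'.exists_lab_eq hc
  obtain ⟨v, hv, h⟩ := hm v'
  rw [hp.wordValue_eq s', ← h, hp.wordValue_eq s, hp.eq_of_move m hv]

end IsOrientedParity

theorem Spells.rotate {A B : Word} (h : K.Spells (A ++ B)) : K.Spells (B ++ A) := by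
  obtain ⟨D, ⟨s⟩⟩ := h
  obtain ⟨s', -⟩ := s.rotate
  exact ⟨D, ⟨s'⟩⟩

theorem IsOrientedParity.wordValue_rotate (hp : IsOrientedParity p) {L₁ L₂ : Word}
    (h : K.Spells (L₁ ++ L₂)) {c : Label} {b : Bool} (hc : (c, b) ∈ L₁ ++ L₂) :
    wordValue p (L₁ ++ L₂) c = wordValue p (L₂ ++ L₁) c := by
  obtain ⟨D, ⟨s⟩⟩ := h
  obtain ⟨s', hs'⟩ := s.rotate
  obtain ⟨v, rfl⟩ := s.exists_lab_eq hc
  rw [hp.wordValue_eq s, ← hs', hp.wordValue_eq s']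

/-- The labels may be changed. -/
theorem _root_.GaussDiagram.Spelling.exists_relabel {D : GaussDiagram} {L : Word}
    (s : Spelling D L) {g : Label → Label} (hg : ∀ x ∈ L, ∀ y ∈ L, g x.1 = g y.1 → x.1 = y.1)
    (hs : ∀ x ∈ L, (g x.1).2 = x.1.2) :
    ∃ s' : Spelling D (L.map (Prod.map g id)), ∀ v, s'.lab v = g (s.lab v) := by
  refine ⟨⟨fun v => g (s.lab v), fun v w h => ?_, fun v => ?_, s.list, s.nodup, s.complete,
    s.next_eq, ?_⟩, fun _ => rfl⟩
  · exact s.lab_inj (hg _ (s.mem (v, true)) _ (s.mem (w, true)) h)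
  · exact (hs _ (s.mem (v, true))).trans (s.sign_lab v)
  · refine Eq.trans ?_ (congrArg (List.map (Prod.map g id)) s.map_eq)
    rw [List.map_map]
    rfl

theorem IsOrientedParity.wordValue_relabel (hp : IsOrientedParity p) {L : Word} (h : K.Spells L)
    {g : Label → Label} (hg : ∀ x ∈ L, ∀ y ∈ L, g x.1 = g y.1 → x.1 = y.1)
    (hs : ∀ x ∈ L, (g x.1).2 = x.1.2) {c : Label} {b : Bool} (hc : (c, b) ∈ L) :
    wordValue p (L.map (Prod.map g id)) (g c) = wordValue p L c := by
  obtain ⟨D, ⟨s⟩⟩ := h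
  obtain ⟨s', hs'⟩ := s.exists_relabel hg hs
  obtain ⟨v, rfl⟩ := s.exists_lab_eq hc
  rw [← hs', hp.wordValue_eq s', hp.wordValue_eq s]

/-! ### Reidemeister moves on Gauss codes -/

section rules

variable {L L' X Y Z β : Word} {u w : Label} {s : Bool}

theorem isGauss_r1 (hL : L = X ++ (u, s) :: (u, !s) :: Y) (hL' : L' = X ++ Y) :
    IsGauss L ↔ Fresh u L' ∧ IsGauss L' := by
  have hP : L.Perm ((u, s) :: (u, !s) :: L') := by
    subst hL hL'
    exact List.perm_middle.trans (List.perm_middle.cons _)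
  rw [← isGauss_cons_cons]
  exact ⟨fun h => h.perm hP, fun h => h.perm hP.symm⟩

theorem isGauss_r2 (hβ : β = [(u, !s), (w, s)] ∨ β = [(w, s), (u, !s)])
    (hL : L = X ++ (u, s) :: (w, !s) :: (Y ++ β ++ Z)) (hL' : L' = X ++ Y ++ Z) (huw : u ≠ w) :
    IsGauss L ↔ Fresh u L' ∧ Fresh w L' ∧ IsGauss L' := by
  have hP : L.Perm ((u, s) :: (u, !s) :: (w, s) :: (w, !s) :: L') := by
    subst hL hL'
    rw [List.perm_iff_count]
    intro x
    rcases hβ with rfl | rfl <;> simp [List.count_cons] <;> omega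
  have : IsGauss ((u, s) :: (u, !s) :: (w, s) :: (w, !s) :: L') ↔
      Fresh u L' ∧ Fresh w L' ∧ IsGauss L' := by
    rw [isGauss_cons_cons, isGauss_cons_cons]
    simp [huw]
  rw [← this]
  exact ⟨fun h => h.perm hP, fun h => h.perm hP.symm⟩

theorem filter_r1 (hL : L = X ++ (u, s) :: (u, !s) :: Y) (hL' : L' = X ++ Y) (h : IsGauss L) :
    L' = L.filter fun x => x.1 ∉ [u] := by
  obtain ⟨h1, -⟩ := (isGauss_r1 hL hL').1 h
  rw [hL', fresh_append] at h1
  have hX := Fresh.filter_eq (T := [u]) (L := X) (by simpa using h1.1)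
  have hY := Fresh.filter_eq (T := [u]) (L := Y) (by simpa using h1.2)
  subst hL hL'
  rw [List.filter_append, hX, List.filter_cons_of_neg (by simp), List.filter_cons_of_neg (by simp),
    hY]

theorem filter_r2 (hβ : β = [(u, !s), (w, s)] ∨ β = [(w, s), (u, !s)])
    (hL : L = X ++ (u, s) :: (w, !s) :: (Y ++ β ++ Z)) (hL' : L' = X ++ Y ++ Z) (huw : u ≠ w)
    (h : IsGauss L) : L' = L.filter fun x => x.1 ∉ [u, w] := by
  obtain ⟨h1, h2, -⟩ := (isGauss_r2 hβ hL hL' huw).1 h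
  rw [hL', fresh_append, fresh_append] at h1 h2
  have hX := Fresh.filter_eq (T := [u, w]) (L := X) (by simpa using ⟨h1.1.1, h2.1.1⟩)
  have hY := Fresh.filter_eq (T := [u, w]) (L := Y) (by simpa using ⟨h1.1.2, h2.1.2⟩)
  have hZ := Fresh.filter_eq (T := [u, w]) (L := Z) (by simpa using ⟨h1.2, h2.2⟩)
  have hb : (β.filter fun x => x.1 ∉ [u, w]) = [] := by
    rcases hβ with rfl | rfl <;> simp
  subst hL hL'
  rw [List.filter_append, hX, List.filter_cons_of_neg (by simp), List.filter_cons_of_neg (by simp),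
    List.filter_append, List.filter_append, hY, hZ, hb, List.append_nil, List.append_assoc]

theorem _root_.GaussDiagram.ne_of_sign {u w : Label} (h : w.2 = - u.2) : u ≠ w := by
  rintro rfl
  rcases Int.units_eq_one_or u.2 with h' | h' <;> rw [h'] at h <;> exact absurd h (by decide)

theorem exists_r1_of_word {D D' : GaussDiagram} (t : Spelling D L) (t' : Spelling D' L')
    (hL : L = X ++ (u, s) :: (u, !s) :: Y) (hL' : L' = X ++ Y) :
    ∃ r : R1 D D', t.lab r.x.1 = u ∧ ∀ v', t.lab (r.del.emb v') = t'.lab v' := by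
  obtain ⟨v, rfl⟩ := t.exists_lab_eq (c := u) (b := s) (by simp [hL])
  obtain ⟨r, h1, h2⟩ := t.exists_r1 t' (t.next_of_append hL) (filter_r1 hL hL' t.isGauss)
  exact ⟨r, by rw [h1], h2⟩

theorem exists_r2_of_word {D D' : GaussDiagram} (t : Spelling D L) (t' : Spelling D' L')
    (hβ : β = [(u, !s), (w, s)] ∨ β = [(w, s), (u, !s)])
    (hL : L = X ++ (u, s) :: (w, !s) :: (Y ++ β ++ Z)) (hL' : L' = X ++ Y ++ Z)
    (hs : w.2 = - u.2) :
    ∃ r : R2 D D', (∀ v', t.lab (r.del.emb v') = t'.lab v') ∧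
      ((t.lab r.x.1 = u ∧ t.lab (D.next r.x).1 = w) ∨
        (t.lab r.x.1 = w ∧ t.lab (D.next r.x).1 = u)) := by
  have huw : u ≠ w := ne_of_sign hs
  obtain ⟨v, rfl⟩ := t.exists_lab_eq (c := u) (b := s) (by simp [hL])
  obtain ⟨v', rfl⟩ := t.exists_lab_eq (c := w) (b := !s) (by simp [hL])
  obtain ⟨r, h1, h2, -⟩ := t.exists_r2 t' (v := v) (w := v') (b := s) (fun h => huw (by rw [h]))
    (by rw [← t.sign_lab, ← t.sign_lab, hs]) (t.next_of_append hL)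
    (by
      rcases hβ with rfl | rfl
      · exact .inl (t.next_of_append (A := X ++ (t.lab v, s) :: (t.lab v', !s) :: Y) (B := Z)
          (by simp [hL]))
      · exact .inr (t.next_of_append (A := X ++ (t.lab v, s) :: (t.lab v', !s) :: Y) (B := Z)
          (by simp [hL])))
    (filter_r2 hβ hL hL' huw t.isGauss)
  refine ⟨r, h1, ?_⟩
  rcases h2 with ⟨h2, h3⟩ | ⟨h2, h3⟩
  · exact .inl ⟨by rw [h2], by rw [h3]⟩
  · exact .inr ⟨by rw [h2], by rw [h3]⟩

theorem IsOrientedParity.r1 (hp : IsOrientedParity p) (h : K.Spells L)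
    (hL : L = X ++ (u, s) :: (u, !s) :: Y) (hL' : L' = X ++ Y) :
    K.Spells L' ∧ wordValue p L u = 0 ∧
      ∀ c b, (c, b) ∈ L' → wordValue p L c = wordValue p L' c := by
  obtain ⟨D, ⟨t⟩⟩ := h
  obtain ⟨D', ⟨t'⟩⟩ := ((isGauss_r1 hL hL').1 t.isGauss).2.exists_diagram
  obtain ⟨r, h1, h2⟩ := exists_r1_of_word t t' hL hL'
  have hD' := mk_eq_of_move' (.r1 r)
  refine ⟨⟨⟨D', hD'⟩, ⟨t'⟩⟩, ?_, fun c b hc => ?_⟩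
  · rw [← h1, hp.wordValue_eq t, hp.P1 D ⟨D', hD'⟩ r]
  · exact hp.wordValue_eq_of_move (D' := ⟨D', hD'⟩) t t' (.r1 r) hc fun v' => ⟨_, rfl, h2 v'⟩

theorem Spells.insert_r1 (h : K.Spells L') (hL : L = X ++ (u, s) :: (u, !s) :: Y)
    (hL' : L' = X ++ Y) (hu : Fresh u L') : K.Spells L := by
  obtain ⟨D', ⟨t'⟩⟩ := h
  obtain ⟨D, ⟨t⟩⟩ := ((isGauss_r1 hL hL').2 ⟨hu, t'.isGauss⟩).exists_diagram
  obtain ⟨r, -, -⟩ := exists_r1_of_word t t' hL hL'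
  exact ⟨⟨D, mk_eq_of_move' (.r1Inv r)⟩, ⟨t⟩⟩

theorem IsOrientedParity.r2 (hp : IsOrientedParity p) (h : K.Spells L)
    (hβ : β = [(u, !s), (w, s)] ∨ β = [(w, s), (u, !s)])
    (hL : L = X ++ (u, s) :: (w, !s) :: (Y ++ β ++ Z)) (hL' : L' = X ++ Y ++ Z)
    (hs : w.2 = - u.2) :
    K.Spells L' ∧ wordValue p L u + wordValue p L w = 0 ∧
      ∀ c b, (c, b) ∈ L' → wordValue p L c = wordValue p L' c := by
  obtain ⟨D, ⟨t⟩⟩ := h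
  obtain ⟨D', ⟨t'⟩⟩ := ((isGauss_r2 hβ hL hL' (ne_of_sign hs)).1 t.isGauss).2.2.exists_diagram
  obtain ⟨r, h1, h2⟩ := exists_r2_of_word t t' hβ hL hL' hs
  have hD' := mk_eq_of_move' (.r2 r)
  refine ⟨⟨⟨D', hD'⟩, ⟨t'⟩⟩, ?_, fun c b hc => ?_⟩
  · have := hp.P2 D ⟨D', hD'⟩ r
    rcases h2 with ⟨rfl, rfl⟩ | ⟨rfl, rfl⟩
    · rwa [hp.wordValue_eq t, hp.wordValue_eq t]
    · rwa [hp.wordValue_eq t, hp.wordValue_eq t, add_comm]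
  · exact hp.wordValue_eq_of_move (D' := ⟨D', hD'⟩) t t' (.r2 r) hc fun v' => ⟨_, rfl, h1 v'⟩

theorem Spells.insert_r2 (h : K.Spells L')
    (hβ : β = [(u, !s), (w, s)] ∨ β = [(w, s), (u, !s)])
    (hL : L = X ++ (u, s) :: (w, !s) :: (Y ++ β ++ Z)) (hL' : L' = X ++ Y ++ Z)
    (hs : w.2 = - u.2) (hu : Fresh u L') (hw : Fresh w L') : K.Spells L := by
  obtain ⟨D', ⟨t'⟩⟩ := h
  obtain ⟨D, ⟨t⟩⟩ := ((isGauss_r2 hβ hL hL' (ne_of_sign hs)).2 ⟨hu, hw, t'.isGauss⟩).exists_diagram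
  obtain ⟨r, -, -⟩ := exists_r2_of_word t t' hβ hL hL' hs
  exact ⟨⟨D, mk_eq_of_move' (.r2Inv r)⟩, ⟨t⟩⟩

/-- The relation of a triangle, see `IsOrientedParity.eq_add`. -/
theorem IsOrientedParity.r3 (hp : IsOrientedParity p) (h : K.Spells L) {v : Label}
    (hne : u ≠ w) (h1 : [(u, !s), (w, s)] <:+: L) (h2 : [(u, s), (v, s)] <:+: L)
    (h3 : [(v, !s), (w, !s)] <:+: L) (hw : w.2 = sideSign s)
    (hpat : u.2 = - sideSign s ∨ (u.2 = sideSign s ∧ v.2 = sideSign s)) :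
    wordValue p L v = wordValue p L u + wordValue p L w := by
  obtain ⟨D, ⟨t⟩⟩ := h
  obtain ⟨P1, Q1, h1⟩ := h1
  obtain ⟨P2, Q2, h2⟩ := h2
  obtain ⟨P3, Q3, h3⟩ := h3
  obtain ⟨u, rfl⟩ := t.exists_lab_eq (c := u) (b := !s) (by simp [← h1])
  obtain ⟨w, rfl⟩ := t.exists_lab_eq (c := w) (b := s) (by simp [← h1])
  obtain ⟨v, rfl⟩ := t.exists_lab_eq (c := v) (b := s) (by simp [← h2])
  rw [hp.wordValue_eq, hp.wordValue_eq, hp.wordValue_eq]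
  rw [t.sign_lab, t.sign_lab] at hpat
  rw [t.sign_lab] at hw
  refine hp.eq_add D (b := s) (fun h => hne (by rw [h])) ?_ ?_ ?_ hw hpat
  · exact t.next_of_append (A := P1) (B := Q1) (by simp [← h1])
  · exact t.next_of_append (A := P2) (B := Q2) (by simp [← h2])
  · exact t.next_of_append (A := P3) (B := Q3) (by simp [← h3])

end rules

end VirtualKnot

namespace VirtualKnot

open GaussDiagram

variable {K : VirtualKnot} {A : Type*} [AddCommGroup A] {p : K.CrossingFamily A}

/-! ### The value of a bigon -/

/-- The result of an increasing second Reidemeister move on the Gauss code `X ++ Y`: a bigon with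
the crossings `u`, `w` between the closing arc of the word and the arc between `X` and `Y`. -/
def bigon (u w : Label) (s : Bool) (X Y : Word) : Word :=
  (u, s) :: (w, !s) :: (X ++ (u, !s) :: (w, s) :: Y)

open Classical in
/-- The value of `p` at the first crossing `u` of a bigon between the closing arc of the word `X ++
Y` and the arc between `X` and `Y`, such that the closing arc passes `u` from the lower left. By
`IsOrientedParity.wordValue_bigon_true` it does not depend on the labels and signs of the new
crossings. -/
noncomputable def bigonValue (p : K.CrossingFamily A) (X Y : Word) : A :=
  wordValue p (bigon ((exists_bound (X ++ Y)).choose, 1) ((exists_bound (X ++ Y)).choose, -1)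
    true X Y) ((exists_bound (X ++ Y)).choose, 1)

/-- The value at the first crossing of `bigon u w s X Y`, see `IsOrientedParity.wordValue_bigon`. If
`s = false`, it is the second strand that passes `u` from the lower left, and the word is cut open
at this strand. -/
noncomputable def sidedBigonValue (p : K.CrossingFamily A) (s : Bool) (X Y : Word) : A :=
  if s then bigonValue p X Y else bigonValue p Y X

section bigon

variable {L X Y Z : Word} {u w u' w' v : Label} {s : Bool}

theorem Spells.bigon (h : K.Spells (X ++ Y)) (hu : Fresh u (X ++ Y)) (hw : Fresh w (X ++ Y))
    (hs : w.2 = - u.2) : K.Spells (bigon u w s X Y) :=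
  h.insert_r2 (X := []) (Y := X) (Z := Y) (s := s) (.inl rfl) (by simp [VirtualKnot.bigon])
    (by simp) hs hu hw

theorem isGauss_bigon (h : IsGauss (bigon u w s X Y)) (hs : w.2 = - u.2) :
    Fresh u (X ++ Y) ∧ Fresh w (X ++ Y) :=
  have := (isGauss_r2 (X := []) (Y := X) (Z := Y) (L' := X ++ Y) (s := s) (.inl rfl)
    (by simp [VirtualKnot.bigon]) (by simp) (ne_of_sign hs)).1 h
  ⟨this.1, this.2.1⟩

theorem mem_bigon : (u, s) ∈ bigon u w s X Y := List.mem_cons_self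

theorem bigon_relabel {g : Label → Label} (hX : ∀ x ∈ X ++ Y, g x.1 = x.1) (hu : g u = u')
    (hw : g w = w') : (bigon u w s X Y).map (Prod.map g id) = bigon u' w' s X Y := by
  have : ∀ Z : Word, (∀ x ∈ Z, g x.1 = x.1) → Z.map (Prod.map g id) = Z := fun Z hZ => by
    conv_rhs => rw [← Z.map_id]
    exact List.map_congr_left fun x hx => Prod.ext (hZ x hx) rfl
  rw [bigon, bigon, List.map_cons, List.map_cons, List.map_append, List.map_cons, List.map_cons,
    this X fun x hx => hX x (List.mem_append_left _ hx),
    this Y fun x hx => hX x (List.mem_append_right _ hx)]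
  simp [hu, hw]

namespace IsOrientedParity

theorem wordValue_bigon_relabel (hp : IsOrientedParity p) (h : K.Spells (bigon u w s X Y))
    (hs : w.2 = - u.2) (hu : u'.2 = u.2) (hw : w'.2 = w.2) (hu' : Fresh u' (X ++ Y))
    (hw' : Fresh w' (X ++ Y)) :
    wordValue p (bigon u' w' s X Y) u' = wordValue p (bigon u w s X Y) u := by
  obtain ⟨h1, h2⟩ := isGauss_bigon h.isGauss hs
  have hne : u ≠ w := ne_of_sign hs
  have hne' : u' ≠ w := ne_of_sign (by rw [hs, hu])
  have hne'' : u ≠ w' := ne_of_sign (by rw [hw, hs])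
  have hne3 : u' ≠ w' := ne_of_sign (by rw [hw, hs, hu])
  let g : Equiv.Perm Label := Equiv.swap u u' * Equiv.swap w w'
  have hgu : g u = u' := by
    simp only [g, Equiv.Perm.mul_apply]
    rw [Equiv.swap_apply_of_ne_of_ne hne hne'', Equiv.swap_apply_left]
  have hgw : g w = w' := by
    simp only [g, Equiv.Perm.mul_apply]
    rw [Equiv.swap_apply_left, Equiv.swap_apply_of_ne_of_ne hne''.symm hne3.symm]
  have hg : ∀ x ∈ X ++ Y, g x.1 = x.1 := fun x hx => by
    simp only [g, Equiv.Perm.mul_apply]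
    rw [Equiv.swap_apply_of_ne_of_ne (h2.fst_ne hx) (hw'.fst_ne hx),
      Equiv.swap_apply_of_ne_of_ne (h1.fst_ne hx) (hu'.fst_ne hx)]
  rw [← bigon_relabel hg hgu hgw, ← hgu]
  refine hp.wordValue_relabel h (fun x _ y _ hxy => g.injective hxy) (fun x hx => ?_) mem_bigon
  rw [bigon, List.mem_cons, List.mem_cons, List.mem_append, List.mem_cons, List.mem_cons] at hx
  rcases hx with rfl | rfl | hx | rfl | rfl | hx
  · simp only [hgu, hu]
  · simp only [hgw, hw]
  · rw [hg x (List.mem_append_left _ hx)]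
  · simp only [hgu, hu]
  · simp only [hgw, hw]
  · rw [hg x (List.mem_append_right _ hx)]

theorem r2_bigon (hp : IsOrientedParity p) (h : K.Spells (bigon u w s X Y)) (hs : w.2 = - u.2) :
    K.Spells (X ++ Y) ∧
      wordValue p (bigon u w s X Y) u + wordValue p (bigon u w s X Y) w = 0 ∧
      ∀ c b, (c, b) ∈ X ++ Y → wordValue p (bigon u w s X Y) c = wordValue p (X ++ Y) c :=
  hp.r2 (X := []) (Y := X) (Z := Y) (s := s) h (.inl rfl) (by simp [bigon]) (by simp) hs

/-- Push strands from the closing arc to the arc before the first passage of `v` and to the arc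
after its second passage. The two arcs bound a quadrant at `v`, in which the pushed pieces form a
triangle with `v`; its relation expresses the value of `v`. The condition `hpat` is the one of
`IsOrientedParity.eq_add`. -/
theorem wordValue_eq_bigon_sub (hp : IsOrientedParity p)
    (h : K.Spells (X ++ (v, s) :: (Y ++ (v, !s) :: Z))) {u₁ w₁ u₂ w₂ : Label}
    (hf : ∀ x ∈ [u₁, w₁, u₂, w₂], Fresh x (X ++ (v, s) :: (Y ++ (v, !s) :: Z)))
    (h12 : u₁ ≠ u₂ ∧ u₁ ≠ w₂ ∧ w₁ ≠ u₂ ∧ w₁ ≠ w₂) (hs₁ : w₁.2 = - u₁.2) (hs₂ : w₂.2 = - u₂.2)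
    (hu₂ : u₂.2 = sideSign s)
    (hpat : u₁.2 = - sideSign s ∨ (u₁.2 = sideSign s ∧ v.2 = sideSign s)) :
    wordValue p (X ++ (v, s) :: (Y ++ (v, !s) :: Z)) v =
      wordValue p (bigon u₂ w₂ s (X ++ (v, s) :: (Y ++ [(v, !s)])) Z) u₂ -
        wordValue p (bigon w₁ u₁ s X ((v, s) :: (Y ++ (v, !s) :: Z))) w₁ := by
  simp only [List.forall_mem_cons, fresh_append, fresh_cons, ne_eq] at hf
  have hs₁' : u₁.2 = - w₁.2 := by rw [hs₁, neg_neg]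
  have hb1 : K.Spells (bigon w₁ u₁ s X ((v, s) :: (Y ++ (v, !s) :: Z))) :=
    h.bigon (by simp [hf]) (by simp [hf]) hs₁'
  -- the word with both bigons
  let W : Word := (w₁, s) :: (u₁, !s) :: (u₂, s) :: (w₂, !s) :: (X ++ (w₁, !s) :: (u₁, s) ::
    (v, s) :: (Y ++ (v, !s) :: (u₂, !s) :: (w₂, s) :: Z))
  have hL : W = [(w₁, s), (u₁, !s)] ++ (u₂, s) :: (w₂, !s) :: ((X ++ (w₁, !s) :: (u₁, s) ::
    (v, s) :: (Y ++ [(v, !s)])) ++ [(u₂, !s), (w₂, s)] ++ Z) := by simp [W]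
  have hL' : bigon w₁ u₁ s X ((v, s) :: (Y ++ (v, !s) :: Z)) = [(w₁, s), (u₁, !s)] ++
    (X ++ (w₁, !s) :: (u₁, s) :: (v, s) :: (Y ++ [(v, !s)])) ++ Z := by simp [bigon]
  have hW : K.Spells W := hb1.insert_r2 (.inl rfl) hL hL' hs₂
    (by simp [hf, bigon, h12.1.symm, h12.2.2.1.symm])
    (by simp [hf, bigon, h12.2.1.symm, h12.2.2.2.symm])
  obtain ⟨-, h2, h3⟩ := hp.r2 hW (.inl rfl) hL hL' hs₂
  obtain ⟨-, h4, h5⟩ := hp.r2_bigon hb1 hs₁'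
  obtain ⟨-, h6, h7⟩ := hp.r2 hW (X := []) (u := w₁) (w := u₁) (s := s)
    (Y := (u₂, s) :: (w₂, !s) :: X)
    (Z := (v, s) :: (Y ++ (v, !s) :: (u₂, !s) :: (w₂, s) :: Z))
    (L' := bigon u₂ w₂ s (X ++ (v, s) :: (Y ++ [(v, !s)])) Z) (.inl rfl)
    (by simp [W]) (by simp [bigon]) hs₁'
  have h8 := hp.r3 hW (u := u₁) (w := u₂) (v := v) (s := s) h12.1
    ⟨[(w₁, s)], _, rfl⟩ ⟨(w₁, s) :: (u₁, !s) :: (u₂, s) :: (w₂, !s) :: (X ++ [(w₁, !s)]),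
      Y ++ (v, !s) :: (u₂, !s) :: (w₂, s) :: Z, by simp [W]⟩
    ⟨(w₁, s) :: (u₁, !s) :: (u₂, s) :: (w₂, !s) :: (X ++ (w₁, !s) :: (u₁, s) ::
      (v, s) :: Y), (w₂, s) :: Z, by simp [W]⟩ hu₂ hpat
  rw [← h5 v s (by simp), ← h3 v s (by simp [bigon]), ← h3 w₁ s mem_bigon, ← h7 u₂ s mem_bigon, h8]
  grind

/-- The variant of `wordValue_eq_bigon_sub` for the opposite order of the passages of `v`: now the
two arcs of the quadrant are the one after the first and the one before the second passage. -/
theorem wordValue_eq_bigon_sub' (hp : IsOrientedParity p)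
    (h : K.Spells (X ++ (v, !s) :: (Y ++ (v, s) :: Z))) {u₁ w₁ u₂ w₂ : Label}
    (hf : ∀ x ∈ [u₁, w₁, u₂, w₂], Fresh x (X ++ (v, !s) :: (Y ++ (v, s) :: Z)))
    (h12 : u₁ ≠ u₂ ∧ u₁ ≠ w₂ ∧ w₁ ≠ u₂ ∧ w₁ ≠ w₂) (hs₁ : w₁.2 = - u₁.2) (hs₂ : w₂.2 = - u₂.2)
    (hu₂ : u₂.2 = sideSign s)
    (hpat : u₁.2 = - sideSign s ∨ (u₁.2 = sideSign s ∧ v.2 = sideSign s)) :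
    wordValue p (X ++ (v, !s) :: (Y ++ (v, s) :: Z)) v =
      wordValue p (bigon u₂ w₂ s (X ++ [(v, !s)]) (Y ++ (v, s) :: Z)) u₂ -
        wordValue p (bigon w₁ u₁ s (X ++ (v, !s) :: Y) ((v, s) :: Z)) w₁ := by
  simp only [List.forall_mem_cons, fresh_append, fresh_cons, ne_eq] at hf
  have hs₁' : u₁.2 = - w₁.2 := by rw [hs₁, neg_neg]
  have hb1 : K.Spells (bigon w₁ u₁ s (X ++ (v, !s) :: Y) ((v, s) :: Z)) :=
    Spells.bigon (by simpa using h) (by simp [hf]) (by simp [hf]) hs₁'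
  -- the word with both bigons
  let W : Word := (w₁, s) :: (u₁, !s) :: (u₂, s) :: (w₂, !s) :: (X ++ (v, !s) :: (u₂, !s) ::
    (w₂, s) :: (Y ++ (w₁, !s) :: (u₁, s) :: (v, s) :: Z))
  have hL : W = [(w₁, s), (u₁, !s)] ++ (u₂, s) :: (w₂, !s) :: ((X ++ [(v, !s)]) ++
    [(u₂, !s), (w₂, s)] ++ (Y ++ (w₁, !s) :: (u₁, s) :: (v, s) :: Z)) := by simp [W]
  have hL' : bigon w₁ u₁ s (X ++ (v, !s) :: Y) ((v, s) :: Z) = [(w₁, s), (u₁, !s)] ++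
    (X ++ [(v, !s)]) ++ (Y ++ (w₁, !s) :: (u₁, s) :: (v, s) :: Z) := by simp [bigon]
  have hW : K.Spells W := hb1.insert_r2 (.inl rfl) hL hL' hs₂
    (by simp [hf, bigon, h12.1.symm, h12.2.2.1.symm])
    (by simp [hf, bigon, h12.2.1.symm, h12.2.2.2.symm])
  obtain ⟨-, h2, h3⟩ := hp.r2 hW (.inl rfl) hL hL' hs₂
  obtain ⟨-, h4, h5⟩ := hp.r2_bigon hb1 hs₁'
  rw [List.append_assoc, List.cons_append] at h5
  obtain ⟨-, h6, h7⟩ := hp.r2 hW (X := []) (u := w₁) (w := u₁) (s := s)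
    (Y := (u₂, s) :: (w₂, !s) :: (X ++ (v, !s) :: (u₂, !s) :: (w₂, s) :: Y))
    (Z := (v, s) :: Z)
    (L' := bigon u₂ w₂ s (X ++ [(v, !s)]) (Y ++ (v, s) :: Z)) (.inl rfl)
    (by simp [W]) (by simp [bigon]) hs₁'
  have h8 := hp.r3 hW (u := u₁) (w := u₂) (v := v) (s := s) h12.1
    ⟨[(w₁, s)], _, rfl⟩ ⟨(w₁, s) :: (u₁, !s) :: (u₂, s) :: (w₂, !s) :: (X ++ (v, !s) :: (u₂, !s) ::
      (w₂, s) :: (Y ++ [(w₁, !s)])), Z, by simp [W]⟩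
    ⟨(w₁, s) :: (u₁, !s) :: (u₂, s) :: (w₂, !s) :: X, (w₂, s) ::
      (Y ++ (w₁, !s) :: (u₁, s) :: (v, s) :: Z), by simp [W]⟩ hu₂ hpat
  rw [← h5 v s (by simp), ← h3 v s (by simp [bigon]), ← h3 w₁ s mem_bigon, ← h7 u₂ s mem_bigon, h8]
  grind

/-- The value of a bigon does not depend on the sign of its first crossing: at a kink, whose
crossing has the value zero, `wordValue_eq_bigon_sub` compares two bigons of opposite signs. -/
theorem wordValue_bigon_sign (hp : IsOrientedParity p) (h : K.Spells (X ++ Y))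
    (hf : ∀ x ∈ [u, w, u', w'], Fresh x (X ++ Y)) (hu : u.2 = sideSign s) (hw : w.2 = - sideSign s)
    (hu' : u'.2 = - sideSign s) (hw' : w'.2 = sideSign s) :
    wordValue p (bigon u w s X Y) u = wordValue p (bigon u' w' s X Y) u' := by
  obtain ⟨N, hN⟩ := exists_bound (X ++ Y)
  simp only [List.forall_mem_cons] at hf
  obtain ⟨v, hv⟩ : ∃ v, v = ((N, sideSign s) : Label) := ⟨_, rfl⟩
  obtain ⟨u₂, hu₂⟩ : ∃ v, v = ((N + 1, sideSign s) : Label) := ⟨_, rfl⟩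
  obtain ⟨w₂, hw₂⟩ : ∃ v, v = ((N + 1, - sideSign s) : Label) := ⟨_, rfl⟩
  obtain ⟨u₁, hu₁⟩ : ∃ v, v = ((N + 2, sideSign s) : Label) := ⟨_, rfl⟩
  obtain ⟨w₁, hw₁⟩ : ∃ v, v = ((N + 2, - sideSign s) : Label) := ⟨_, rfl⟩
  have fv : Fresh v (X ++ Y) := hv ▸ hN _ _ le_rfl
  have fu₂ : Fresh u₂ (X ++ Y) := hu₂ ▸ hN _ _ (by lia)
  have fw₂ : Fresh w₂ (X ++ Y) := hw₂ ▸ hN _ _ (by lia)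
  have fu₁ : Fresh u₁ (X ++ Y) := hu₁ ▸ hN _ _ (by lia)
  have fw₁ : Fresh w₁ (X ++ Y) := hw₁ ▸ hN _ _ (by lia)
  have hne : u₁ ≠ v ∧ w₁ ≠ v ∧ u₂ ≠ v ∧ w₂ ≠ v ∧ u₁ ≠ u₂ ∧ u₁ ≠ w₂ ∧ w₁ ≠ u₂ ∧ w₁ ≠ w₂ := by
    subst hv hu₁ hw₁ hu₂ hw₂
    simp
  have hvs : v.2 = sideSign s := by rw [hv]
  have hu₁s : u₁.2 = sideSign s := by rw [hu₁]
  have hw₁s : w₁.2 = - sideSign s := by rw [hw₁]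
  have hu₂s : u₂.2 = sideSign s := by rw [hu₂]
  have hw₂s : w₂.2 = - sideSign s := by rw [hw₂]
  clear hv hu₁ hw₁ hu₂ hw₂ hN
  have hk : K.Spells (X ++ (v, s) :: ([] ++ (v, !s) :: Y)) := h.insert_r1 rfl rfl fv
  have hkey := hp.wordValue_eq_bigon_sub hk (u₁ := u₁) (w₁ := w₁) (u₂ := u₂) (w₂ := w₂)
    (by
      rw [fresh_append] at fu₁ fw₁ fu₂ fw₂
      simp [hne, fu₁, fw₁, fu₂, fw₂]) ⟨hne.2.2.2.2.1, hne.2.2.2.2.2⟩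
    (by rw [hu₁s, hw₁s]) (by rw [hu₂s, hw₂s]) hu₂s (.inr ⟨hu₁s, hvs⟩)
  rw [(hp.r1 hk rfl rfl).2.1] at hkey
  have f : ∀ x, x ≠ v → Fresh x (X ++ Y) → Fresh x (X ++ (v, s) :: ([] ++ (v, !s) :: Y)) :=
    fun x hx hX => by
      rw [fresh_append] at hX
      simp [hx, hX]
  have hb2 : K.Spells (bigon u₂ w₂ s (X ++ (v, s) :: ([] ++ [(v, !s)])) Y) :=
    Spells.bigon (by simpa using hk) (by simpa using f u₂ (by simp [hne]) fu₂)
      (by simpa using f w₂ (by simp [hne]) fw₂) (by rw [hu₂s, hw₂s])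
  have hb1 : K.Spells (bigon w₁ u₁ s X ((v, s) :: ([] ++ (v, !s) :: Y))) :=
    hk.bigon (f _ (by simp [hne]) fw₁) (f _ (by simp [hne]) fu₁) (by rw [hu₁s, hw₁s, neg_neg])
  obtain ⟨hs2, -, h2⟩ := hp.r1 hb2 (X := (u₂, s) :: (w₂, !s) :: X) (u := v) (s := s)
    (L' := bigon u₂ w₂ s X Y) (by simp [bigon]; rfl) (by simp [bigon])
  obtain ⟨hs1, -, h1⟩ := hp.r1 hb1 (X := (w₁, s) :: (u₁, !s) :: (X ++ [(w₁, !s), (u₁, s)]))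
    (u := v) (s := s) (L' := bigon w₁ u₁ s X Y) (by simp [bigon]; rfl) (by simp [bigon])
  rw [h2 u₂ s mem_bigon, h1 w₁ s mem_bigon] at hkey
  rw [hp.wordValue_bigon_relabel hs2 (by rw [hu₂s, hw₂s]) (by rw [hu, hu₂s]) (by rw [hw, hw₂s])
    hf.1 hf.2.1, hp.wordValue_bigon_relabel hs1 (by rw [hu₁s, hw₁s, neg_neg]) (by rw [hu', hw₁s])
    (by rw [hw', hu₁s]) hf.2.2.1 hf.2.2.2.1]
  exact sub_eq_zero.1 hkey.symm

theorem wordValue_bigon_true (hp : IsOrientedParity p) (h : K.Spells (bigon u w true X Y))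
    (hs : w.2 = - u.2) : wordValue p (bigon u w true X Y) u = bigonValue p X Y := by
  have hL := (hp.r2_bigon h hs).1
  obtain ⟨hu, hw⟩ := isGauss_bigon h.isGauss hs
  have hN := (exists_bound (X ++ Y)).choose_spec
  rw [bigonValue]
  generalize (exists_bound (X ++ Y)).choose = N at *
  have fu := hN N 1 le_rfl
  have fw := hN N (-1) le_rfl
  rcases Int.units_eq_one_or u.2 with hu1 | hu1 <;> rw [hu1] at hs
  · exact (hp.wordValue_bigon_relabel h (by rw [hs, hu1]) (by rw [hu1]) (by rw [hs]) fu fw).symm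
  · exact (hp.wordValue_bigon_sign hL (by simp only [List.forall_mem_cons]; simp [*]) rfl rfl hu1
      (by rw [hs]; rfl)).symm

theorem wordValue_bigon (hp : IsOrientedParity p) (h : K.Spells (bigon u w s X Y))
    (hs : w.2 = - u.2) : wordValue p (bigon u w s X Y) u = sidedBigonValue p s X Y := by
  rw [sidedBigonValue]
  cases s
  · have : bigon u w false X Y = ((u, false) :: (w, true) :: X) ++ ((u, true) :: (w, false) :: Y) :=
      rfl
    have h' : K.Spells (bigon u w true Y X) := Spells.rotate (this ▸ h)
    rw [if_neg (by simp), ← hp.wordValue_bigon_true h' hs, this,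
      hp.wordValue_rotate (this ▸ h) (c := u) (b := false) (by simp)]
    rfl
  · rw [if_pos rfl, hp.wordValue_bigon_true h hs]

/-- The value of a crossing is the difference of the values of the bigons of the closing arc with
the arcs that bound the left quadrant (if `s = true`) or the right quadrant (if `s = false`). -/
theorem wordValue_eq_sub (hp : IsOrientedParity p) (hL : L = X ++ (v, s) :: (Y ++ (v, !s) :: Z))
    (h : K.Spells L) : wordValue p L v =
      sidedBigonValue p s (X ++ (v, s) :: (Y ++ [(v, !s)])) Z -
        sidedBigonValue p s X ((v, s) :: (Y ++ (v, !s) :: Z)) := by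
  obtain ⟨N, hN⟩ := exists_bound L
  have hN0 := fun ε => hN N ε le_rfl
  have hN1 := fun ε => hN (N + 1) ε (by lia)
  subst hL
  rw [hp.wordValue_eq_bigon_sub h (u₁ := (N, - sideSign s)) (w₁ := (N, sideSign s))
    (u₂ := (N + 1, sideSign s)) (w₂ := (N + 1, - sideSign s))
    (by simp only [List.forall_mem_cons]; simp [hN0, hN1, -fresh_append]) (by simp) (by simp) rfl
    rfl (.inl rfl),
    hp.wordValue_bigon (Spells.bigon (by simpa using h) (by simpa using hN1 _)
      (by simpa using hN1 _) rfl) rfl,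
    hp.wordValue_bigon (h.bigon (hN0 _) (hN0 _) rfl) rfl]

/-- The variant of `wordValue_eq_sub` for the opposite order of the passages of `v`. -/
theorem wordValue_eq_sub' (hp : IsOrientedParity p) (hL : L = X ++ (v, !s) :: (Y ++ (v, s) :: Z))
    (h : K.Spells L) : wordValue p L v =
      sidedBigonValue p s (X ++ [(v, !s)]) (Y ++ (v, s) :: Z) -
        sidedBigonValue p s (X ++ (v, !s) :: Y) ((v, s) :: Z) := by
  obtain ⟨N, hN⟩ := exists_bound L
  have hN0 := fun ε => hN N ε le_rfl
  have hN1 := fun ε => hN (N + 1) ε (by lia)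
  subst hL
  rw [hp.wordValue_eq_bigon_sub' h (u₁ := (N, - sideSign s)) (w₁ := (N, sideSign s))
    (u₂ := (N + 1, sideSign s)) (w₂ := (N + 1, - sideSign s))
    (by simp only [List.forall_mem_cons]; simp [hN0, hN1, -fresh_append]) (by simp) (by simp) rfl
    rfl (.inl rfl),
    hp.wordValue_bigon (Spells.bigon (by simpa using h) (by simpa using hN1 _)
      (by simpa using hN1 _) rfl) rfl,
    hp.wordValue_bigon (Spells.bigon (by simpa using h) (by simpa using hN0 _)
      (by simpa using hN0 _) rfl) rfl]

end IsOrientedParity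

end bigon

end VirtualKnot

/-! ### Relations between the values of bigons -/

namespace VirtualKnot

open GaussDiagram

variable {K : VirtualKnot} {A : Type*} [AddCommGroup A] {p : K.CrossingFamily A}

namespace IsOrientedParity

variable {X Y Z X' Y' β : Word} {v : Label}

/-- The value of a bigon is not changed by a second Reidemeister move elsewhere. -/
theorem bigonValue_r2 (hp : IsOrientedParity p) (h : K.Spells (X ++ Y))
    {F G H : Label → Label → Word} {c d : Label} {s : Bool}
    (hβ : β = [(c, !s), (d, s)] ∨ β = [(d, s), (c, !s)]) (hs : d.2 = - c.2)
    (h1 : ∀ u w, bigon u w true X Y = F u w ++ (c, s) :: (d, !s) :: (G u w ++ β ++ H u w))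
    (h2 : ∀ u w, bigon u w true X' Y' = F u w ++ G u w ++ H u w) :
    bigonValue p X Y = bigonValue p X' Y' := by
  obtain ⟨N, hN⟩ := exists_bound (X ++ Y)
  have hb : K.Spells (bigon (N, 1) (N, -1) true X Y) :=
    h.bigon (hN _ _ le_rfl) (hN _ _ le_rfl) rfl
  obtain ⟨hb', -, h3⟩ := hp.r2 hb hβ (h1 _ _) (h2 _ _) hs
  rw [← hp.wordValue_bigon_true hb rfl, ← hp.wordValue_bigon_true hb' rfl]
  exact h3 _ true mem_bigon

/-- Two fresh labels of opposite signs. -/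
theorem _root_.GaussDiagram.exists_fresh (L : Word) : ∃ c d : Label, d.2 = - c.2 ∧
    Fresh c L ∧ Fresh d L := by
  obtain ⟨N, hN⟩ := exists_bound L
  exact ⟨(N, 1), (N, -1), rfl, hN _ _ le_rfl, hN _ _ le_rfl⟩

/-- The first crossing of a bigon whose second strand runs through it in the opposite direction: the
arcs at its left quadrant are those that the bigon connects. -/
theorem wordValue_antiparallel (hp : IsOrientedParity p) {c d : Label} (hs : d.2 = - c.2)
    (h : K.Spells ((c, true) :: (d, false) :: (Y ++ (d, true) :: (c, false) :: Z))) :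
    wordValue p ((c, true) :: (d, false) :: (Y ++ (d, true) :: (c, false) :: Z)) c =
      bigonValue p Y Z - bigonValue p [] (Y ++ Z) := by
  rw [hp.wordValue_eq_sub (X := []) (Y := (d, false) :: (Y ++ [(d, true)])) (Z := Z) (s := true)
    (by simp) h, sidedBigonValue, sidedBigonValue, if_pos rfl, if_pos rfl]
  congr 1
  · exact hp.bigonValue_r2 (by simpa using h) (s := true) (F := fun u w => [(u, true), (w, false)])
      (G := fun _ _ => Y) (H := fun u w => (u, false) :: (w, true) :: Z) (.inr rfl) hs
      (by simp [bigon]) (by simp [bigon])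
  · exact hp.bigonValue_r2 (by simpa using h) (s := true) (F := fun u w =>
      [(u, true), (w, false), (u, false), (w, true)]) (G := fun _ _ => Y) (H := fun _ _ => Z)
      (.inr rfl) hs (by simp [bigon]) (by simp [bigon])

/-- The relation between the bigons that connect the three arcs between `X`, `Y` and `Z`. It
computes in two ways the value of a crossing of an antiparallel bigon between the arcs at the ends
of `Y`: with bigons of the arc between `Z` and `X`, and with bigons of the arc between `X` and `Y`.
-/
theorem bigonValue_add_sub (hp : IsOrientedParity p) (h : K.Spells (X ++ (Y ++ Z))) :
    bigonValue p X (Y ++ Z) + bigonValue p Y (Z ++ X) - bigonValue p (X ++ Y) Z =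
      bigonValue p [] (Y ++ (Z ++ X)) := by
  obtain ⟨c, d, hs, hc, hd⟩ := exists_fresh (X ++ (Y ++ Z))
  have hL : K.Spells (X ++ (c, true) :: (d, false) :: (Y ++ (d, true) :: (c, false) :: Z)) :=
    h.insert_r2 (s := true) (X := X) (Y := Y) (Z := Z) (.inr rfl) (by simp) (by simp) hs hc hd
  have h2 := hp.wordValue_antiparallel (Y := Y) (Z := Z ++ X) hs (by simpa using hL.rotate)
  rw [show (c, true) :: (d, false) :: (Y ++ (d, true) :: (c, false) :: (Z ++ X)) =
    ((c, true) :: (d, false) :: (Y ++ (d, true) :: (c, false) :: Z)) ++ X by simp,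
    ← hp.wordValue_rotate hL (b := true) (by simp)] at h2
  have k1 : bigonValue p (X ++ (c, true) :: (d, false) :: (Y ++ [(d, true), (c, false)])) Z =
      bigonValue p (X ++ Y) Z :=
    hp.bigonValue_r2 (by simpa using hL) (s := true) (F := fun u w => (u, true) :: (w, false) :: X)
      (G := fun _ _ => Y) (H := fun u w => (u, false) :: (w, true) :: Z)
      (.inr rfl) hs (by simp [bigon]) (by simp [bigon])
  have k2 : bigonValue p X ((c, true) :: (d, false) :: (Y ++ (d, true) :: (c, false) :: Z)) =
      bigonValue p X (Y ++ Z) :=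
    hp.bigonValue_r2 (by simpa using hL) (s := true) (F := fun u w =>
      (u, true) :: (w, false) :: (X ++ [(u, false), (w, true)])) (G := fun _ _ => Y)
      (H := fun _ _ => Z) (.inr rfl) hs (by simp [bigon]) (by simp [bigon])
  have h1 := hp.wordValue_eq_sub (X := X) (Y := (d, false) :: (Y ++ [(d, true)])) (Z := Z)
    (s := true) (v := c) (by simp) hL
  rw [sidedBigonValue, sidedBigonValue, if_pos rfl, if_pos rfl] at h1
  simp only [List.append_assoc, List.cons_append, List.nil_append, Bool.not_true] at h1
  rw [k1, k2] at h1
  grind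

/-- The variant of `bigonValue_add_sub` for the other crossing of the antiparallel bigon. -/
theorem bigonValue_add_sub' (hp : IsOrientedParity p) (h : K.Spells (X ++ (Y ++ Z))) :
    bigonValue p (X ++ Y) Z + bigonValue p (Z ++ X) Y - bigonValue p X (Y ++ Z) =
      bigonValue p [] (Z ++ (X ++ Y)) := by
  obtain ⟨c, d, hs, hc, hd⟩ := exists_fresh (X ++ (Y ++ Z))
  have hL : K.Spells ((X ++ (d, true) :: (c, false) :: Y) ++ (c, true) :: (d, false) :: Z) :=
    h.insert_r2 (s := true) (X := X) (Y := Y) (Z := Z) (.inr rfl) (by simp)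
      (by simp) (by rw [hs, neg_neg]) hd hc
  have h2 := hp.wordValue_antiparallel (Y := Z ++ X) (Z := Y) hs (by simpa using hL.rotate)
  rw [show (c, true) :: (d, false) :: (Z ++ X ++ (d, true) :: (c, false) :: Y) =
    ((c, true) :: (d, false) :: Z) ++ (X ++ (d, true) :: (c, false) :: Y) by simp,
    ← hp.wordValue_rotate hL (b := true) (by simp)] at h2
  have hs' : c.2 = - d.2 := by rw [hs, neg_neg]
  have k1 : bigonValue p (X ++ [(d, true), (c, false)]) (Y ++ (c, true) :: (d, false) :: Z) =
      bigonValue p X (Y ++ Z) :=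
    hp.bigonValue_r2 (by simpa using hL) (s := true) (F := fun u w => (u, true) :: (w, false) :: X)
      (G := fun u w => (u, false) :: (w, true) :: Y) (H := fun u w => Z)
      (.inr rfl) hs' (by simp [bigon]) (by simp [bigon])
  have k2 : bigonValue p (X ++ (d, true) :: (c, false) :: Y) ((c, true) :: (d, false) :: Z) =
      bigonValue p (X ++ Y) Z :=
    hp.bigonValue_r2 (by simpa using hL) (s := true) (F := fun u w => (u, true) :: (w, false) :: X)
      (G := fun u w => Y ++ [(u, false), (w, true)]) (H := fun u w => Z)
      (.inr rfl) hs' (by simp [bigon]) (by simp [bigon])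
  have h1 := hp.wordValue_eq_sub' (X := X ++ [(d, true)]) (Y := Y) (Z := (d, false) :: Z)
    (s := true) (v := c) (by simp) hL
  rw [sidedBigonValue, sidedBigonValue, if_pos rfl, if_pos rfl] at h1
  simp only [List.append_assoc, List.cons_append, List.nil_append, Bool.not_true] at h1 h2
  rw [k1, k2] at h1
  grind

/-- The value of a bigon of the closing arc with itself does not depend on the order of its
strands. -/
theorem bigonValue_nil_right (hp : IsOrientedParity p) (h : K.Spells Y) :
    bigonValue p Y [] = bigonValue p [] Y := by
  obtain ⟨c, d, hs, hc, hd⟩ := exists_fresh Y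
  have hL : K.Spells ([(c, true), (d, false)] ++ (Y ++ [(d, true), (c, false)])) :=
    h.insert_r2 (s := true) (X := []) (Y := Y) (Z := []) (.inr rfl) (by simp) (by simp) hs hc hd
  have h1 := hp.wordValue_antiparallel (Y := Y) (Z := []) hs hL
  have h2 := hp.wordValue_rotate hL (c := c) (b := true) (by simp)
  rw [hp.wordValue_eq_sub' (L := (Y ++ [(d, true), (c, false)]) ++ [(c, true), (d, false)])
    (X := Y ++ [(d, true)]) (Y := []) (Z := [(d, false)]) (s := true) (by simp) hL.rotate,
    List.nil_append, sub_self] at h2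
  rw [List.append_nil] at h1
  exact sub_eq_zero.1 (h1.symm.trans h2)

theorem bigonValue_add_swap (hp : IsOrientedParity p) (h : K.Spells (X ++ Y)) :
    bigonValue p X Y + bigonValue p Y X =
      bigonValue p [] (X ++ Y) + bigonValue p [] (Y ++ X) := by
  have := hp.bigonValue_add_sub (X := X) (Y := Y) (Z := []) (by simpa using h)
  rw [hp.bigonValue_nil_right h, List.append_nil, List.nil_append] at this
  grind

/-- The value of a crossing `v` is the value of a bigon between the arc before its first and the arc
before its second passage: a crossing of this bigon forms a second bigon with `v`, and so their
values add up to zero. -/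
theorem wordValue_eq_bigonValue (hp : IsOrientedParity p)
    (h : K.Spells ((v, true) :: (Y ++ (v, false) :: Z))) :
    wordValue p ((v, true) :: (Y ++ (v, false) :: Z)) v =
      bigonValue p ((v, true) :: Y) ((v, false) :: Z) := by
  obtain ⟨N, hN⟩ := exists_bound ((v, true) :: (Y ++ (v, false) :: Z))
  obtain ⟨u, hu, hus⟩ : ∃ u, Fresh u ((v, true) :: (Y ++ (v, false) :: Z)) ∧ u.2 = v.2 :=
    ⟨(N, v.2), hN _ _ le_rfl, rfl⟩
  obtain ⟨w, hw, hws⟩ : ∃ u, Fresh u ((v, true) :: (Y ++ (v, false) :: Z)) ∧ u.2 = - v.2 :=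
    ⟨(N, - v.2), hN _ _ le_rfl, rfl⟩
  have hb : K.Spells (bigon u w true ((v, true) :: Y) ((v, false) :: Z)) :=
    Spells.bigon (by simpa using h) (by simpa using hu) (by simpa using hw) (by rw [hus, hws])
  obtain ⟨-, h1, h2⟩ := hp.r2_bigon hb (by rw [hus, hws])
  obtain ⟨-, h3, -⟩ := hp.r2 hb (X := [(u, true)]) (u := w) (w := v) (s := false)
    (Y := Y ++ [(u, false)]) (Z := Z) (.inl rfl) (by simp [bigon]) rfl (by rw [hws, neg_neg])
  have h4 := h2 v true (by simp)
  rw [List.cons_append] at h4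
  rw [← h4, ← hp.wordValue_bigon_true hb (by rw [hus, hws])]
  grind

/-- The variant of `wordValue_eq_bigonValue` with the arcs after the passages of `v`. -/
theorem wordValue_eq_neg_bigonValue (hp : IsOrientedParity p)
    (h : K.Spells (Z ++ (v, true) :: (Y ++ [(v, false)]))) :
    wordValue p (Z ++ (v, true) :: (Y ++ [(v, false)])) v =
      - bigonValue p (Z ++ [(v, true)]) (Y ++ [(v, false)]) := by
  obtain ⟨N, hN⟩ := exists_bound (Z ++ (v, true) :: (Y ++ [(v, false)]))
  obtain ⟨u, hu, hus⟩ : ∃ u, Fresh u (Z ++ (v, true) :: (Y ++ [(v, false)])) ∧ u.2 = - v.2 :=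
    ⟨(N, - v.2), hN _ _ le_rfl, rfl⟩
  obtain ⟨w, hw, hws⟩ : ∃ u, Fresh u (Z ++ (v, true) :: (Y ++ [(v, false)])) ∧ u.2 = v.2 :=
    ⟨(N, v.2), hN _ _ le_rfl, rfl⟩
  have hs : w.2 = - u.2 := by rw [hus, hws, neg_neg]
  have hb : K.Spells (bigon u w true (Z ++ [(v, true)]) (Y ++ [(v, false)])) :=
    Spells.bigon (by simpa using h) (by simpa using hu) (by simpa using hw) hs
  have hrot : bigon u w true (Z ++ [(v, true)]) (Y ++ [(v, false)]) =
      ((u, true) :: (w, false) :: (Z ++ (v, true) :: (u, false) :: (w, true) :: Y)) ++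
        [(v, false)] := by simp [bigon]
  obtain ⟨-, h1, h2⟩ := hp.r2_bigon hb hs
  obtain ⟨-, h3, -⟩ := hp.r2 (hrot ▸ hb).rotate (X := []) (u := v) (w := u) (s := false)
    (Y := (w, false) :: Z) (Z := (w, true) :: Y) (.inl rfl) (by simp) rfl hus
  rw [← hp.wordValue_rotate (hrot ▸ hb) (c := v) (b := true) (by simp),
    ← hp.wordValue_rotate (hrot ▸ hb) (c := u) (b := true) (by simp), ← hrot] at h3
  have h4 := h2 v true (by simp)
  rw [List.append_assoc, List.singleton_append] at h4
  rw [← h4, ← hp.wordValue_bigon_true hb hs]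
  grind

/-! ### The parity cycle at a crossing -/

/-- The value of the crossing `v` and the values of the bigons of its lower left and its upper left
arc with themselves are differences of the values of the bigons between the closing arc and the
four arcs at `v`; the fourth relation is the condition for a cycle at `v`. -/
theorem bigonValue_crossing (hp : IsOrientedParity p)
    (h : K.Spells (X ++ (v, true) :: (Y ++ (v, false) :: Z))) :
    wordValue p (X ++ (v, true) :: (Y ++ (v, false) :: Z)) v =
        bigonValue p (X ++ (v, true) :: (Y ++ [(v, false)])) Z -
          bigonValue p X ((v, true) :: (Y ++ (v, false) :: Z)) ∧
      bigonValue p [] ((v, true) :: (Y ++ (v, false) :: (Z ++ X))) =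
        bigonValue p (X ++ (v, true) :: (Y ++ [(v, false)])) Z -
          bigonValue p (X ++ (v, true) :: Y) ((v, false) :: Z) ∧
      bigonValue p [] (Z ++ (X ++ (v, true) :: (Y ++ [(v, false)]))) =
        bigonValue p X ((v, true) :: (Y ++ (v, false) :: Z)) -
          bigonValue p (X ++ [(v, true)]) (Y ++ (v, false) :: Z) ∧
      bigonValue p [] (Y ++ (v, false) :: (Z ++ (X ++ [(v, true)]))) +
        bigonValue p [] (Z ++ (X ++ (v, true) :: (Y ++ [(v, false)]))) =
      bigonValue p [] ((v, true) :: (Y ++ (v, false) :: (Z ++ X))) +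
        bigonValue p [] ((v, false) :: (Z ++ (X ++ (v, true) :: Y))) := by
  have ha : K.Spells ((v, true) :: (Y ++ (v, false) :: (Z ++ X))) := by simpa using h.rotate
  have hd : K.Spells (Z ++ (X ++ (v, true) :: (Y ++ [(v, false)]))) :=
    Spells.rotate (A := X ++ (v, true) :: (Y ++ [(v, false)])) (by simpa using h)
  have e1 := hp.wordValue_eq_sub rfl h
  have e2 := hp.wordValue_eq_sub' (s := false) rfl h
  rw [sidedBigonValue, sidedBigonValue, if_pos rfl, if_pos rfl] at e1
  rw [sidedBigonValue, sidedBigonValue, if_neg (by simp), if_neg (by simp)] at e2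
  have e3 := hp.wordValue_eq_bigonValue ha
  have e4 := hp.wordValue_eq_neg_bigonValue (Z := Z ++ X) (by simpa using hd)
  have r3 := hp.wordValue_rotate h (c := v) (b := true) (by simp)
  have r4 := hp.wordValue_rotate (L₁ := X ++ (v, true) :: (Y ++ [(v, false)])) (L₂ := Z)
    (by simpa using h) (c := v) (b := true) (by simp)
  have b1 := hp.bigonValue_add_sub (X := X) (Y := (v, true) :: Y) (Z := (v, false) :: Z)
    (by simpa using h)
  have b2 := hp.bigonValue_add_sub' (X := X ++ [(v, true)]) (Y := Y ++ [(v, false)]) (Z := Z)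
    (by simpa using h)
  have c1 := hp.bigonValue_add_swap (X := X ++ [(v, true)]) (Y := Y ++ (v, false) :: Z)
    (by simpa using h)
  have c2 := hp.bigonValue_add_swap (X := X ++ (v, true) :: Y) (Y := (v, false) :: Z)
    (by simpa using h)
  simp only [List.append_assoc, List.cons_append, List.nil_append, Bool.not_true,
    Bool.not_false] at *
  clear h ha hd
  grind

/-- The variant of `bigonValue_crossing` for the opposite order of the passages of `v`. -/
theorem bigonValue_crossing' (hp : IsOrientedParity p)
    (h : K.Spells (X ++ (v, false) :: (Y ++ (v, true) :: Z))) :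
    wordValue p (X ++ (v, false) :: (Y ++ (v, true) :: Z)) v =
        bigonValue p (X ++ [(v, false)]) (Y ++ (v, true) :: Z) -
          bigonValue p (X ++ (v, false) :: Y) ((v, true) :: Z) ∧
      bigonValue p [] ((v, true) :: (Z ++ (X ++ (v, false) :: Y))) =
        bigonValue p (X ++ [(v, false)]) (Y ++ (v, true) :: Z) -
          bigonValue p X ((v, false) :: (Y ++ (v, true) :: Z)) ∧
      bigonValue p [] (Y ++ (v, true) :: (Z ++ (X ++ [(v, false)]))) =
        bigonValue p (X ++ (v, false) :: Y) ((v, true) :: Z) -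
          bigonValue p (X ++ (v, false) :: (Y ++ [(v, true)])) Z ∧
      bigonValue p [] (Z ++ (X ++ (v, false) :: (Y ++ [(v, true)]))) +
        bigonValue p [] (Y ++ (v, true) :: (Z ++ (X ++ [(v, false)]))) =
      bigonValue p [] ((v, true) :: (Z ++ (X ++ (v, false) :: Y))) +
        bigonValue p [] ((v, false) :: (Y ++ (v, true) :: (Z ++ X))) := by
  have ha : K.Spells ((v, true) :: (Z ++ (X ++ (v, false) :: Y))) := by
    simpa using Spells.rotate (A := X ++ (v, false) :: Y) (B := (v, true) :: Z) (by simpa using h)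
  have hd : K.Spells (Y ++ (v, true) :: (Z ++ (X ++ [(v, false)]))) := by
    simpa using Spells.rotate (A := X ++ [(v, false)]) (B := Y ++ (v, true) :: Z)
      (by simpa using h)
  have e1 := hp.wordValue_eq_sub' (s := true) rfl h
  have e2 := hp.wordValue_eq_sub (s := false) rfl h
  rw [sidedBigonValue, sidedBigonValue, if_pos rfl, if_pos rfl] at e1
  rw [sidedBigonValue, sidedBigonValue, if_neg (by simp), if_neg (by simp)] at e2
  have e3 := hp.wordValue_eq_bigonValue (Y := Z ++ X) (Z := Y) (by simpa using ha)
  have e4 := hp.wordValue_eq_neg_bigonValue (Z := Y) (Y := Z ++ X) (by simpa using hd)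
  have r3 := hp.wordValue_rotate (L₁ := X ++ (v, false) :: Y) (L₂ := (v, true) :: Z)
    (by simpa using h) (c := v) (b := true) (by simp)
  have r4 := hp.wordValue_rotate (L₁ := X ++ [(v, false)]) (L₂ := Y ++ (v, true) :: Z)
    (by simpa using h) (c := v) (b := true) (by simp)
  have b1 := hp.bigonValue_add_sub' (X := X) (Y := (v, false) :: Y) (Z := (v, true) :: Z)
    (by simpa using h)
  have b2 := hp.bigonValue_add_sub (X := X ++ [(v, false)]) (Y := Y ++ [(v, true)]) (Z := Z)
    (by simpa using h)
  have c1 := hp.bigonValue_add_swap (X := X ++ (v, false) :: (Y ++ [(v, true)])) (Y := Z)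
    (by simpa using h)
  have c2 := hp.bigonValue_add_swap (X := X) (Y := (v, false) :: (Y ++ (v, true) :: Z))
    (by simpa using h)
  simp only [List.append_assoc, List.cons_append, List.nil_append, Bool.not_true,
    Bool.not_false] at *
  clear h ha hd
  grind

end IsOrientedParity

end VirtualKnot

/-! ### Spellings and arcs -/

namespace List

variable {α : Type*} [DecidableEq α]

/-- A list without repetitions is determined by its cyclic permutation and its last element. -/
theorem eq_of_formPerm_eq {l l' : List α} (hl : l.Nodup) (hl' : l'.Nodup)
    (h : l.formPerm = l'.formPerm) (hlast : l.getLast? = l'.getLast?) : l = l' := by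
  rcases (formPerm_eq_formPerm_iff hl hl').1 h with hr | ⟨h1, h2⟩
  · obtain ⟨n, hn, rfl⟩ := isRotated_iff_mod.1 hr
    rw [rotate_eq_drop_append_take hn] at hlast ⊢
    rcases eq_nil_or_concat' (l.drop n) with hd | ⟨B, x, hd⟩
    · have := take_append_drop n l
      rw [hd, append_nil] at this
      rw [hd, this, nil_append]
    rcases eq_nil_or_concat' (l.take n) with ht | ⟨C, y, ht⟩
    · have := take_append_drop n l
      rw [ht, nil_append] at this
      rw [ht, this, append_nil]
    · have := take_append_drop n l
      rw [hd, ht] at this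
      rw [← this] at hl
      rw [← append_assoc] at hl
      rw [hd, ht, ← this, ← append_assoc, ← append_assoc, getLast?_concat, getLast?_concat] at hlast
      obtain rfl := Option.some.inj hlast
      simp [nodup_append] at hl
  · match l, l', h1, h2 with
    | [], [], _, _ => rfl
    | [x], [y], _, _ => simpa using hlast
    | [], [y], _, _ => simp at hlast
    | [x], [], _, _ => simp at hlast

end List

namespace GaussDiagram

variable {D D' D₁ : GaussDiagram} {L L' W : Word}

theorem Arc.start_injective {a b : D.Arc} (h : a.start = b.start) : a = b := by
  cases a <;> cases b <;> simp_all [Arc.start]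

theorem letter_pt (lab : D.V → Label) (v : D.V) (b : Bool) :
    D.letter lab (D.pt v b) = (lab v, b) := by
  simp [letter]

namespace Spelling

theorem list_eq_of_getLast? (s : Spelling D L) (s' : Spelling D L')
    (h : s.list.getLast? = s'.list.getLast?) : s.list = s'.list :=
  List.eq_of_formPerm_eq s.nodup s'.nodup (s.next_eq.symm.trans s'.next_eq) h

theorem list_eq_of_lab (s : Spelling D L) (s' : Spelling D L') (hL : L = L')
    (h : ∀ v, s.lab v = s'.lab v) : s.list = s'.list := by
  subst hL
  obtain rfl' : s.lab = s'.lab := funext h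
  refine List.map_injective_iff.2 (letter_injective s'.lab_inj) ?_
  rw [s'.map_eq, ← rfl', s.map_eq]

theorem next_eq_of_list (s : Spelling D L) {A B : List D.Endpoint} {e f : D.Endpoint}
    (h : s.list = A ++ e :: f :: B) : D.next e = f := by
  have hn := s.nodup
  rw [h] at hn
  rw [s.next_eq, h]
  exact List.formPerm_append_apply hn

/-- An end of a chord is followed by the next one in the list unless it is the last one. -/
theorem exists_eq_cons (s : Spelling D L) {A B : List D.Endpoint} {e : D.Endpoint}
    (h : s.list = A ++ e :: B) (he : s.list.getLast? ≠ some e) : ∃ B', B = D.next e :: B' := by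
  obtain _ | ⟨f, B⟩ := B
  · rw [h, List.getLast?_concat] at he
    exact absurd rfl he
  · exact ⟨B, by rw [s.next_eq_of_list h]⟩

/-- The last end is followed by the first one. -/
theorem getLast?_of_cons (s : Spelling D L) {A : List D.Endpoint} {e : D.Endpoint}
    (h : s.list = e :: A) : s.list.getLast? = some (D.next.symm e) := by
  have h2 := List.formPerm_apply_getLast e A
  have h3 : D.next = (e :: A).formPerm := s.next_eq.trans (congrArg _ h)
  rw [← h3] at h2
  rw [h, List.getLast?_eq_some_getLast (List.cons_ne_nil e A), (Equiv.symm_apply_eq _).2 h2.symm]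

theorem exists_cons_of_getLast? (s : Spelling D L) {e : D.Endpoint}
    (h : s.list.getLast? = some (D.next.symm e)) : ∃ A, s.list = e :: A := by
  rcases hl : s.list with _ | ⟨f, A⟩
  · rw [hl] at h
    cases h
  · rw [s.getLast?_of_cons hl, Option.some.injEq, EmbeddingLike.apply_eq_iff_eq] at h
    exact ⟨A, by rw [h]⟩

/-- The spelling that starts at another passage. -/
theorem exists_rotate (s : Spelling D L) {A B : List D.Endpoint} (h : s.list = A ++ B) :
    ∃ s' : Spelling D ((B ++ A).map (D.letter s.lab)), s'.list = B ++ A := by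
  have hr : A ++ B ~r B ++ A := List.isRotated_append
  have hn := s.nodup
  have hc := s.complete
  rw [h] at hn hc
  exact ⟨⟨s.lab, s.lab_inj, s.sign_lab, B ++ A, hr.nodup_iff.1 hn, fun e => hr.mem_iff.1 (hc e),
    by rw [s.next_eq, h, List.formPerm_eq_of_isRotated hn hr], rfl⟩, rfl⟩

/-- If `D₁` is spelled by a word that ends with a spelling of `D`, then the passages of `D` follow
each other in `D₁` as they do in `D`, except at the closing arc. -/
theorem exists_lift (s : Spelling D L) (s₁ : Spelling D₁ (W ++ L)) :
    ∃ ι : D.V → D₁.V, Function.Injective ι ∧ (∀ v, s₁.lab (ι v) = s.lab v) ∧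
      (∀ v, D₁.sign (ι v) = D.sign v) ∧
      ∀ e, s.list.getLast? ≠ some e → D₁.next (Prod.map ι id e) = Prod.map ι id (D.next e) := by
  have h : ∀ v, ∃ v₁, s₁.lab v₁ = s.lab v := fun v =>
    s₁.exists_lab_eq (List.mem_append_right W (s.mem (v, true)))
  choose ι hι using h
  have hsign : ∀ v, D₁.sign (ι v) = D.sign v := fun v => by
    rw [← s₁.sign_lab, hι, s.sign_lab]
  have hpt : ∀ v b, D₁.pt (ι v) b = Prod.map ι id (D.pt v b) := fun v b => by
    simp [pt, hsign]
  refine ⟨ι, fun v w h => s.lab_inj (by rw [← hι, ← hι, h]), hι, hsign, fun e he => ?_⟩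
  obtain ⟨A, B, hl⟩ := List.append_of_mem (s.complete e)
  obtain ⟨B, rfl⟩ := s.exists_eq_cons hl he
  have hL := s.map_eq.symm
  rw [hl, List.map_append, List.map_cons, List.map_cons] at hL
  have h1 := s₁.next_of_append (A := W ++ A.map (D.letter s.lab)) (B := B.map (D.letter s.lab))
    (v := ι e.1) (w := ι (D.next e).1) (b := D.side e) (b' := D.side (D.next e))
    (by rw [hι, hι, List.append_assoc]; exact congrArg (W ++ ·) hL)
  rwa [hpt, hpt, pt_side, pt_side] at h1

end Spelling

theorem Iso.exists_spelling (i : Iso D D') (s : Spelling D L) :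
    ∃ s' : Spelling D' L, s'.list = s.list.map (Prod.map i.equiv id) := by
  have hinj : Function.Injective (Prod.map i.equiv (id : Bool → Bool)) :=
    i.equiv.injective.prodMap Function.injective_id
  have hsurj : Function.Surjective (Prod.map i.equiv (id : Bool → Bool)) :=
    i.equiv.surjective.prodMap Function.surjective_id
  refine ⟨⟨fun v => s.lab (i.equiv.symm v), s.lab_inj.comp i.equiv.symm.injective, fun v => ?_,
    s.list.map (Prod.map i.equiv id), s.nodup.map hinj, fun e => ?_, ?_, ?_⟩, rfl⟩
  · rw [s.sign_lab, ← i.sign_eq, Equiv.apply_symm_apply]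
  · obtain ⟨e, rfl⟩ := hsurj e
    exact List.mem_map_of_mem (s.complete e)
  · ext1 e
    obtain ⟨e, rfl⟩ := hsurj e
    rw [i.next_eq, s.next_eq, List.formPerm_map_apply hinj s.nodup (s.complete e)]
  · rw [List.map_map]
    refine Eq.trans (List.map_congr_left fun e _ => ?_) s.map_eq
    simp [letter, side, i.sign_eq]

/-- The permutation of the letters that belongs to a third Reidemeister move, see `R3.flip`. -/
def R3.letterFlip (r : R3 D D') (lab : D.V → Label) : Equiv.Perm (Label × Bool) :=
  Equiv.swap (D.letter lab (r.a, true)) (D.letter lab (r.b, true)) *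
    Equiv.swap (D.letter lab (r.a, false)) (D.letter lab (r.c, true)) *
    Equiv.swap (D.letter lab (r.b, false)) (D.letter lab (r.c, false))

theorem R3.letter_flip (r : R3 D D') {lab : D.V → Label} (h : Function.Injective lab)
    (e : D.Endpoint) : D.letter lab (r.flip e) = r.letterFlip lab (D.letter lab e) := by
  have hi := letter_injective (D := D) h
  rw [R3.flip, R3.letterFlip]
  simp only [Equiv.Perm.mul_apply, hi.map_swap]

theorem R3.exists_spelling (r : R3 D D') (s : Spelling D L) :
    ∃ s' : Spelling D' (L.map (r.letterFlip s.lab)),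
      s'.list = s.list.map (fun e => r.map (r.flip e)) ∧ ∀ v, s.lab v = s'.lab (r.equiv v) := by
  have hinj : Function.Injective fun e => r.map (r.flip e) :=
    (r.equiv.injective.prodMap Function.injective_id).comp r.flip.injective
  have hsurj : Function.Surjective fun e => r.map (r.flip e) :=
    (r.equiv.surjective.prodMap Function.surjective_id).comp r.flip.surjective
  refine ⟨⟨fun v => s.lab (r.equiv.symm v), s.lab_inj.comp r.equiv.symm.injective, fun v => ?_,
    s.list.map fun e => r.map (r.flip e), s.nodup.map hinj, fun e => ?_, ?_, ?_⟩, rfl,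
    fun v => by simp⟩
  · rw [s.sign_lab, ← r.sign_eq, Equiv.apply_symm_apply]
  · obtain ⟨e, rfl⟩ := hsurj e
    exact List.mem_map_of_mem (s.complete e)
  · ext1 e
    obtain ⟨e, rfl⟩ := hsurj e
    rw [List.formPerm_map_apply hinj s.nodup (s.complete e), ← s.next_eq]
    exact r.next_eq e
  · refine Eq.trans ?_ (congrArg (List.map (r.letterFlip s.lab)) s.map_eq)
    rw [List.map_map, List.map_map]
    refine List.map_congr_left fun e _ => ?_
    rw [Function.comp_apply, Function.comp_apply, ← r.letter_flip s.lab_inj]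
    simp [letter, side, r.sign_eq, R3.map]

variable {S : Set D.V}

theorem Deletion.covers_unique (d : Deletion D D' S) {f : D.Endpoint} {e e' : D'.Endpoint}
    (h : d.Covers f (.edge e)) (h' : d.Covers f (.edge e')) : e = e' := by
  have key : ∀ (e e' : D'.Endpoint) (k n : ℕ), (D.next ^ (k + n)) (Prod.map d.emb id e) = f →
      (∀ j, 0 < j → j ≤ k + n → ((D.next ^ j) (Prod.map d.emb id e)).1 ∈ S) →
      (D.next ^ k) (Prod.map d.emb id e') = f → e = e' := by
    intro e e' k n h1 h2 h3
    rw [pow_add, Equiv.Perm.mul_apply, ← h3] at h1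
    have h4 := (D.next ^ k).injective h1
    obtain _ | n := n
    · exact d.emb.injective.prodMap Function.injective_id h4
    · refine absurd (h2 (n + 1) n.succ_pos (by lia)) ?_
      rw [h4]
      exact d.emb_notMem e'.1
  obtain ⟨k, h1, h2⟩ := h
  obtain ⟨k', h1', h2'⟩ := h'
  rcases le_total k k' with hk | hk
  · obtain ⟨n, rfl⟩ := Nat.exists_eq_add_of_le hk
    exact (key e' e k n h1' h2' h1).symm
  · obtain ⟨n, rfl⟩ := Nat.exists_eq_add_of_le hk
    exact key e e' k' n h1 h2 h1'

/-- A spelling of the result of a deletion. If it is made from a spelling with the closing arc `f`,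
then its closing arc is the one that contains `f`. -/
theorem Deletion.exists_spelling (d : Deletion D D' S) (s : Spelling D L) {T : List Label}
    (hS : ∀ v, v ∈ S ↔ s.lab v ∈ T) :
    ∃ s' : Spelling D' (L.filter fun x => x.1 ∉ T), (∀ v, s'.lab v = s.lab (d.emb v)) ∧
      ∀ f a', s.list.getLast? = some f → d.Covers f a' → s'.list.getLast? = a'.start := by
  classical
  have hinj : Function.Injective (Prod.map d.emb (id : Bool → Bool)) :=
    d.emb.injective.prodMap Function.injective_id
  have hT : ∀ e : D.Endpoint, decide (s.lab e.1 ∉ T) = decide (e.1 ∉ S) := fun e => by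
    simp [hS]
  obtain ⟨l', hl'⟩ : ∃ l' : List D'.Endpoint, l'.map (Prod.map d.emb id) =
      s.list.filter fun e => e.1 ∉ S := by
    have : (s.list.filter fun e => e.1 ∉ S) ∈ Set.range (List.map (Prod.map d.emb id)) := by
      rw [Set.range_list_map]
      intro e he
      have he' := List.of_mem_filter he
      exact d.exists_emb_eq (by simpa using he')
    exact this
  have hn : l'.Nodup := List.Nodup.of_map _ (hl' ▸ s.nodup.filter _)
  have hc : ∀ e, e ∈ l' := fun e => by
    have : Prod.map d.emb id e ∈ l'.map (Prod.map d.emb id) := by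
      rw [hl', List.mem_filter]
      exact ⟨s.complete _, by simpa using d.emb_notMem e.1⟩
    rwa [List.mem_map_of_injective hinj] at this
  have hnext : D'.next = l'.formPerm := by
    ext1 e
    obtain ⟨k, hk, hj⟩ := List.exists_pow_formPerm_filter s.nodup hl' (hc e)
    obtain ⟨k', hk', hj'⟩ := d.next_eq e
    rw [← s.next_eq] at hk hj
    have hkk : k = k' := Equiv.Perm.first_return_unique (S := {f : D.Endpoint | f.1 ∈ S})
      (by rw [hk]; exact d.emb_notMem _) (fun j h0 h1 => by simpa using hj j h0 h1)
      (by rw [hk']; exact d.emb_notMem _) (fun j h0 h1 => hj' j h0 h1)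
    subst hkk
    exact hinj (hk'.symm.trans hk)
  refine ⟨⟨fun v => s.lab (d.emb v), s.lab_inj.comp d.emb.injective,
    fun v => by rw [s.sign_lab, d.sign_eq], l', hn, hc, hnext, ?_⟩, fun _ => rfl, ?_⟩
  · conv_rhs => rw [← s.map_eq]
    rw [List.filter_map]
    have : (s.list.filter ((fun x : Label × Bool => decide (x.1 ∉ T)) ∘ D.letter s.lab)) =
        l'.map (Prod.map d.emb id) := by
      rw [hl']
      exact List.filter_congr fun e _ => hT e
    rw [this, List.map_map]
    refine List.map_congr_left fun e _ => ?_
    simp [letter, side, d.sign_eq]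
  · intro f a' hf ha'
    cases a' with
    | circle h =>
      obtain rfl : l' = [] := List.eq_nil_iff_forall_not_mem.2 fun e _ => h.elim e.1
      rfl
    | edge e' =>
      obtain ⟨A, g, rfl⟩ : ∃ A g, l' = A ++ [g] := by
        rcases List.eq_nil_or_concat' l' with rfl | h
        · exact absurd (hc e') List.not_mem_nil
        · exact h
      rw [List.map_append, List.map_singleton] at hl'
      obtain ⟨l₁, l₂, hl, -, h₂⟩ := List.filter_eq_append_iff.1 hl'.symm
      obtain ⟨Q, R, rfl, -, -, hR⟩ := List.filter_eq_cons_iff.1 h₂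
      rw [← List.append_assoc] at hl
      rw [List.filter_eq_nil_iff] at hR
      -- the deleted passages after the last remaining one lie on the closing arc
      have key : ∀ (R B : List D.Endpoint) (e : D.Endpoint), s.list = B ++ e :: R →
          (∀ x ∈ R, x.1 ∈ S) → d.Covers e (.edge g) → d.Covers f (.edge g) := by
        intro R
        induction R with
        | nil =>
          intro B e h _ hcov
          rw [h, List.getLast?_concat] at hf
          rwa [← Option.some.inj hf]
        | cons x R ih =>
          intro B e h hR hcov
          have hx := s.next_eq_of_list h
          refine ih (B ++ [e]) x (by simp [h]) (fun y hy => hR y (List.mem_cons_of_mem _ hy)) ?_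
          rw [← hx]
          exact d.covers_next hcov (by rw [hx]; exact hR x List.mem_cons_self)
      have := key R _ _ hl (fun x hx => by simpa using hR x hx) (d.covers_self g)
      rw [List.getLast?_concat, d.covers_unique this ha', Arc.start]

end GaussDiagram

/-! ### The parity cycle -/

namespace VirtualKnot

open GaussDiagram

variable {K : VirtualKnot} {A : Type*} [AddCommGroup A] {p : K.CrossingFamily A}

/-- The parity cycle of `p`: its coefficient at an arc `a` is the value of the bigon of the closing
arc with itself, for a Gauss code with the closing arc `a`. For a parity it does not depend on the
Gauss code (`IsOrientedParity.parityCycle_eq`). -/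
noncomputable def parityCycle (p : K.CrossingFamily A) : K.ChainFamily A := fun D a =>
  bigonValue p [] (D.1.exists_spelling a).choose

namespace IsOrientedParity

variable {L L' : Word} {D D' : K.Diagram}

/-- The value of the bigon of the closing arc with itself does not depend on the labels. -/
theorem bigonValue_nil_congr (hp : IsOrientedParity p) (s : Spelling D.1 L) (s' : Spelling D.1 L')
    (h : s.list = s'.list) : bigonValue p [] L = bigonValue p [] L' := by
  obtain ⟨N, hN⟩ := exists_bound (L ++ L')
  obtain ⟨u, hu⟩ : ∃ u : Label, u = (N, 1) := ⟨_, rfl⟩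
  obtain ⟨w, hw⟩ : ∃ w : Label, w = (N, -1) := ⟨_, rfl⟩
  have hus : u.2 = 1 := by rw [hu]
  have hws : w.2 = -1 := by rw [hw]
  have fu : Fresh u L ∧ Fresh u L' := fresh_append.1 (hu ▸ hN _ _ le_rfl)
  have fw : Fresh w L ∧ Fresh w L' := fresh_append.1 (hw ▸ hN _ _ le_rfl)
  clear hu hw hN
  have hs : w.2 = - u.2 := by rw [hus, hws]
  have hne : u ≠ w := ne_of_sign hs
  have hlu : ∀ v, s.lab v ≠ u := fun v => fu.1.fst_ne (s.mem (v, true))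
  have hlw : ∀ v, s.lab v ≠ w := fun v => fw.1.fst_ne (s.mem (v, true))
  have hlu' : ∀ v, s'.lab v ≠ u := fun v => fu.2.fst_ne (s'.mem (v, true))
  have hlw' : ∀ v, s'.lab v ≠ w := fun v => fw.2.fst_ne (s'.mem (v, true))
  let g : Label → Label := Function.extend s.lab s'.lab id
  have hgu : g u = u := Function.extend_apply' _ _ _ fun ⟨v, hv⟩ => hlu v hv
  have hgw : g w = w := Function.extend_apply' _ _ _ fun ⟨v, hv⟩ => hlw v hv
  have hg : ∀ v, g (s.lab v) = s'.lab v := fun v => s.lab_inj.extend_apply _ _ _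
  clear_value g
  have hL : L.map (Prod.map g id) = L' := by
    refine (congrArg _ s.map_eq.symm).trans (Eq.trans ?_ s'.map_eq)
    rw [List.map_map, h]
    exact List.map_congr_left fun e _ => Prod.ext (hg e.1) rfl
  have hb : K.Spells (bigon u w true [] L) :=
    Spells.bigon ⟨D, ⟨s⟩⟩ fu.1 fw.1 hs
  have hb' : K.Spells (bigon u w true [] L') :=
    Spells.bigon ⟨D, ⟨s'⟩⟩ fu.2 fw.2 hs
  have hmap : (bigon u w true [] L).map (Prod.map g id) = bigon u w true [] L' := by
    rw [← hL]
    simp [bigon, hgu, hgw]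
  have hcases : ∀ x ∈ bigon u w true [] L, x.1 = u ∨ x.1 = w ∨ ∃ v, x.1 = s.lab v := by
    intro x hx
    simp only [bigon, List.nil_append, List.mem_cons] at hx
    rcases hx with rfl | rfl | rfl | rfl | hx
    · exact .inl rfl
    · exact .inr (.inl rfl)
    · exact .inl rfl
    · exact .inr (.inl rfl)
    · obtain ⟨v, hv, -⟩ := s.exists_of_mem hx
      exact .inr (.inr ⟨v, hv.symm⟩)
  have := hp.wordValue_relabel hb (g := g) (fun x hx y hy hxy => by
      rcases hcases x hx with hx | hx | ⟨v, hx⟩ <;> rcases hcases y hy with hy | hy | ⟨v', hy⟩ <;>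
        rw [hx, hy] at hxy ⊢ <;> simp only [hgu, hgw, hg] at hxy
      · exact absurd hxy hne
      · exact absurd hxy.symm (hlu' _)
      · exact absurd hxy.symm hne
      · exact absurd hxy.symm (hlw' _)
      · exact absurd hxy (hlu' _)
      · exact absurd hxy (hlw' _)
      · rw [s'.lab_inj hxy])
    (fun x hx => by
      rcases hcases x hx with hx | hx | ⟨v, hx⟩ <;> rw [hx]
      · rw [hgu]
      · rw [hgw]
      · rw [hg, s.sign_lab, s'.sign_lab]) mem_bigon
  rw [hmap, hgu, hp.wordValue_bigon_true hb hs, hp.wordValue_bigon_true hb' hs] at this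
  exact this.symm

theorem parityCycle_eq (hp : IsOrientedParity p) (s : Spelling D.1 L) {a : D.1.Arc}
    (h : s.list.getLast? = a.start) : parityCycle p D a = bigonValue p [] L := by
  obtain ⟨s', hs'⟩ := (D.1.exists_spelling a).choose_spec
  exact hp.bigonValue_nil_congr s' s (s'.list_eq_of_getLast? s (hs'.trans h.symm))

/-! ### Self-moves -/

/-- A self-move is obtained from a bigon of the closing arc `a` with itself. -/
theorem exists_selfMove (D : K.Diagram) (a : D.1.Arc) :
    ∃ (D' : K.Diagram) (r : R2 D'.1 D.1), IsSelfMove r a := by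
  obtain ⟨L, s, hs⟩ := D.1.exists_spelling a
  obtain ⟨u, w, huw, hu, hw⟩ := exists_fresh L
  obtain ⟨M, hM⟩ : ∃ M, M = bigon u w true [] L := ⟨_, rfl⟩
  obtain ⟨D', ⟨s'⟩⟩ : K.Spells M := hM ▸ Spells.bigon ⟨D, ⟨s⟩⟩ hu hw huw
  have hfilter : L = M.filter fun x => x.1 ∉ [u, w] :=
    filter_r2 (X := []) (Y := []) (Z := L) (s := true) (.inl rfl) hM rfl (ne_of_sign huw)
      s'.isGauss
  obtain ⟨v, hv⟩ := s'.exists_lab_eq (c := u) (b := true) (hM ▸ mem_bigon)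
  obtain ⟨v', hv'⟩ := s'.exists_lab_eq (c := w) (b := true) (by simp [hM, bigon])
  subst hv hv'
  have hne : v ≠ v' := fun h => ne_of_sign huw (by rw [h])
  have n1 : D'.1.next (D'.1.pt v true) = D'.1.pt v' false :=
    s'.next_of_append (A := []) hM
  have n2 : D'.1.next (D'.1.pt v' false) = D'.1.pt v false :=
    s'.next_of_append (A := [(s'.lab v, true)]) hM
  have n3 : D'.1.next (D'.1.pt v false) = D'.1.pt v' true :=
    s'.next_of_append (A := [(s'.lab v, true), (s'.lab v', false)]) hM
  obtain ⟨r, h1, h2, h3⟩ := s'.exists_r2 s (v := v) (w := v') (b := true) hne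
    (by rw [← s'.sign_lab, ← s'.sign_lab, huw]) n1 (.inl n3) hfilter
  have hS : ∀ z, z ∈ ({r.x.1, (D'.1.next r.x).1} : Set D'.1.V) ↔
      s'.lab z ∈ [s'.lab v, s'.lab v'] := fun z => by
    simp only [List.mem_cons, s'.lab_inj.eq_iff, List.not_mem_nil, or_false, Set.mem_insert_iff,
      Set.mem_singleton_iff]
    rcases h2 with ⟨h2, h4⟩ | ⟨h2, h4⟩ <;> rw [h2, h4]
    exact or_comm
  -- the closing arc of the large diagram is a part of `a`
  have hcov : r.del.Covers (D'.1.next.symm (D'.1.pt v true)) a := by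
    obtain ⟨B, hB⟩ : ∃ B, s'.list = D'.1.pt v true :: B := by
      obtain ⟨e, B, hl, he, -⟩ := List.map_eq_cons_iff.1 (s'.map_eq.trans hM)
      refine ⟨B, ?_⟩
      rw [hl, letter_injective s'.lab_inj (he.trans (letter_pt s'.lab v true).symm)]
    obtain ⟨a', ha'⟩ := r.del.exists_covers (D'.1.next.symm (D'.1.pt v true))
    obtain ⟨s'', h4, h5⟩ := r.del.exists_spelling s' hS
    have h6 := h5 _ a' (s'.getLast?_of_cons hB) ha'
    rw [s''.list_eq_of_lab s hfilter.symm (fun z => (h4 z).trans (h1 z)), hs] at h6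
    rwa [Arc.start_injective h6]
  have hcov' : r.del.Covers (D'.1.pt v' false) a := by
    rw [← n1]
    refine r.del.covers_next ?_ ((hS _).2 (by rw [n1]; simp))
    rw [← Equiv.apply_symm_apply D'.1.next (D'.1.pt v true)]
    refine r.del.covers_next hcov ((hS _).2 ?_)
    rw [Equiv.apply_symm_apply]
    simp
  have hn : ∀ b b', D'.1.pt v' b ≠ D'.1.pt v b' := fun b b' h => hne (congrArg Prod.fst h).symm
  refine ⟨D', r, ?_⟩
  rcases h3 n3 with ⟨hx, hy⟩ | ⟨hx, hy⟩
  · have hz : D'.1.next r.x = D'.1.pt v' false := by rw [hx, n1]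
    refine ⟨by rw [hx, hy]; rfl, .inl ⟨by rw [hz, n2, hy]; rfl, .edge _ _ ?_ ?_
      (Eq.subst (motive := fun z => r.del.Covers z a) hz.symm hcov')⟩⟩
    · rw [hz, hx]
      exact hn _ _
    · rw [hz, hy]
      exact hn _ _
  · have hz : D'.1.next r.y = D'.1.pt v' false := by rw [hy, n1]
    refine ⟨by rw [hx, hy]; rfl, .inr ⟨by rw [hz, n2, hx]; rfl, .edge _ _ ?_ ?_
      (Eq.subst (motive := fun z => r.del.Covers z a) hz.symm hcov')⟩⟩
    · rw [hz, hx]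
      exact hn _ _
    · rw [hz, hy]
      exact hn _ _

end IsOrientedParity

/-- A word that begins with the four successive passages of a self-move is a bigon of the closing
arc with itself. -/
theorem _root_.GaussDiagram.Spelling.exists_selfMove_word {D : GaussDiagram} {L : Word}
    (s : Spelling D L) {e : D.Endpoint} (hs : s.list.getLast? = some (D.next.symm e))
    {u w : D.V} {b : Bool} (h1 : e = D.pt u b) (h2 : D.next e = D.pt w (!b))
    (h3 : D.next (D.pt w (!b)) = D.pt u (!b)) (h4 : D.next (D.pt u (!b)) = D.pt w b)
    (hne : u ≠ w) : ∃ R, L = bigon (s.lab u) (s.lab w) b [] R := by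
  obtain ⟨l₁, hl₁⟩ := s.exists_cons_of_getLast? hs
  have hlast : ∀ f, D.next f ≠ e → s.list.getLast? ≠ some f := fun f hf h => by
    rw [hs, Option.some.injEq] at h
    rw [← h, Equiv.apply_symm_apply] at hf
    exact hf rfl
  obtain ⟨l₂, rfl⟩ := s.exists_eq_cons (A := []) hl₁ (hlast _ (D.next_ne_self e))
  rw [h2] at hl₁
  obtain ⟨l₃, rfl⟩ := s.exists_eq_cons (A := [e]) hl₁ (hlast _ (by
    rw [h3, h1]
    intro h
    simpa using congrArg D.side h))
  rw [h3] at hl₁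
  obtain ⟨l₄, rfl⟩ := s.exists_eq_cons (A := [e, D.pt w (!b)]) hl₁ (hlast _ (by
    rw [h4, h1]
    exact fun h => hne (congrArg Prod.fst h).symm))
  rw [h4, h1] at hl₁
  refine ⟨l₄.map (D.letter s.lab), s.map_eq.symm.trans ?_⟩
  rw [hl₁, List.map_cons, List.map_cons, List.map_cons, List.map_cons, letter_pt, letter_pt,
    letter_pt, letter_pt]
  rfl

namespace IsOrientedParity

/-- All self-moves give the same value. -/
theorem eq_parityCycle_of_selfMove (hp : IsOrientedParity p) {D D' : K.Diagram} (r : R2 D'.1 D.1)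
    {a : D.1.Arc} (h : IsSelfMove r a) : parityCycle p D a = p D' r.x.1 := by
  -- the strand `e` of the self-move comes first, the strand `f` second
  obtain ⟨e, f, hef, hn, ha⟩ : ∃ e f, ((e = r.x ∧ f = r.y) ∨ (e = r.y ∧ f = r.x)) ∧
      D'.1.next (D'.1.next e) = f ∧ r.ArcCorr (.edge (D'.1.next e)) a := by
    rcases h.2 with ⟨h1, h2⟩ | ⟨h1, h2⟩
    exacts [⟨_, _, .inl ⟨rfl, rfl⟩, h1, h2⟩, ⟨_, _, .inr ⟨rfl, rfl⟩, h1, h2⟩]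
  have hcov : r.del.Covers (D'.1.next e) a := by cases ha with | edge _ _ _ _ h => exact h
  obtain ⟨u, w, bu, bw, hu, hw⟩ : ∃ u w bu bw, r.x = (u, bu) ∧ D'.1.next r.x = (w, bw) :=
    ⟨_, _, _, _, rfl, rfl⟩
  obtain ⟨u', w', bu', bw', hu', hw'⟩ : ∃ u w bu bw, r.y = (u, bu) ∧ D'.1.next r.y = (w, bw) :=
    ⟨_, _, _, _, rfl, rfl⟩
  have ho := r.over_x
  have hun := r.under_y
  have hch := r.chords
  have hne := r.ne
  have hs := r.sign_neg
  have h0 := h.1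
  have hS : ∀ z, z ∈ ({r.x.1, (D'.1.next r.x).1} : Set D'.1.V) ↔ z = u ∨ z = w := fun z => by
    rw [hw, hu]
    rfl
  rw [hw, hu] at ho hs hne
  rw [hw', hu'] at hun
  rw [hw, hu, hw', hu'] at hch
  rw [hu, hu'] at h0
  rw [hu]
  simp only at ho hun hch hs hne h0
  obtain ⟨rfl, rfl⟩ := ho
  obtain ⟨rfl, rfl⟩ := hun
  subst h0
  obtain rfl : w' = w := by
    rcases hch with h | h
    · exact h.2
    · exact absurd h.1 hne
  obtain ⟨b, hb1, hb2, hb3, hb4⟩ : ∃ b, e = D'.1.pt u' b ∧ D'.1.next e = D'.1.pt w' (!b) ∧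
      f = D'.1.pt u' (!b) ∧ D'.1.next f = D'.1.pt w' b := by
    refine ⟨D'.1.side e, ?_⟩
    rcases Int.units_eq_one_or (D'.1.sign u') with h1 | h1 <;> rw [h1] at hs <;>
      rcases hef with ⟨rfl, rfl⟩ | ⟨rfl, rfl⟩ <;> rw [hw, hw', hu, hu'] <;>
      simp [pt, side, h1, hs]
  rw [hb2] at hn
  rw [hb3] at hn hb4
  obtain ⟨L, s, hlast⟩ := D'.1.exists_spelling (.edge (D'.1.next.symm e))
  obtain ⟨R, hL⟩ := s.exists_selfMove_word hlast hb1 hb2 hn hb4 hne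
  have hws : (s.lab w').2 = - (s.lab u').2 := by rw [s.sign_lab, s.sign_lab, hs]
  have hfilter : R = L.filter fun x => x.1 ∉ [s.lab u', s.lab w'] :=
    filter_r2 (X := []) (Y := []) (Z := R) (s := b) (.inl rfl) hL rfl (ne_of_sign hws) s.isGauss
  have he : e.1 = u' := by rw [hb1]; rfl
  have hcov' : r.del.Covers (D'.1.next.symm e) a := by
    refine r.del.covers_prev ?_ ((hS _).2 (.inl he))
    have := r.del.covers_prev hcov ((hS _).2 (.inr (by rw [hb2]; rfl)))
    rwa [Equiv.symm_apply_apply] at this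
  obtain ⟨s', -, hs'⟩ := r.del.exists_spelling s (T := [s.lab u', s.lab w']) fun z => by
    rw [hS]
    simp [s.lab_inj.eq_iff]
  have hR := hp.parityCycle_eq s' (hs' _ a hlast hcov')
  rw [← hfilter] at s' hR
  have hp' : p D' u' = wordValue p (bigon (s.lab u') (s.lab w') b [] R) (s.lab u') :=
    (hp.wordValue_eq s u').symm.trans (congrArg (fun M => wordValue p M (s.lab u')) hL)
  have hK : K.Spells (bigon (s.lab u') (s.lab w') b [] R) := by
    have := (⟨D', ⟨s⟩⟩ : K.Spells L)
    exact hL.subst (motive := K.Spells) this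
  rw [hR, hp', hp.wordValue_bigon hK hws, sidedBigonValue]
  split_ifs
  · rfl
  · exact (hp.bigonValue_nil_right ⟨D, ⟨s'⟩⟩).symm

theorem isParityCycle_parityCycle (hp : IsOrientedParity p) : IsParityCycle p (parityCycle p) :=
  fun D a => ⟨exists_selfMove D a, fun _ r h => hp.eq_parityCycle_of_selfMove r h⟩

end IsOrientedParity

end VirtualKnot

/-! ### Invariance of the parity cycle -/

namespace VirtualKnot

open GaussDiagram

variable {K : VirtualKnot} {A : Type*} [AddCommGroup A] {p : K.CrossingFamily A}

theorem filter_bigon {u w : Label} {L : Word} {T : List Label} (hu : u ∉ T) (hw : w ∉ T) :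
    bigon u w true [] (L.filter fun x => x.1 ∉ T) =
      (bigon u w true [] L).filter fun x => x.1 ∉ T := by
  simp [bigon, hu, hw]

theorem isGauss_bigon_filter {u w : Label} {L : Word} {T : List Label} (hs : w.2 = - u.2)
    (hu : Fresh u L) (hw : Fresh w L) (h : IsGauss (L.filter fun x => x.1 ∉ T)) :
    IsGauss (bigon u w true [] (L.filter fun x => x.1 ∉ T)) :=
  (isGauss_r2 (X := []) (Y := []) (s := true) (.inl rfl) rfl rfl (ne_of_sign hs)).2
    ⟨fun b hb => hu b (List.mem_of_mem_filter hb), fun b hb => hw b (List.mem_of_mem_filter hb), h⟩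

/-- A diagram that is spelled by a bigon before a spelling of `D`: the passages of `D` follow each
other as they do in `D`, except at the closing arc. -/
theorem exists_lift_bigon {D D₁ : GaussDiagram} {L : Word} {u w : Label} (s : Spelling D L)
    (s₁ : Spelling D₁ (bigon u w true [] L)) :
    ∃ ι : D.V → D₁.V, Function.Injective ι ∧ (∀ v, s₁.lab (ι v) = s.lab v) ∧
      (∀ v, D₁.sign (ι v) = D.sign v) ∧
      ∀ e, s.list.getLast? ≠ some e → D₁.next (Prod.map ι id e) = Prod.map ι id (D.next e) :=
  s.exists_lift (W := [(u, true), (w, false), (u, false), (w, true)]) s₁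

namespace IsOrientedParity

variable {L L' : Word} {D D' : K.Diagram}

/-- The value of the bigon of the closing arc with itself is preserved if, in the presence of this
bigon, a move leads from `L` to `L'`. -/
theorem bigonValue_nil_eq_of_move (hp : IsOrientedParity p) (s : Spelling D.1 L)
    (h : ∀ u w, w.2 = - u.2 → Fresh u L → Fresh w L → ∀ (D₁ : K.Diagram)
      (s₁ : Spelling D₁.1 (bigon u w true [] L)), ∃ (D₁' : GaussDiagram)
      (s₁' : Spelling D₁' (bigon u w true [] L')) (m : Move D₁.1 D₁'),
      ∀ v', ∃ v, m.CrossingCorr v v' ∧ s₁.lab v = s₁'.lab v') :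
    bigonValue p [] L = bigonValue p [] L' := by
  obtain ⟨u, w, hs, hu, hw⟩ := exists_fresh L
  have hb : K.Spells (bigon u w true [] L) := Spells.bigon ⟨D, ⟨s⟩⟩ hu hw hs
  obtain ⟨D₁, ⟨s₁⟩⟩ := hb
  obtain ⟨D₁', s₁', m, hm⟩ := h u w hs hu hw D₁ s₁
  have hD₁' := mk_eq_of_move' m
  rw [← hp.wordValue_bigon_true ⟨D₁, ⟨s₁⟩⟩ hs,
    ← hp.wordValue_bigon_true ⟨⟨D₁', hD₁'⟩, ⟨s₁'⟩⟩ hs]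
  exact hp.wordValue_eq_of_move (D' := ⟨D₁', hD₁'⟩) s₁ s₁' m mem_bigon hm

theorem parityCycle_r1 (hp : IsOrientedParity p) (r : R1 D.1 D'.1) {f : D.1.Endpoint}
    {a' : D'.1.Arc} (hx : f ≠ r.x) (hc : r.del.Covers f a') :
    parityCycle p D (.edge f) = parityCycle p D' a' := by
  obtain ⟨L, s, hs⟩ := D.1.exists_spelling (.edge f)
  obtain ⟨s', -, hs'⟩ := r.del.exists_spelling s (T := [s.lab r.x.1]) fun v => by
    rw [List.mem_singleton, s.lab_inj.eq_iff]
    rfl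
  rw [hp.parityCycle_eq s hs, hp.parityCycle_eq s' (hs' f a' hs hc)]
  refine hp.bigonValue_nil_eq_of_move s fun u w huw hu hw D₁ s₁ => ?_
  obtain ⟨ι, hι, hlab, -, hnext⟩ := exists_lift_bigon s s₁
  have hlu : ∀ v, u ≠ s.lab v := fun v => (hu.fst_ne (s.mem (v, true))).symm
  have hlw : ∀ v, w ≠ s.lab v := fun v => (hw.fst_ne (s.mem (v, true))).symm
  obtain ⟨D₁', ⟨s₁'⟩⟩ := (isGauss_bigon_filter huw hu hw s'.isGauss).exists_diagram
  obtain ⟨d, hd⟩ := s₁.exists_deletion s₁'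
    (filter_bigon (by simpa using hlu _) (by simpa using hlw _)) (S := {ι r.x.1}) fun v => by
      rw [List.mem_singleton, ← hlab, s₁.lab_inj.eq_iff]
      rfl
  have hn := hnext r.x fun h => hx (Option.some.inj (hs.symm.trans h))
  refine ⟨D₁', s₁', .r1 ⟨Prod.map ι id r.x, ⟨?_, ?_⟩, d⟩, fun v' => ⟨_, rfl, hd v'⟩⟩
  · rw [hn]
    exact congrArg ι r.next_x.1
  · rw [hn]
    exact r.next_x.2

theorem parityCycle_r2 (hp : IsOrientedParity p) (r : R2 D.1 D'.1) {f : D.1.Endpoint}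
    {a' : D'.1.Arc} (hx : f ≠ r.x) (hy : f ≠ r.y) (hc : r.del.Covers f a') :
    parityCycle p D (.edge f) = parityCycle p D' a' := by
  obtain ⟨L, s, hs⟩ := D.1.exists_spelling (.edge f)
  obtain ⟨s', -, hs'⟩ := r.del.exists_spelling s
    (T := [s.lab r.x.1, s.lab (D.1.next r.x).1]) fun v => by
      rw [List.mem_cons, List.mem_singleton, s.lab_inj.eq_iff, s.lab_inj.eq_iff]
      rfl
  rw [hp.parityCycle_eq s hs, hp.parityCycle_eq s' (hs' f a' hs hc)]
  refine hp.bigonValue_nil_eq_of_move s fun u w huw hu hw D₁ s₁ => ?_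
  obtain ⟨ι, hι, hlab, hsign, hnext⟩ := exists_lift_bigon s s₁
  have hlu : ∀ v, u ≠ s.lab v := fun v => (hu.fst_ne (s.mem (v, true))).symm
  have hlw : ∀ v, w ≠ s.lab v := fun v => (hw.fst_ne (s.mem (v, true))).symm
  obtain ⟨D₁', ⟨s₁'⟩⟩ := (isGauss_bigon_filter huw hu hw s'.isGauss).exists_diagram
  have hnx := hnext r.x fun h => hx (Option.some.inj (hs.symm.trans h))
  have hny := hnext r.y fun h => hy (Option.some.inj (hs.symm.trans h))
  obtain ⟨r₁, -, -, hr⟩ := s₁.exists_r2_of_passages s₁' (x := Prod.map ι id r.x)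
    (y := Prod.map ι id r.y) (by rw [hnx]; exact r.over_x) (by rw [hny]; exact r.under_y)
    (by rw [hnx]; exact fun h => r.ne (hι h))
    (by
      rw [hnx, hny]
      exact r.chords.imp (fun h => ⟨congrArg ι h.1, congrArg ι h.2⟩)
        fun h => ⟨congrArg ι h.1, congrArg ι h.2⟩)
    (by
      rw [hnx]
      exact (hsign _).trans (r.sign_neg.trans (congrArg _ (hsign _).symm)))
    (filter_bigon (by simpa using ⟨hlu _, hlu _⟩) (by simpa using ⟨hlw _, hlw _⟩)) fun v => by
      rw [List.mem_cons, List.mem_singleton, ← hlab, ← hlab, s₁.lab_inj.eq_iff, s₁.lab_inj.eq_iff,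
        hnx]
      rfl
  exact ⟨D₁', s₁', .r2 r₁, fun v' => ⟨_, rfl, hr v'⟩⟩

theorem parityCycle_r3 (hp : IsOrientedParity p) (r : R3 D.1 D'.1) {f : D.1.Endpoint}
    (hf : D.1.next f ≠ r.flip f) :
    parityCycle p D (.edge f) = parityCycle p D' (.edge (Prod.map r.equiv id (r.flip f))) := by
  obtain ⟨L, s, hs⟩ := D.1.exists_spelling (.edge f)
  obtain ⟨s', hs', -⟩ := r.exists_spelling s
  rw [hp.parityCycle_eq s hs, hp.parityCycle_eq s' (by rw [hs', List.getLast?_map, hs]; rfl)]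
  refine hp.bigonValue_nil_eq_of_move s fun u w huw hu hw D₁ s₁ => ?_
  obtain ⟨ι, hι, hlab, hsign, hnext⟩ := exists_lift_bigon s s₁
  have hadj : ∀ {ε : ℤˣ} {v v' : D.1.V} {b b' : Bool}, r.flip (v, b) = (v', b') →
      D.1.Adjacent ε (v, b) (v', b') → D₁.1.Adjacent ε (ι v, b) (ι v', b') := by
    intro ε v v' b b' h hadj
    have hlast : ∀ e g, r.flip e = g → D.1.next e = g → s.list.getLast? ≠ some e :=
      fun e g h1 h2 h3 => hf (by
        rw [Option.some.inj (hs.symm.trans h3), h2, h1])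
    rcases hadj.next_eq_or with ⟨rfl, h1⟩ | ⟨rfl, h1⟩
    · have := hnext _ (hlast _ _ h h1)
      rw [h1] at this
      rw [Adjacent, if_pos rfl]
      exact this
    · have := hnext _ (hlast _ _ (by rw [← h, r.flip_flip]) h1)
      rw [h1] at this
      rw [Adjacent, if_neg (by decide)]
      exact this
  obtain ⟨D₁', r₁, ha, hb, hc, -, -, -⟩ := exists_r3 D₁.1 (hι.ne r.ne_ab) (hι.ne r.ne_ac)
    (hι.ne r.ne_bc) (hadj r.flip_aT r.top) (hadj r.flip_aF r.mid) (hadj r.flip_bF r.bot)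
    (by rw [hsign, hsign, hsign]; exact r.triangle)
  obtain ⟨s₁', -, hlab'⟩ := r₁.exists_spelling s₁
  have hletter : ∀ v b, D₁.1.letter s₁.lab (ι v, b) = D.1.letter s.lab (v, b) := fun v b => by
    simp [letter, side, hlab, hsign]
  have hT : r₁.letterFlip s₁.lab = r.letterFlip s.lab := by
    rw [R3.letterFlip, R3.letterFlip, ha, hb, hc]
    simp only [hletter]
  have hfix : ∀ c, Fresh c L → ∀ b, r.letterFlip s.lab (c, b) = (c, b) := fun c hc b => by
    have hne : ∀ e, (c, b) ≠ D.1.letter s.lab e := fun e he => hc b (he ▸ s.mem e)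
    rw [R3.letterFlip, Equiv.Perm.mul_apply, Equiv.Perm.mul_apply,
      Equiv.swap_apply_of_ne_of_ne (hne _) (hne _), Equiv.swap_apply_of_ne_of_ne (hne _) (hne _),
      Equiv.swap_apply_of_ne_of_ne (hne _) (hne _)]
  have hword : (bigon u w true [] L).map (r₁.letterFlip s₁.lab) =
      bigon u w true [] (L.map (r.letterFlip s.lab)) := by
    rw [hT]
    simp [bigon, hfix u hu, hfix w hw]
  obtain ⟨s₂, hs₂⟩ : ∃ s₂ : Spelling D₁' (bigon u w true [] (L.map (r.letterFlip s.lab))),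
      s₂.lab = s₁'.lab := hword ▸ ⟨s₁', rfl⟩
  refine ⟨D₁', s₂, .r3 r₁, fun v' => ⟨r₁.equiv.symm v', r₁.equiv.apply_symm_apply v', ?_⟩⟩
  rw [hlab', Equiv.apply_symm_apply, hs₂]

theorem parityCycle_iso (hp : IsOrientedParity p) (i : Iso D.1 D'.1) {a : D.1.Arc} {a' : D'.1.Arc}
    (h : i.ArcCorr a a') : parityCycle p D a = parityCycle p D' a' := by
  obtain ⟨L, s, hs⟩ := D.1.exists_spelling a
  obtain ⟨s', hs'⟩ := i.exists_spelling s
  rw [hp.parityCycle_eq s hs, hp.parityCycle_eq s' ?_]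
  rw [hs', List.getLast?_map, hs]
  cases h <;> rfl

theorem parityCycle_move (hp : IsOrientedParity p) (m : Move D.1 D'.1) {a : D.1.Arc}
    {a' : D'.1.Arc} (h : m.ArcCorr a a') : parityCycle p D a = parityCycle p D' a' := by
  cases m with
  | iso i => exact hp.parityCycle_iso i h
  | r1 r =>
    obtain ⟨f, _, hx, hc⟩ := (h : r.ArcCorr a a')
    exact hp.parityCycle_r1 r hx hc
  | r1Inv r =>
    obtain ⟨f, _, hx, hc⟩ := (h : r.ArcCorr a' a)
    exact (hp.parityCycle_r1 r hx hc).symm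
  | r2 r =>
    obtain ⟨f, _, hx, hy, hc⟩ := (h : r.ArcCorr a a')
    exact hp.parityCycle_r2 r hx hy hc
  | r2Inv r =>
    obtain ⟨f, _, hx, hy, hc⟩ := (h : r.ArcCorr a' a)
    exact (hp.parityCycle_r2 r hx hy hc).symm
  | r3 r =>
    obtain ⟨f, hf⟩ := (h : r.ArcCorr a a')
    exact hp.parityCycle_r3 r hf

/-! ### A potential of the parity cycle -/

/-- Minus the values of the bigons between the closing arc and the arcs of the diagram: the arc that
starts at `e` lies behind the letter of `e`. For the closing arc itself this is its bigon with
itself. -/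
noncomputable def _root_.GaussDiagram.Spelling.bigonPotential {D : GaussDiagram} (s : Spelling D L)
    (p : K.CrossingFamily A) (e : D.Endpoint) : A :=
  - bigonValue p (L.take (s.list.idxOf e + 1)) (L.drop (s.list.idxOf e + 1))

theorem bigonPotential_eq (s : Spelling D.1 L) {l l' : List D.1.Endpoint} {e : D.1.Endpoint}
    (h : s.list = l ++ e :: l') : s.bigonPotential p e =
      - bigonValue p (l.map (D.1.letter s.lab) ++ [D.1.letter s.lab e])
        (l'.map (D.1.letter s.lab)) := by
  have hn := s.nodup
  rw [h] at hn
  have he : e ∉ l := fun he => by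
    rw [List.nodup_append] at hn
    exact hn.2.2 e he e List.mem_cons_self rfl
  have hidx : s.list.idxOf e = l.length := by
    rw [h, List.idxOf_append_of_notMem he, List.idxOf_cons_self, add_zero]
  have hL : L = (l.map (D.1.letter s.lab) ++ [D.1.letter s.lab e]) ++ l'.map (D.1.letter s.lab) :=
    s.map_eq.symm.trans (by rw [h]; simp)
  have hlen : l.length + 1 = (l.map (D.1.letter s.lab) ++ [D.1.letter s.lab e]).length := by simp
  rw [Spelling.bigonPotential, hidx]
  congr 2
  · exact (congrArg _ hL).trans (by rw [hlen, List.take_left])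
  · exact (congrArg _ hL).trans (by rw [hlen, List.drop_left])

theorem bigonPotential_symm_eq (hp : IsOrientedParity p) (s : Spelling D.1 L)
    {l l' : List D.1.Endpoint} {e : D.1.Endpoint} (h : s.list = l ++ e :: l') :
    s.bigonPotential p (D.1.next.symm e) = - bigonValue p (l.map (D.1.letter s.lab))
      (D.1.letter s.lab e :: l'.map (D.1.letter s.lab)) := by
  rcases List.eq_nil_or_concat' l with rfl | ⟨l, f, rfl⟩
  · -- the last arc of the list is the closing arc
    have hlast := s.getLast?_of_cons h
    rw [List.getLast?_eq_some_iff] at hlast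
    obtain ⟨l₁, hl₁⟩ := hlast
    have hmap : l₁.map (D.1.letter s.lab) ++ [D.1.letter s.lab (D.1.next.symm e)] =
        D.1.letter s.lab e :: l'.map (D.1.letter s.lab) := by
      have := congrArg (List.map (D.1.letter s.lab)) (hl₁.symm.trans h)
      simpa using this
    have hL : D.1.letter s.lab e :: l'.map (D.1.letter s.lab) = L := by
      refine Eq.trans ?_ s.map_eq
      rw [h]
      simp
    rw [bigonPotential_eq (l := l₁) (l' := []) s hl₁, hmap, List.map_nil,
      hp.bigonValue_nil_right (by rw [hL]; exact ⟨D, ⟨s⟩⟩)]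
  · rw [List.append_assoc] at h
    have hn := s.next_eq_of_list h
    rw [(Equiv.symm_apply_eq _).2 hn.symm, bigonPotential_eq s h]
    simp

theorem parityCycle_edge (hp : IsOrientedParity p) (s : Spelling D.1 L)
    {l l' : List D.1.Endpoint} {e : D.1.Endpoint} (h : s.list = l ++ e :: l') :
    parityCycle p D (.edge e) = bigonValue p [] (l'.map (D.1.letter s.lab) ++
      (l.map (D.1.letter s.lab) ++ [D.1.letter s.lab e])) := by
  obtain ⟨s', hs'⟩ := s.exists_rotate (A := l ++ [e]) (B := l') (by simp [h])
  rw [hp.parityCycle_eq s' (by rw [hs', ← List.append_assoc, List.getLast?_concat]; rfl)]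
  simp

theorem parityCycle_edge_symm (hp : IsOrientedParity p) (s : Spelling D.1 L)
    {l l' : List D.1.Endpoint} {e : D.1.Endpoint} (h : s.list = l ++ e :: l') :
    parityCycle p D (.edge (D.1.next.symm e)) = bigonValue p [] (D.1.letter s.lab e ::
      (l'.map (D.1.letter s.lab) ++ l.map (D.1.letter s.lab))) := by
  obtain ⟨s', hs'⟩ := s.exists_rotate h
  rw [hp.parityCycle_eq (a := .edge (D.1.next.symm e)) s' (s'.getLast?_of_cons hs')]
  simp

/-- The relations of `bigonValue_crossing`, for the crossing of a diagram. -/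
theorem crossing_relations (hp : IsOrientedParity p) (s : Spelling D.1 L) (v : D.1.V) :
    p D v = s.bigonPotential p (D.1.next.symm (D.1.ltr v)) - s.bigonPotential p (D.1.rtl v) ∧
    parityCycle p D (.edge (D.1.next.symm (D.1.ltr v))) =
      s.bigonPotential p (D.1.next.symm (D.1.rtl v)) - s.bigonPotential p (D.1.rtl v) ∧
    parityCycle p D (.edge (D.1.rtl v)) =
      s.bigonPotential p (D.1.ltr v) - s.bigonPotential p (D.1.next.symm (D.1.ltr v)) ∧
    parityCycle p D (.edge (D.1.ltr v)) + parityCycle p D (.edge (D.1.rtl v)) =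
      parityCycle p D (.edge (D.1.next.symm (D.1.ltr v))) +
        parityCycle p D (.edge (D.1.next.symm (D.1.rtl v))) := by
  have hlt : D.1.letter s.lab (D.1.ltr v) = (s.lab v, true) := by rw [← pt_true, letter_pt]
  have hrt : D.1.letter s.lab (D.1.rtl v) = (s.lab v, false) := by rw [← pt_false, letter_pt]
  have hK : K.Spells (s.list.map (D.1.letter s.lab)) := by
    rw [s.map_eq]
    exact ⟨D, ⟨s⟩⟩
  have hv : p D v = wordValue p (s.list.map (D.1.letter s.lab)) (s.lab v) :=
    (hp.wordValue_eq s v).symm.trans (by rw [s.map_eq])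
  obtain ⟨l₁, l₂, h⟩ := List.append_of_mem (s.complete (D.1.ltr v))
  have hr := s.complete (D.1.rtl v)
  rw [h, List.mem_append, List.mem_cons] at hr
  rcases hr with hr | hr | hr
  · obtain ⟨l₃, l₄, rfl⟩ := List.append_of_mem hr
    have h' : s.list = l₃ ++ D.1.rtl v :: (l₄ ++ D.1.ltr v :: l₂) := by simp [h]
    rw [hv, bigonPotential_eq s h, bigonPotential_eq s h', hp.bigonPotential_symm_eq s h,
      hp.bigonPotential_symm_eq s h', hp.parityCycle_edge s h, hp.parityCycle_edge s h',
      hp.parityCycle_edge_symm s h, hp.parityCycle_edge_symm s h']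
    rw [h'] at hK ⊢
    simp only [List.map_append, List.map_cons, hlt, hrt] at hK ⊢
    obtain ⟨e1, e2, e3, e4⟩ := hp.bigonValue_crossing' hK
    simp only [List.append_assoc, List.cons_append] at *
    clear hK hv h h' hr hlt hrt
    refine ⟨?_, ?_, ?_, ?_⟩ <;> grind
  · exact absurd hr (D.1.ltr_ne_rtl v v).symm
  · obtain ⟨l₃, l₄, rfl⟩ := List.append_of_mem hr
    have h' : s.list = (l₁ ++ D.1.ltr v :: l₃) ++ D.1.rtl v :: l₄ := by simp [h]
    rw [hv, bigonPotential_eq s h, bigonPotential_eq s h', hp.bigonPotential_symm_eq s h,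
      hp.bigonPotential_symm_eq s h', hp.parityCycle_edge s h, hp.parityCycle_edge s h',
      hp.parityCycle_edge_symm s h, hp.parityCycle_edge_symm s h']
    rw [h] at hK ⊢
    simp only [List.map_append, List.map_cons, hlt, hrt] at hK ⊢
    obtain ⟨e1, e2, e3, e4⟩ := hp.bigonValue_crossing hK
    simp only [List.append_assoc, List.cons_append] at *
    clear hK hv h h' hr hlt hrt
    refine ⟨?_, ?_, ?_, ?_⟩ <;> grind

theorem isPotential_bigonPotential (hp : IsOrientedParity p) (s : Spelling D.1 L) :
    D.1.IsPotential (parityCycle p D) (s.bigonPotential p) where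
  ltr v := by rw [(hp.crossing_relations s v).2.2.1]; abel
  rtl v := by rw [(hp.crossing_relations s v).2.1]; abel

theorem isNormalizedInvariantCycle_parityCycle (hp : IsOrientedParity p) :
    IsNormalizedInvariantCycle (parityCycle p) where
  cycle D := by
    rw [mem_H1_iff]
    intro v
    obtain ⟨L, s, -⟩ := D.1.exists_spelling (.edge (v, true))
    exact (hp.crossing_relations s v).2.2.2.symm
  invariant D D' m a a' h := hp.parityCycle_move m h
  normalized D := by
    rcases isEmpty_or_nonempty D.1.V with hV | ⟨⟨v⟩⟩
    · exact Finset.sum_of_isEmpty _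
    · obtain ⟨L, s, -⟩ := D.1.exists_spelling (.edge (v, true))
      exact (hp.isPotential_bigonPotential s).inter_fundamental_eq_zero

theorem intersectionParity_parityCycle (hp : IsOrientedParity p) :
    intersectionParity (parityCycle p) = p := by
  funext D v
  obtain ⟨L, s, -⟩ := D.1.exists_spelling (.edge (v, true))
  rw [intersectionParity_eq_jump (hp.isPotential_bigonPotential s), (hp.crossing_relations s v).1]
  rfl

end IsOrientedParity

/-! ### The isomorphism -/

/-- Self-moves exist, so a parity has at most one parity cycle. -/
theorem IsParityCycle.unique {B : Type*} {p : K.CrossingFamily B} {δ δ' : K.ChainFamily B}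
    (h : IsParityCycle p δ) (h' : IsParityCycle p δ') : δ = δ' := by
  funext D a
  obtain ⟨⟨D', r, hr⟩, h1⟩ := h D a
  rw [h1 D' r hr, (h' D a).2 D' r hr]

theorem IsNormalizedInvariantCycle.isParityCycle {δ : K.ChainFamily A}
    (hδ : IsNormalizedInvariantCycle δ) : IsParityCycle (intersectionParity δ) δ :=
  fun D a => ⟨IsOrientedParity.exists_selfMove D a, fun _ r h => hδ.intersectionParity_selfMove r h⟩

variable (K A) in
/-- The homomorphism from normalized invariant cycles to oriented parities. -/
noncomputable def intersectionParityHom :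
    K.normalizedInvariantCycles A →+ K.orientedParities A where
  toFun δ := ⟨intersectionParity δ.1, δ.2.isOrientedParity⟩
  map_zero' := by
    ext D v
    simp [intersectionParity, inter]
  map_add' δ η := by
    ext D v
    simp only [intersectionParity, inter, AddSubgroup.coe_add, Pi.add_apply, smul_add,
      ← Finset.sum_add_distrib]
    exact Finset.sum_congr rfl fun v _ => by abel

theorem intersectionParityHom_bijective : Function.Bijective (intersectionParityHom K A) := by
  refine ⟨fun δ η h => Subtype.ext ?_, fun p => ?_⟩
  · have hη := η.2.isParityCycle
    rw [← show intersectionParity δ.1 = intersectionParity η.1 from congrArg Subtype.val h] at hη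
    exact δ.2.isParityCycle.unique hη
  · exact ⟨⟨parityCycle p.1, p.2.isNormalizedInvariantCycle_parityCycle⟩,
      Subtype.ext p.2.intersectionParity_parityCycle⟩

end VirtualKnot

theorem mainTheorem2 (K : VirtualKnot) (A : Type*) [AddCommGroup A] :
    (∀ δ : K.ChainFamily A, VirtualKnot.IsNormalizedInvariantCycle δ →
      VirtualKnot.IsOrientedParity (VirtualKnot.intersectionParity δ)) ∧
    (∀ p : K.CrossingFamily A, VirtualKnot.IsOrientedParity p →
      ∃! δ : K.ChainFamily A, VirtualKnot.IsParityCycle p δ) ∧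
    (∀ (p : K.CrossingFamily A) (δ : K.ChainFamily A), VirtualKnot.IsOrientedParity p →
      VirtualKnot.IsParityCycle p δ →
      VirtualKnot.IsNormalizedInvariantCycle δ ∧ VirtualKnot.intersectionParity δ = p) ∧
    (∀ δ : K.ChainFamily A, VirtualKnot.IsNormalizedInvariantCycle δ →
      VirtualKnot.IsParityCycle (VirtualKnot.intersectionParity δ) δ) ∧
    ∃ e : K.normalizedInvariantCycles A ≃+ K.orientedParities A,
      (∀ δ, (e δ : K.CrossingFamily A) =
        VirtualKnot.intersectionParity (δ : K.ChainFamily A)) ∧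
      ∀ p : K.orientedParities A, VirtualKnot.IsParityCycle (p : K.CrossingFamily A)
        (e.symm p : K.ChainFamily A) := by
  refine ⟨fun δ hδ => hδ.isOrientedParity,
    fun p hp => ⟨_, hp.isParityCycle_parityCycle, fun δ hδ =>
      hδ.unique hp.isParityCycle_parityCycle⟩,
    fun p δ hp hδ => ?_, fun δ hδ => hδ.isParityCycle,
    AddEquiv.ofBijective (VirtualKnot.intersectionParityHom K A)
      VirtualKnot.intersectionParityHom_bijective, fun δ => rfl, fun p => ?_⟩
  · rw [hδ.unique hp.isParityCycle_parityCycle]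
    exact ⟨hp.isNormalizedInvariantCycle_parityCycle, hp.intersectionParity_parityCycle⟩
  · have h := (AddEquiv.ofBijective (VirtualKnot.intersectionParityHom K A)
      VirtualKnot.intersectionParityHom_bijective).apply_symm_apply p
    have h' := ((AddEquiv.ofBijective (VirtualKnot.intersectionParityHom K A)
      VirtualKnot.intersectionParityHom_bijective).symm p).2.isParityCycle
    rwa [show VirtualKnot.intersectionParity _ = (p : K.CrossingFamily A) from
      congrArg Subtype.val h] at h'
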